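/- Let $n\ge 3$ and $1\le m\le n$ be integers. Let $M$ be a connected, complete, smooth $n$-dimensional Riemannian manifold, isometrically immersed in the unit sphere $S^{n+1}\subset\mathbb R^{n+2}$ as an oriented hypersurface, with smooth unit normal field $N$, and let $\lambda_1,\dots,\lambda_n$ be its principal curvatures (the eigenvalues of the shape operator $A$, $df\circ A=-dN$, where $f$ is the immersion). Suppose that the $m$-th mean curvature $H_m=\binom nm^{-1}\sum_{i_1<\dots<i_m}\lambda_{i_1}\cdots\lambda_{i_m}$ is constant, and that at every point $M$ has exactly two distinct principal curvatures, $\lambda$ of multiplicity $n-1$ and $\mu$ of multiplicity $1$, where $\lambda>0$ on $M$. Then $M$ is isometric to a complete hypersurface of revolution $S^{n-1}(c(s))\times M^1$, in the following sense. There are $T\ge 0$ and a smooth diffeomorphism $\Phi:S^{n-1}\times M^1\to M$, where $S^{n-1}$ is the unit sphere of $\mathbb R^n$ and $M^1=\mathbb R/T\mathbb Z$ with arc length parameter $s$ (so $M^1$ is $\mathbb R$ if $T=0$ and a circle of length $T$ if $T>0$), such that: 1. $\lambda\circ\Phi$ is a smooth function $\lambda(s)$ of $s$ alone, and $\lambda(s)^m-H_m>0$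 for all $s$. The slices $\Phi(S^{n-1}\times\{s\})$ are tangent to the principal directions of $\lambda$, and the curves $s\mapsto\Phi(p,s)$ are tangent to those of $\mu$. 2. $\Phi^*g_M=ds^2+\frac1{c(s)}\,g_{S^{n-1}}$, where $g_M$ is the metric of $M$ and $g_{S^{n-1}}$ the round metric of curvature $1$; that is, the slice over $s$ is a round sphere $S^{n-1}(c(s))$ of constant curvature $$c(s)=\Big[\frac{d}{ds}\log|\lambda^m-H_m|^{1/n}\Big]^2+\lambda^2+1 .$$ 3. Up to a linear isometry $\mathbb R^n\times\mathbb R^2\cong\mathbb R^{n+2}$, $f(\Phi(p,s))=(r(s)\,p,\;y(s))$ with $r(s)=c(s)^{-1/2}$, where $s\mapsto(r(s),y(s))\in\mathbb R\times\mathbb R^2$ is a smooth curve in $S^2$ parametrized by arc length. 4. The function $w=|\lambda^m-H_m|^{-1/n}$ is smooth in $s\in\mathbb R$ and satisfies $$\frac{d^2w}{ds^2}-w\left\{\frac{(n-m)(w^{-n}+H_m)^{(2-m)/m}}{m\,w^n}-H_m(w^{-n}+H_m)^{(2-m)/m}-1\right\}=0 .$$ -/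

import Mathlib

open Metric
open scoped Manifold ContDiff Bundle

noncomputable section

namespace SphereHypersurface

/-- Euclidean space `ℝᵏ`. -/
abbrev EE (k : ℕ) : Type := EuclideanSpace ℝ (Fin k)

/-- The unit sphere `S^{n-1}` of `ℝⁿ`. -/
abbrev USphere (n : ℕ) : Type := sphere (0 : EE n) 1

/-- Makes `S^{n-1} ⊂ ℝⁿ` a smooth manifold of dimension `n - 1`. -/
instance factFinrank (n : ℕ) [h : Fact (3 ≤ n)] :
    Fact (Module.finrank ℝ (EE n) = (n - 1) + 1) :=
  ⟨by have := h.out; simp only [finrank_euclideanSpace, Fintype.card_fin]; omega⟩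

section Hypersurface

variable {n : ℕ} {M : Type*} [EMetricSpace M] [ChartedSpace (EE n) M]

/-- The differential at `x` of a vector valued map `g` on `M`. -/
def diffl {k : ℕ} (g : M → EE k) (x : M) : TangentSpace (𝓡 n) x →ₗ[ℝ] EE k :=
  (mfderiv (𝓡 n) 𝓘(ℝ, EE k) g x : TangentSpace (𝓡 n) x →L[ℝ] EE k).toLinearMap

instance finiteDimensional_tangentSpace (x : M) : FiniteDimensional ℝ (TangentSpace (𝓡 n) x) :=
  inferInstanceAs (FiniteDimensional ℝ (EE n))

/-- The shape operator `A` of the hypersurface `f` with unit normal `N`, that is, the endomorphism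
of `T_x M` with `df (A v) = -dN v`, see `IsOrientedHypersurface.diffl_shapeOperator`. -/
def shapeOperator (f N : M → EE (n + 2)) (x : M) : Module.End ℝ (TangentSpace (𝓡 n) x) :=
  -((diffl f x).leftInverse ∘ₗ diffl N x)

/-- The principal curvatures at `x`, repeated according to multiplicity: the eigenvalues of the
shape operator. -/
def principalCurvatures (f N : M → EE (n + 2)) (x : M) : Multiset ℝ :=
  (shapeOperator f N x).charpoly.roots

/-- The `m`-th mean curvature `H_m`: the `m`-th elementary symmetric function of the principal
curvatures divided by the binomial coefficient `n choose m`. -/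
def meanCurvature (f N : M → EE (n + 2)) (m : ℕ) (x : M) : ℝ :=
  (principalCurvatures f N x).esymm m / (n.choose m : ℝ)

/-- At every point the hypersurface has exactly the two distinct principal curvatures `lam`, of
multiplicity `n - 1`, and `mu`, which is simple. -/
structure HasTwoPrincipalCurvatures (f N : M → EE (n + 2)) (lam mu : M → ℝ) : Prop where
  distinct : ∀ x, lam x ≠ mu x
  multiplicity : ∀ x,
    Module.finrank ℝ (Module.End.eigenspace (shapeOperator f N x) (lam x)) = n - 1
  simple : ∀ x, Module.finrank ℝ (Module.End.eigenspace (shapeOperator f N x) (mu x)) = 1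

theorem inner_diffl_add {k : ℕ} {g h : M → EE k} {x : M} {c : ℝ}
    (hg : MDifferentiableAt (𝓡 n) 𝓘(ℝ, EE k) g x) (hh : MDifferentiableAt (𝓡 n) 𝓘(ℝ, EE k) h x)
    (hc : ∀ y, inner ℝ (g y) (h y) = c) (v : TangentSpace (𝓡 n) x) :
    inner ℝ (g x) (diffl h x v) + inner ℝ (diffl g x v) (h x) = 0 := by
  have h1 := hg.hasMFDerivAt.2.inner ℝ hh.hasMFDerivAt.2
  have h4 : (fun t ↦ inner ℝ (writtenInExtChartAt (𝓡 n) 𝓘(ℝ, EE k) x g t)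
      (writtenInExtChartAt (𝓡 n) 𝓘(ℝ, EE k) x h t)) = fun _ ↦ c := by
    funext t; exact hc _
  rw [h4] at h1
  have hu : UniqueDiffWithinAt ℝ (Set.range (𝓡 n)) (extChartAt (𝓡 n) x x) :=
    (𝓡 n).uniqueDiffOn _ (extChartAt_target_subset_range (I := 𝓡 n) x (mem_extChartAt_target x))
  have h5 := hu.eq h1 (hasFDerivWithinAt_const c _ _)
  have h6 := DFunLike.congr_fun h5 v
  have e1 : writtenInExtChartAt (𝓡 n) 𝓘(ℝ, EE k) x g (extChartAt (𝓡 n) x x) = g x :=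
    congrArg g (extChartAt_to_inv (I := 𝓡 n) x)
  have e2 : writtenInExtChartAt (𝓡 n) 𝓘(ℝ, EE k) x h (extChartAt (𝓡 n) x x) = h x :=
    congrArg h (extChartAt_to_inv (I := 𝓡 n) x)
  rw [e1, e2] at h6
  exact h6

variable [Bundle.RiemannianBundle (fun x : M ↦ TangentSpace (𝓡 n) x)]

/-- `f` is a smooth isometric immersion of the Riemannian manifold `M` into the unit sphere
`S^{n+1} ⊂ ℝ^{n+2}`, and `N` is a smooth unit normal vector field of `M` in `S^{n+1}` along `f`
(that is, an orientation of the hypersurface). -/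
structure IsOrientedHypersurface (f N : M → EE (n + 2)) : Prop where
  contMDiff : ContMDiff (𝓡 n) 𝓘(ℝ, EE (n + 2)) ∞ f
  mem_sphere : ∀ x, f x ∈ sphere (0 : EE (n + 2)) 1
  isometric : ∀ (x : M) (v w : TangentSpace (𝓡 n) x),
    inner ℝ (diffl f x v) (diffl f x w) = inner ℝ v w
  contMDiff_normal : ContMDiff (𝓡 n) 𝓘(ℝ, EE (n + 2)) ∞ N
  norm_normal : ∀ x, ‖N x‖ = 1
  normal_tangent_sphere : ∀ x, inner ℝ (N x) (f x) = 0
  normal_orthogonal : ∀ (x : M) (v : TangentSpace (𝓡 n) x), inner ℝ (N x) (diffl f x v) = 0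

theorem IsOrientedHypersurface.diffl_shapeOperator {f N : M → EE (n + 2)}
    (h : IsOrientedHypersurface f N) (x : M) (v : TangentSpace (𝓡 n) x) :
    diffl f x (shapeOperator f N x v) = -diffl N x v := by
  have hfd : MDifferentiableAt (𝓡 n) 𝓘(ℝ, EE (n + 2)) f x :=
    h.contMDiff.contMDiffAt.mdifferentiableAt (by simp)
  have hNd : MDifferentiableAt (𝓡 n) 𝓘(ℝ, EE (n + 2)) N x :=
    h.contMDiff_normal.contMDiffAt.mdifferentiableAt (by simp)
  have hinj : LinearMap.ker (diffl (n := n) f x) = ⊥ := by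
    rw [LinearMap.ker_eq_bot']
    intro w hw
    have hw2 := h.isometric x w w
    rw [hw, inner_zero_left] at hw2
    exact inner_self_eq_zero.1 hw2.symm
  have hff : ∀ y, inner ℝ (f y) (f y) = (1 : ℝ) := fun y ↦ by
    have := h.mem_sphere y
    rw [mem_sphere_zero_iff_norm] at this
    rw [real_inner_self_eq_norm_sq, this]; norm_num
  have hNN : ∀ y, inner ℝ (N y) (N y) = (1 : ℝ) := fun y ↦ by
    rw [real_inner_self_eq_norm_sq, h.norm_normal]; norm_num
  have hfF (w : TangentSpace (𝓡 n) x) : inner ℝ (f x) (diffl f x w) = (0 : ℝ) := by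
    have := inner_diffl_add hfd hfd hff w
    rw [real_inner_comm] at this ⊢
    linarith [real_inner_comm (f x) (diffl f x w)]
  have hNG (w : TangentSpace (𝓡 n) x) : inner ℝ (N x) (diffl N x w) = (0 : ℝ) := by
    have := inner_diffl_add hNd hNd hNN w
    linarith [real_inner_comm (N x) (diffl N x w)]
  have hfG (w : TangentSpace (𝓡 n) x) : inner ℝ (f x) (diffl N x w) = (0 : ℝ) := by
    have := inner_diffl_add hNd hfd h.normal_tangent_sphere w
    rw [h.normal_orthogonal, zero_add, real_inner_comm] at this
    exact this
  let e : Fin 2 → EE (n + 2) := ![N x, f x]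
  have he : Orthonormal ℝ e := by
    rw [orthonormal_iff_ite]
    intro i j
    have h1 := h.normal_tangent_sphere x
    have h2 : inner ℝ (f x) (N x) = (0 : ℝ) := by rw [real_inner_comm]; exact h1
    fin_cases i <;> fin_cases j <;> simp only [e] <;>
      first
        | simpa using hNN x
        | simpa using hff x
        | simpa using h1
        | simpa using h2
  let W := Submodule.span ℝ (Set.range e)
  have hW : ∀ z, z ∈ Wᗮ ↔ inner ℝ (N x) z = (0 : ℝ) ∧ inner ℝ (f x) z = (0 : ℝ) := by
    intro z
    simp only [W, Submodule.mem_orthogonal]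
    constructor
    · intro hz
      exact ⟨hz _ (Submodule.subset_span ⟨0, rfl⟩), hz _ (Submodule.subset_span ⟨1, rfl⟩)⟩
    · rintro ⟨hz1, hz2⟩ u hu
      induction hu using Submodule.span_induction with
      | mem u hu =>
        obtain ⟨i, rfl⟩ := hu
        fin_cases i
        · exact hz1
        · exact hz2
      | zero => simp
      | add a b _ _ ha hb => rw [inner_add_left, ha, hb, add_zero]
      | smul t a _ ha => rw [real_inner_smul_left, ha, mul_zero]
  have hdW : Module.finrank ℝ Wᗮ = n := by
    have h1 := Submodule.finrank_add_finrank_orthogonal W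
    have h2 : Module.finrank ℝ W = 2 := by
      rw [finrank_span_eq_card he.linearIndependent]; simp
    rw [h2, finrank_euclideanSpace, Fintype.card_fin] at h1
    omega
  have hdR : Module.finrank ℝ (LinearMap.range (diffl (n := n) f x)) = n := by
    rw [LinearMap.finrank_range_of_inj (LinearMap.ker_eq_bot.1 hinj)]
    exact finrank_euclideanSpace_fin (𝕜 := ℝ) (n := n)
  have hle : LinearMap.range (diffl (n := n) f x) ≤ Wᗮ := by
    rintro _ ⟨w, rfl⟩
    exact (hW _).2 ⟨h.normal_orthogonal x w, hfF w⟩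
  have heq := Submodule.eq_of_le_of_finrank_eq hle (hdR.trans hdW.symm)
  have hmem : diffl N x v ∈ LinearMap.range (diffl (n := n) f x) := by
    rw [heq]; exact (hW _).2 ⟨hNG v, hfG v⟩
  obtain ⟨w, hw⟩ := hmem
  simp only [shapeOperator, LinearMap.neg_apply, LinearMap.comp_apply, map_neg]
  rw [← hw, LinearMap.leftInverse_apply_of_inj hinj]

variable [Fact (3 ≤ n)]

/-- `Φ : S^{n-1} × M¹ → M`, with `M¹ = ℝ / Tℤ` (which is `ℝ` for `T = 0` and a circle of length `T`
for `T > 0`), composed with the projection `ℝ → M¹`. -/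
def lift {T : ℝ} (Φ : USphere n × AddCircle T ≃ₜ M) (q : USphere n × ℝ) : M :=
  Φ (q.1, (q.2 : AddCircle T))

/-- The differential of `lift Φ` at `(p, s)`, applied to the tangent vector `u + a ∂/∂s`. -/
def diffLift {T : ℝ} (Φ : USphere n × AddCircle T ≃ₜ M) (p : USphere n) (s : ℝ)
    (u : TangentSpace (𝓡 (n - 1)) p) (a : ℝ) : TangentSpace (𝓡 n) (lift Φ (p, s)) :=
  mfderiv ((𝓡 (n - 1)).prod 𝓘(ℝ, ℝ)) (𝓡 n) (lift Φ) (p, s)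
    ((u, a) : TangentSpace (𝓡 (n - 1)) p × ℝ)

/-- The length of a tangent vector of the unit sphere `S^{n-1}` in its round metric of
curvature `1`. -/
def sphereNorm (p : USphere n) (u : TangentSpace (𝓡 (n - 1)) p) : ℝ :=
  letI v : EE n := mfderiv (𝓡 (n - 1)) 𝓘(ℝ, EE n) (fun q : USphere n ↦ (q : EE n)) p u
  ‖v‖

/-- The homeomorphism `Φ : S^{n-1} × M¹ → M` is a smooth diffeomorphism and an isometry, where the
slice `S^{n-1} × {s}` carries the round metric of constant curvature `c s` (the unit round metric
divided by `c s`), `s` is the arc length of `M¹`, and the two factors are orthogonal. -/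
structure IsWarpedIsometry {T : ℝ} (c : ℝ → ℝ) (Φ : USphere n × AddCircle T ≃ₜ M) : Prop where
  pos : ∀ s, 0 < c s
  isLocalDiffeomorph :
    IsLocalDiffeomorph ((𝓡 (n - 1)).prod 𝓘(ℝ, ℝ)) (𝓡 n) ∞ (lift Φ)
  metric : ∀ (p : USphere n) (s : ℝ) (u : TangentSpace (𝓡 (n - 1)) p) (a : ℝ),
    ‖diffLift Φ p s u a‖ ^ 2 = sphereNorm p u ^ 2 / c s + a ^ 2

/-- `f ∘ Φ` is, up to a linear isometry `A` of the ambient space, the hypersurface of revolution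
`(p, s) ↦ (r(s) p, y(s)) ∈ ℝⁿ × ℝ²` generated by the profile curve `(r, y)` in `S²`, which is
smooth and parametrized by arc length, with `r > 0`. -/
def IsRevolution {T : ℝ} (f : M → EE (n + 2)) (r : ℝ → ℝ)
    (Φ : USphere n × AddCircle T ≃ₜ M) : Prop :=
  ∃ (y : ℝ → EE 2) (A : WithLp 2 (EE n × EE 2) ≃ₗᵢ[ℝ] EE (n + 2)),
    ContDiff ℝ ∞ r ∧ ContDiff ℝ ∞ y ∧ (∀ s, 0 < r s) ∧
    (∀ s, r s ^ 2 + ‖y s‖ ^ 2 = 1) ∧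
    (∀ s, deriv r s ^ 2 + ‖deriv y s‖ ^ 2 = 1) ∧
    ∀ (p : USphere n) (s : ℝ), f (lift Φ (p, s)) = A (WithLp.toLp 2 (r s • (p : EE n), y s))

end Hypersurface

/-- The function `(d/ds log |lam^m - H|^{1/n})² + lam² + 1`. -/
def sliceCurvature (n m : ℕ) (H : ℝ) (lam : ℝ → ℝ) (s : ℝ) : ℝ :=
  deriv (fun t ↦ Real.log (|lam t ^ m - H| ^ (1 / (n : ℝ)))) s ^ 2 + lam s ^ 2 + 1

/-- The function `w = |lam^m - H|^{-1/n}`. -/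
def wFun (n m : ℕ) (H : ℝ) (lam : ℝ → ℝ) (s : ℝ) : ℝ :=
  |lam s ^ m - H| ^ (-(1 / (n : ℝ)))

end SphereHypersurface

end

/-! Locally, let Z be the unit principal direction of mu, seen in the ambient space. The eigenspace
of lam has dimension n - 1 ≥ 2, so the Codazzi equation (`codazzi`) forces lam to be constant along
it (`deriv_lam_eq_zero`). Since H_m is constant and lam > 0, mu is a function of lam and is constant
there too. Hence d lam = (lam - mu) κ ⟨Z, dF⟩ for some function κ. Codazzi then determines dZ
(`deriv_Z`), and the symmetry of the second derivative of Z yields the Riccati equation dκ = (κ² + 1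
+ lam mu) ⟨Z, dF⟩ (`deriv_kappa`).

Consequently ξ = N + lam f and η = Z + κ f have derivatives in their own span (`deriv_xi`,
`deriv_eta`). The plane P they span is therefore locally constant (`eventually_plane_eq`) and, M
being connected, constant (`profilePlane_eq`). Splitting the ambient space into the complement of P
and P itself gives f = (f₁, f₂) and N = (-lam f₁, ξ - lam f₂). An infinitesimal rotation of the
first factor is then orthogonal to both f and N, hence tangent to M: the hypersurface is
infinitesimally invariant under rotations. All of this is recorded in `RotationalData`.

Completeness makes bounded smooth fields integrable for all time. Rotation fields sweep out the
slices, and the field e of mu-directions gives the profile curves. Polar coordinates on the sphere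
assemble them into a map Ψ from S^{n-1} × ℝ to M (`exists_rotationFamily`), a local diffeomorphism
with the warped product metric. Two such maps with a common value differ by a translation of s
(`rigid`). Hence Ψ is onto, and it identifies points only through a discrete group of periods Tℤ
(`exists_parametrization`).

Along a profile curve, l' = (l - mu) κ and κ' = 1 + κ² + l mu. Constancy of H_m turns the first
equation into (l^m - H)' = n κ (l^m - H), so w' = -κ w and w'' = -(1 + l mu) w, which is the stated
equation; the slice curvature is 1 + l² + κ² = r⁻². If l^m < H held somewhere, then mu > l > 0
everywhere on the curve, so κ' > 1 + κ² and κ would blow up in finite time; this settles the sign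
(`lt_pow`). -/

noncomputable section

namespace SphereHypersurface

/-! ### The inverse function theorem on manifolds -/

section InverseFunctionTheorem

variable {E : Type*} [NormedAddCommGroup E] [NormedSpace ℝ E]
  {E' : Type*} [NormedAddCommGroup E'] [NormedSpace ℝ E']
  {H : Type*} [TopologicalSpace H] {I : ModelWithCorners ℝ E H}
  {H' : Type*} [TopologicalSpace H'] {J : ModelWithCorners ℝ E' H'}
  {M : Type*} [TopologicalSpace M] [ChartedSpace H M]
  {M' : Type*} [TopologicalSpace M'] [ChartedSpace H' M']

/-- An extended chart of a boundaryless manifold as a partial diffeomorphism. -/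
def extChartPartialDiffeomorph [I.Boundaryless] [IsManifold I ∞ M] (x : M) :
    PartialDiffeomorph I 𝓘(ℝ, E) M E ∞ where
  toPartialEquiv := extChartAt I x
  open_source := isOpen_extChartAt_source x
  open_target := isOpen_extChartAt_target x
  contMDiffOn_toFun := by
    have h := contMDiffOn_extChartAt (I := I) (n := ∞) (x := x)
    rwa [← extChartAt_source I] at h
  contMDiffOn_invFun := contMDiffOn_extChartAt_symm x

/-- The inverse function theorem in normed spaces, as a statement on partial diffeomorphisms. -/
theorem exists_partialDiffeomorph_of_contDiffOn [CompleteSpace E] {g : E → E'} {U : Set E}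
    (hU : IsOpen U) (hg : ContDiffOn ℝ ∞ g U) {a : E} (ha : a ∈ U) (g' : E ≃L[ℝ] E')
    (hg' : HasFDerivAt g (g' : E →L[ℝ] E') a) :
    ∃ Φ : PartialDiffeomorph 𝓘(ℝ, E) 𝓘(ℝ, E') E E' ∞,
      a ∈ Φ.source ∧ Φ.source ⊆ U ∧ ∀ x, Φ x = g x := by
  have hca : ContDiffAt ℝ ∞ g a := hg.contDiffAt (hU.mem_nhds ha)
  let e := hca.toOpenPartialHomeomorph g hg' (by simp)
  have hcont : ContinuousAt (fderiv ℝ g) a :=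
    (hca.fderiv_right (m := 0) (by simp)).continuousAt
  -- Invertible operators form an open set. Shrinking to points with invertible derivative makes the
  -- inverse smooth on the whole target, not only at the image of `a`.
  have hnear : ∀ᶠ x in nhds a, fderiv ℝ g x ∈ Set.range ((↑) : (E ≃L[ℝ] E') → (E →L[ℝ] E')) := by
    refine hcont.eventually (ContinuousLinearEquiv.isOpen.mem_nhds ?_)
    exact ⟨g', hg'.fderiv.symm⟩
  obtain ⟨W, hW, hWo, haW⟩ := _root_.eventually_nhds_iff.1 (hnear.and (hU.mem_nhds ha))
  let e' := e.restrOpen W hWo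
  have hsrc : e'.source = e.source ∩ W := rfl
  have hsub : e'.source ⊆ W := Set.inter_subset_right
  refine ⟨⟨e'.toPartialEquiv, e'.open_source, e'.open_target, ?_, ?_⟩, ?_, ?_, fun x ↦ rfl⟩
  · rw [contMDiffOn_iff_contDiffOn]
    exact hg.mono fun x hx ↦ (hW x (hsub hx)).2
  · rw [contMDiffOn_iff_contDiffOn]
    intro y hy
    have hx := hsub (e'.map_target hy)
    obtain ⟨L, hL⟩ := (hW _ hx).1
    have hcd : ContDiffAt ℝ ∞ g (e'.symm y) := hg.contDiffAt (hU.mem_nhds (hW _ hx).2)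
    refine (e'.contDiffAt_symm (f₀' := L) hy ?_ hcd).contDiffWithinAt
    rw [hL]
    exact (hcd.differentiableAt (by simp)).hasFDerivAt
  · exact ⟨hca.mem_toOpenPartialHomeomorph_source hg' (by simp), haW⟩
  · exact fun x hx ↦ (hW x (hsub hx)).2

/-- The inverse function theorem for smooth maps of boundaryless manifolds. -/
theorem isLocalDiffeomorphAt_of_bijective [I.Boundaryless] [J.Boundaryless]
    [IsManifold I ∞ M] [IsManifold J ∞ M'] [CompleteSpace E] [CompleteSpace E'] {f : M → M'}
    (hf : ContMDiff I J ∞ f) (x : M) (hx : Function.Bijective (mfderiv I J f x)) :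
    IsLocalDiffeomorphAt I J ∞ f x := by
  let φ := extChartPartialDiffeomorph (I := I) x
  let ψ := extChartPartialDiffeomorph (I := J) (f x)
  have hφs : φ.source = (extChartAt I x).source := rfl
  have hψs : ψ.source = (extChartAt J (f x)).source := rfl
  have hxs : x ∈ φ.source := mem_extChartAt_source x
  have hfxs : f x ∈ ψ.source := mem_extChartAt_source (f x)
  let g : E → E' := ψ ∘ f ∘ φ.symm
  let U : Set E := φ.target ∩ φ.symm ⁻¹' (f ⁻¹' ψ.source)
  have hUo : IsOpen U :=
    φ.symm.contMDiffOn.continuousOn.isOpen_inter_preimage φ.open_target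
      (ψ.open_source.preimage hf.continuous)
  have haU : φ x ∈ U := by
    refine ⟨φ.map_source hxs, ?_⟩
    change f (φ.toPartialEquiv.symm (φ.toPartialEquiv x)) ∈ ψ.source
    rw [φ.left_inv hxs]; exact hfxs
  have hg : ContDiffOn ℝ ∞ g U := by
    rw [← contMDiffOn_iff_contDiffOn]
    refine ψ.contMDiffOn.comp (t := ψ.source) (hf.comp_contMDiffOn
      (φ.symm.contMDiffOn.mono Set.inter_subset_left)) fun y hy ↦ hy.2
  have hgm : MDifferentiableAt I J f x := hf.contMDiffAt.mdifferentiableAt (by simp)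
  have hgd : HasFDerivAt g (mfderiv I J f x : E →L[ℝ] E') (φ x) := by
    have h : HasFDerivWithinAt g (mfderiv I J f x : E →L[ℝ] E') (Set.range I) (φ x) :=
      hgm.hasMFDerivAt.2
    exact h.hasFDerivAt (by rw [I.range_eq_univ]; exact Filter.univ_mem)
  let L : E ≃L[ℝ] E' := ContinuousLinearEquiv.ofBijective (mfderiv I J f x : E →L[ℝ] E')
    (LinearMap.ker_eq_bot.2 hx.1) (LinearMap.range_eq_top.2 hx.2)
  obtain ⟨e, hae, heU, heg⟩ := exists_partialDiffeomorph_of_contDiffOn hUo hg haU L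
    (by convert! hgd)
  refine ⟨(φ.trans e).trans ψ.symm, ?_, ?_⟩
  · refine ⟨⟨hxs, hae⟩, ?_⟩
    change e (φ x) ∈ ψ.target
    rw [heg]
    exact ψ.map_source (heU hae).2
  · rintro y ⟨⟨hy1, hy2⟩, -⟩
    change f y = ψ.toPartialEquiv.symm (e (φ y))
    have h2 := (heU hy2).2
    have h3 : φ.symm (φ y) = y := φ.left_inv hy1
    change f (φ.symm (φ y)) ∈ ψ.source at h2
    rw [h3] at h2
    rw [heg]
    change f y = ψ.toPartialEquiv.symm (ψ.toPartialEquiv (f (φ.symm (φ y))))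
    rw [h3, ψ.left_inv h2]

end InverseFunctionTheorem

/-! ### Joint continuity of families of lifted paths -/

section Lifting

open Topology

/-- A family of continuous lifts of paths through a locally injective map, which depends
continuously on the parameter at time `t'`, is jointly continuous. -/
theorem continuous_lift_of_isLocallyInjective {A E X I : Type*} [TopologicalSpace A]
    [TopologicalSpace I] [PreconnectedSpace I] [LocallyConnectedSpace I]
    [TopologicalSpace E] [TopologicalSpace X] [T2Space X] [T2Space E] [LocallyCompactSpace E]
    {f : E → X}
    (hf : Continuous f) (hinj : IsLocallyInjective f) {g : I × A → E} (t' : I)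
    (hfg : Continuous (f ∘ g)) (h0 : Continuous fun a ↦ g (t', a))
    (hA : ∀ a, Continuous fun t ↦ g (t, a)) : Continuous g := by
  -- Take a compact neighbourhood `K` on which `f` is injective. Near `(t₀, a₀)` the values of `f ∘
  -- g` avoid the image of `K \ interior K`, so a lifted path over the connected set `J` that meets
  -- the interior of `K` cannot leave it. Inside `K` the map `f` is an embedding, and continuity of
  -- `f ∘ g` passes to `g`.
  have key : ∀ (t₀ : I) (a₀ : A), ∃ J ∈ 𝓝 t₀, ∀ t₁ ∈ J,
      ContinuousAt (fun a ↦ g (t₁, a)) a₀ → ∃ B ∈ 𝓝 a₀, ContinuousOn g (J ×ˢ B) := by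
    intro t₀ a₀
    obtain ⟨W, hWo, hxW, hWinj⟩ := hinj (g (t₀, a₀))
    obtain ⟨K, hK, hKW, hKc⟩ := local_compact_nhds (hWo.mem_nhds hxW)
    have hC : IsClosed (f '' (K \ interior K)) :=
      ((hKc.diff isOpen_interior).image hf).isClosed
    have hxC : f (g (t₀, a₀)) ∉ f '' (K \ interior K) := by
      rintro ⟨z, ⟨hz1, hz2⟩, hz⟩
      have := hWinj (hKW hz1) hxW hz
      exact hz2 (this ▸ mem_interior_iff_mem_nhds.2 hK)
    have h1 : ∀ᶠ q : I × A in 𝓝 (t₀, a₀), f (g q) ∉ f '' (K \ interior K) :=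
      hfg.continuousAt.eventually (hC.isOpen_compl.mem_nhds hxC)
    rw [nhds_prod_eq, Filter.eventually_prod_iff] at h1
    obtain ⟨pa, hpa, pb, hpb, hab⟩ := h1
    have h2 : ∀ᶠ t in 𝓝 t₀, g (t, a₀) ∈ interior K :=
      (hA a₀).continuousAt.eventually (isOpen_interior.mem_nhds (mem_interior_iff_mem_nhds.2 hK))
    obtain ⟨J, ⟨hJn, hJc⟩, hJ⟩ :=
      (locallyConnectedSpace_iff_connected_basis.1 inferInstance t₀).mem_iff.1
        (hpa.and h2)
    refine ⟨J, hJn, fun t₁ ht₁ hcont ↦ ?_⟩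
    have h3 : ∀ᶠ a in 𝓝 a₀, g (t₁, a) ∈ interior K :=
      hcont.eventually (isOpen_interior.mem_nhds (hJ ht₁).2)
    refine ⟨_, hpb.and h3, ?_⟩
    have hmem : ∀ t ∈ J, ∀ a, pb a ∧ g (t₁, a) ∈ interior K → g (t, a) ∈ interior K := by
      rintro t ht a ⟨ha1, ha2⟩
      have hsub : J ⊆ (fun t ↦ g (t, a)) ⁻¹' interior K := by
        refine hJc.subset_left_of_subset_union (isOpen_interior.preimage (hA a))
          (hKc.isClosed.isOpen_compl.preimage (hA a)) ?_ ?_ ⟨t₁, ht₁, ha2⟩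
        · exact Set.disjoint_left.2 fun s hs1 hs2 ↦ hs2 (interior_subset hs1)
        · intro s hs
          by_cases hsK : g (s, a) ∈ K
          · left
            by_contra hcon
            exact hab (hJ hs).1 ha1 ⟨_, ⟨hsK, hcon⟩, rfl⟩
          · exact Or.inr hsK
      exact hsub ht
    have hemb : IsEmbedding (K.domRestrict f) := by
      have : CompactSpace K := isCompact_iff_compactSpace.1 hKc
      exact (((hf.comp continuous_subtype_val).isClosedEmbedding
        ((Set.injOn_iff_injective).1 (hWinj.mono hKW))).isEmbedding)
    rw [continuousOn_iff_continuous_domRestrict]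
    have hgK : ∀ q : ↥(J ×ˢ {a | pb a ∧ g (t₁, a) ∈ interior K}), g q ∈ K := fun q ↦
      interior_subset (hmem _ q.2.1 _ q.2.2)
    have : Continuous fun q : ↥(J ×ˢ {a | pb a ∧ g (t₁, a) ∈ interior K}) ↦
        (⟨g q, hgK q⟩ : K) := by
      rw [hemb.continuous_iff]
      exact hfg.comp continuous_subtype_val
    exact continuous_subtype_val.comp this
  rw [continuous_iff_continuousAt]
  rintro ⟨t, a⟩
  -- In `key` the set `J` is chosen before `t₁`, so continuity at one time of `J` spreads to all of
  -- `J`; this gives both openness and closedness.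
  have hclopen : IsClopen {t : I | ContinuousAt (fun a ↦ g (t, a)) a} := by
    have hJJ : ∀ t₀ : I, ∃ J ∈ 𝓝 t₀, ∀ t₁ ∈ J, ContinuousAt (fun a ↦ g (t₁, a)) a →
        ∀ t ∈ J, ContinuousAt (fun a ↦ g (t, a)) a := by
      intro t₀
      obtain ⟨J, hJ, h⟩ := key t₀ a
      refine ⟨J, hJ, fun t₁ ht₁ hc t ht ↦ ?_⟩
      obtain ⟨B, hB, hcB⟩ := h t₁ ht₁ hc
      have : ContinuousOn (fun a ↦ g (t, a)) B :=
        hcB.comp (by fun_prop) fun b hb ↦ ⟨ht, hb⟩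
      exact this.continuousAt hB
    constructor
    · rw [← isOpen_compl_iff, isOpen_iff_mem_nhds]
      intro t₀ ht₀
      obtain ⟨J, hJ, h⟩ := hJJ t₀
      filter_upwards [hJ] with s hs hcon
      exact ht₀ (h s hs hcon t₀ (mem_of_mem_nhds hJ))
    · rw [isOpen_iff_mem_nhds]
      intro t₀ ht₀
      obtain ⟨J, hJ, h⟩ := hJJ t₀
      filter_upwards [hJ] with s hs
      exact h t₀ (mem_of_mem_nhds hJ) ht₀ s hs
  have huniv := hclopen.eq_univ ⟨t', h0.continuousAt⟩
  obtain ⟨J, hJ, h⟩ := key t a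
  obtain ⟨B, hB, hcB⟩ := h t (mem_of_mem_nhds hJ) (by
    have : t ∈ {t : I | ContinuousAt (fun a ↦ g (t, a)) a} := huniv ▸ Set.mem_univ t
    exact this)
  exact hcB.continuousAt (prod_mem_nhds hJ hB)

end Lifting

/-! ### Local structure equations: Codazzi, the principal direction, the Riccati equation -/

section LocalTheory

variable {X : Type*} [NormedAddCommGroup X] [NormedSpace ℝ X]
  {V : Type*} [NormedAddCommGroup V] [InnerProductSpace ℝ V]

theorem hasDerivAt_comp_line {W : Type*} [NormedAddCommGroup W] [NormedSpace ℝ W] {g : X → W}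
    {x : X} (hg : DifferentiableAt ℝ g x) (u : X) :
    HasDerivAt (fun t : ℝ ↦ g (x + t • u)) (fderiv ℝ g x u) 0 := by
  have h1 : HasDerivAt (fun t : ℝ ↦ x + t • u) u 0 := by
    simpa using ((hasDerivAt_id (0 : ℝ)).smul_const u).const_add x
  have h2 : HasFDerivAt g (fderiv ℝ g x) (x + (0 : ℝ) • u) := by simpa using hg.hasFDerivAt
  exact h2.comp_hasDerivAt (0 : ℝ) h1

theorem two_le_infty : (2 : WithTop ℕ∞) ≤ ∞ := by
  exact WithTop.coe_le_coe.2 (le_top : (2 : ℕ∞) ≤ ⊤)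

theorem hasDerivAt_fderiv_comp_line {W : Type*} [NormedAddCommGroup W] [NormedSpace ℝ W]
    {g : X → W} {x : X} (hg : ContDiffAt ℝ ∞ g x) (u v : X) :
    HasDerivAt (fun t : ℝ ↦ fderiv ℝ g (x + t • u) v) (fderiv ℝ (fderiv ℝ g) x u v) 0 := by
  have h := hasDerivAt_comp_line
    ((hg.fderiv_right (m := 1) two_le_infty).differentiableAt (by simp)) u
  simpa using h.clm_apply (hasDerivAt_const (0 : ℝ) v)

theorem fderiv_fderiv_symm {W : Type*} [NormedAddCommGroup W] [NormedSpace ℝ W]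
    {g : X → W} {x : X} (hg : ContDiffAt ℝ ∞ g x) (u v : X) :
    fderiv ℝ (fderiv ℝ g) x u v = fderiv ℝ (fderiv ℝ g) x v u :=
  (hg.isSymmSndFDerivAt (by simpa using two_le_infty)).eq u v

theorem eventually_line_mem {U : Set X} (hU : IsOpen U) {x : X} (hx : x ∈ U) (u : X) :
    ∀ᶠ t : ℝ in nhds 0, x + t • u ∈ U := by
  have h : ContinuousAt (fun t : ℝ ↦ x + t • u) 0 := by fun_prop
  exact h.eventually (by simpa using hU.mem_nhds hx)

theorem exists_ne_zero_two_functionals [FiniteDimensional ℝ X]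
    (hX : 3 ≤ Module.finrank ℝ X) (a b : X →ₗ[ℝ] ℝ) : ∃ u ≠ 0, a u = 0 ∧ b u = 0 := by
  have h : LinearMap.ker (a.prod b) ≠ ⊥ :=
    LinearMap.ker_ne_bot_of_finrank_lt (by simp; omega)
  obtain ⟨u, hu, hu0⟩ := Submodule.exists_mem_ne_zero_of_ne_bot h
  have hu' : (a u, b u) = 0 := hu
  rw [Prod.mk_eq_zero] at hu'
  exact ⟨u, hu0, hu'.1, hu'.2⟩

/-- A piece of hypersurface `F` of the unit sphere with unit normal `G`, in coordinates, having two
principal curvatures: `mu` with principal direction `Z` and `lam` on the complement of `Z`, where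
`mu` is a function of `lam` to first order. -/
structure LocalPrincipalFrame (F G Z : X → V) (lam mu : X → ℝ) (v₀ : X) (U : Set X) : Prop where
  isOpen : IsOpen U
  smooth_F : ContDiffOn ℝ ∞ F U
  smooth_G : ContDiffOn ℝ ∞ G U
  smooth_Z : ContDiffOn ℝ ∞ Z U
  smooth_lam : ContDiffOn ℝ ∞ lam U
  smooth_mu : ContDiffOn ℝ ∞ mu U
  norm_F : ∀ x ∈ U, inner ℝ (F x) (F x) = (1 : ℝ)
  norm_G : ∀ x ∈ U, inner ℝ (G x) (G x) = (1 : ℝ)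
  norm_Z : ∀ x ∈ U, inner ℝ (Z x) (Z x) = (1 : ℝ)
  inner_G_F : ∀ x ∈ U, inner ℝ (G x) (F x) = (0 : ℝ)
  inner_G_deriv : ∀ x ∈ U, ∀ v, inner ℝ (G x) (fderiv ℝ F x v) = (0 : ℝ)
  injective : ∀ x ∈ U, Function.Injective (fderiv ℝ F x)
  exists_dir : ∀ x ∈ U, ∃ e, fderiv ℝ F x e = Z x
  weingarten : ∀ x ∈ U, ∀ v, fderiv ℝ G x v =
    -(lam x • fderiv ℝ F x v) + ((lam x - mu x) * inner ℝ (Z x) (fderiv ℝ F x v)) • Z x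
  ne : ∀ x ∈ U, lam x ≠ mu x
  deriv_mu : ∀ x ∈ U, ∀ u, fderiv ℝ lam x u = 0 → fderiv ℝ mu x u = 0
  inner_ne : ∀ x ∈ U, inner ℝ (Z x) (fderiv ℝ F x v₀) ≠ (0 : ℝ)

namespace LocalPrincipalFrame

variable {F G Z : X → V} {lam mu : X → ℝ} {v₀ : X} {U : Set X}

section
variable (h : LocalPrincipalFrame F G Z lam mu v₀ U) {x : X} (hx : x ∈ U)
include h hx

theorem contDiffAt_F : ContDiffAt ℝ ∞ F x := h.smooth_F.contDiffAt (h.isOpen.mem_nhds hx)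
theorem contDiffAt_G : ContDiffAt ℝ ∞ G x := h.smooth_G.contDiffAt (h.isOpen.mem_nhds hx)
theorem contDiffAt_Z : ContDiffAt ℝ ∞ Z x := h.smooth_Z.contDiffAt (h.isOpen.mem_nhds hx)
theorem contDiffAt_lam : ContDiffAt ℝ ∞ lam x := h.smooth_lam.contDiffAt (h.isOpen.mem_nhds hx)
theorem contDiffAt_mu : ContDiffAt ℝ ∞ mu x := h.smooth_mu.contDiffAt (h.isOpen.mem_nhds hx)
theorem hasDerivAt_F (u : X) :
    HasDerivAt (fun t : ℝ ↦ F (x + t • u)) (fderiv ℝ F x u) 0 :=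
  hasDerivAt_comp_line ((h.contDiffAt_F hx).differentiableAt (by simp)) u
theorem hasDerivAt_G (u : X) :
    HasDerivAt (fun t : ℝ ↦ G (x + t • u)) (fderiv ℝ G x u) 0 :=
  hasDerivAt_comp_line ((h.contDiffAt_G hx).differentiableAt (by simp)) u
theorem hasDerivAt_Z (u : X) :
    HasDerivAt (fun t : ℝ ↦ Z (x + t • u)) (fderiv ℝ Z x u) 0 :=
  hasDerivAt_comp_line ((h.contDiffAt_Z hx).differentiableAt (by simp)) u
theorem hasDerivAt_lam (u : X) :
    HasDerivAt (fun t : ℝ ↦ lam (x + t • u)) (fderiv ℝ lam x u) 0 :=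
  hasDerivAt_comp_line ((h.contDiffAt_lam hx).differentiableAt (by simp)) u
theorem hasDerivAt_mu (u : X) :
    HasDerivAt (fun t : ℝ ↦ mu (x + t • u)) (fderiv ℝ mu x u) 0 :=
  hasDerivAt_comp_line ((h.contDiffAt_mu hx).differentiableAt (by simp)) u

/-- Differentiating a constant scalar product. -/
theorem inner_deriv_add_eq_zero {g k : X → V} {c : ℝ} (hg : ContDiffAt ℝ ∞ g x)
    (hk : ContDiffAt ℝ ∞ k x) (hc : ∀ y ∈ U, inner ℝ (g y) (k y) = c) (u : X) :
    inner ℝ (g x) (fderiv ℝ k x u) + inner ℝ (fderiv ℝ g x u) (k x) = 0 := by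
  have h1 := (hasDerivAt_comp_line (hg.differentiableAt (by simp)) u).inner ℝ
    (hasDerivAt_comp_line (hk.differentiableAt (by simp)) u)
  have h2 : HasDerivAt (fun _ : ℝ ↦ c) 0 0 := hasDerivAt_const _ _
  have h3 := h1.unique (h2.congr_of_eventuallyEq
    ((eventually_line_mem h.isOpen hx u).mono fun t ht ↦ hc _ ht))
  simpa using h3

theorem inner_F_deriv (u : X) : inner ℝ (F x) (fderiv ℝ F x u) = (0 : ℝ) := by
  have := h.inner_deriv_add_eq_zero hx (h.contDiffAt_F hx) (h.contDiffAt_F hx) h.norm_F u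
  linarith [real_inner_comm (F x) (fderiv ℝ F x u)]

theorem inner_Z_F : inner ℝ (Z x) (F x) = (0 : ℝ) := by
  obtain ⟨e, he⟩ := h.exists_dir x hx
  rw [← he, real_inner_comm]; exact h.inner_F_deriv hx e

theorem inner_Z_G : inner ℝ (Z x) (G x) = (0 : ℝ) := by
  obtain ⟨e, he⟩ := h.exists_dir x hx
  rw [← he, real_inner_comm]; exact h.inner_G_deriv x hx e

theorem inner_derivZ_Z (u : X) : inner ℝ (fderiv ℝ Z x u) (Z x) = (0 : ℝ) := by
  have := h.inner_deriv_add_eq_zero hx (h.contDiffAt_Z hx) (h.contDiffAt_Z hx) h.norm_Z u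
  rw [real_inner_comm] at this
  linarith

theorem inner_derivZ_F (u : X) :
    inner ℝ (fderiv ℝ Z x u) (F x) = -inner ℝ (Z x) (fderiv ℝ F x u) := by
  have := h.inner_deriv_add_eq_zero hx (h.contDiffAt_Z hx) (h.contDiffAt_F hx)
    (fun y hy ↦ h.inner_Z_F hy) u
  linarith

theorem inner_derivZ_G (u : X) :
    inner ℝ (fderiv ℝ Z x u) (G x) = mu x * inner ℝ (Z x) (fderiv ℝ F x u) := by
  have := h.inner_deriv_add_eq_zero hx (h.contDiffAt_Z hx) (h.contDiffAt_G hx)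
    (fun y hy ↦ h.inner_Z_G hy) u
  rw [h.weingarten x hx, inner_add_right, inner_neg_right, real_inner_smul_right,
    real_inner_smul_right, h.norm_Z x hx] at this
  linarith

/-- The Codazzi equation. -/
theorem codazzi (u v : X) :
    -(fderiv ℝ lam x u • fderiv ℝ F x v) + fderiv ℝ lam x v • fderiv ℝ F x u
      + ((fderiv ℝ lam x u - fderiv ℝ mu x u) * inner ℝ (Z x) (fderiv ℝ F x v)
        - (fderiv ℝ lam x v - fderiv ℝ mu x v) * inner ℝ (Z x) (fderiv ℝ F x u)
        + (lam x - mu x) * (inner ℝ (fderiv ℝ Z x u) (fderiv ℝ F x v)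
          - inner ℝ (fderiv ℝ Z x v) (fderiv ℝ F x u))) • Z x
      + ((lam x - mu x) * inner ℝ (Z x) (fderiv ℝ F x v)) • fderiv ℝ Z x u
      - ((lam x - mu x) * inner ℝ (Z x) (fderiv ℝ F x u)) • fderiv ℝ Z x v = 0 := by
  -- Differentiate the Weingarten formula along `u`. Antisymmetrising in `u` and `v` cancels all
  -- second derivatives of `F` and `G`.
  have key : ∀ u v : X, fderiv ℝ (fderiv ℝ G) x u v =
      -(lam x • fderiv ℝ (fderiv ℝ F) x u v + fderiv ℝ lam x u • fderiv ℝ F x v)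
      + (((lam x - mu x) * inner ℝ (Z x) (fderiv ℝ F x v)) • fderiv ℝ Z x u
        + ((fderiv ℝ lam x u - fderiv ℝ mu x u) * inner ℝ (Z x) (fderiv ℝ F x v)
          + (lam x - mu x) * (inner ℝ (Z x) (fderiv ℝ (fderiv ℝ F) x u v)
            + inner ℝ (fderiv ℝ Z x u) (fderiv ℝ F x v))) • Z x) := by
    intro u v
    have hF := hasDerivAt_fderiv_comp_line (h.contDiffAt_F hx) u v
    have hl := h.hasDerivAt_lam hx u
    have hm := h.hasDerivAt_mu hx u
    have hZ := h.hasDerivAt_Z hx u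
    have hR := ((hl.smul hF).neg).add (((hl.sub hm).mul (hZ.inner ℝ hF)).smul hZ)
    have hL := hasDerivAt_fderiv_comp_line (h.contDiffAt_G hx) u v
    have := hL.unique (hR.congr_of_eventuallyEq
      ((eventually_line_mem h.isOpen hx u).mono fun t ht ↦ h.weingarten _ ht v))
    simpa using this
  have h1 := key u v
  rw [fderiv_fderiv_symm (h.contDiffAt_G hx), key v u,
    fderiv_fderiv_symm (h.contDiffAt_F hx) v u] at h1
  rw [← sub_eq_zero] at h1
  have h2 : ∀ a b : V, a = b → b = 0 → a = 0 := fun a b h h' ↦ h.trans h'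
  refine h2 _ _ ?_ (neg_eq_zero.2 h1)
  module

end

section FiniteDimensional

variable [FiniteDimensional ℝ X] [FiniteDimensional ℝ V] (hX : 3 ≤ Module.finrank ℝ X)
  (hV : Module.finrank ℝ V = Module.finrank ℝ X + 2)
  (h : LocalPrincipalFrame F G Z lam mu v₀ U) {x : X} (hx : x ∈ U)

section
omit [FiniteDimensional ℝ V]
include hX h hx

/-- Dimension at least three leaves room for a direction orthogonal to both `Z` and `v`. This is
where the multiplicity of `lam` being at least two enters. -/
theorem exists_orthogonal (v : X) : ∃ u, fderiv ℝ F x u ≠ 0 ∧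
    inner ℝ (Z x) (fderiv ℝ F x u) = (0 : ℝ) ∧
    inner ℝ (fderiv ℝ F x v) (fderiv ℝ F x u) = (0 : ℝ) := by
  obtain ⟨u, hu0, hu1, hu2⟩ := exists_ne_zero_two_functionals hX
    ((innerₛₗ ℝ (Z x)).comp (fderiv ℝ F x : X →ₗ[ℝ] V))
    ((innerₛₗ ℝ (fderiv ℝ F x v)).comp (fderiv ℝ F x : X →ₗ[ℝ] V))
  refine ⟨u, fun h0 ↦ hu0 ?_, hu1, hu2⟩
  exact h.injective x hx (h0.trans (map_zero _).symm)

/-- Pick `u` orthogonal to `Z` and `v`. Pairing the Codazzi equation for `u`, `v` with `dF u` leaves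
only `d lam (v)` times the squared length of `dF u`. -/
theorem deriv_lam_eq_zero {v : X} (hv : inner ℝ (Z x) (fderiv ℝ F x v) = (0 : ℝ)) :
    fderiv ℝ lam x v = 0 := by
  obtain ⟨u, hu0, hu1, hu2⟩ := h.exists_orthogonal hX hx v
  have hc := congrArg (fun y ↦ inner ℝ y (fderiv ℝ F x u)) (h.codazzi hx u v)
  simp only [hu1, hv, inner_add_left, inner_sub_left, inner_neg_left, real_inner_smul_left, hu2,
    mul_zero, zero_mul, inner_zero_left, sub_zero, add_zero, neg_zero, zero_add] at hc
  exact (mul_eq_zero.1 hc).resolve_right fun h0 ↦ hu0 (inner_self_eq_zero.1 h0)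

theorem deriv_mu_eq_zero {v : X} (hv : inner ℝ (Z x) (fderiv ℝ F x v) = (0 : ℝ)) :
    fderiv ℝ mu x v = 0 :=
  h.deriv_mu x hx v (h.deriv_lam_eq_zero hX hx hv)

end

/-- The function `κ` with `d lam = (lam - mu) κ ⟨Z, dF⟩`. -/
def kappa (F Z : X → V) (lam mu : X → ℝ) (v₀ : X) (x : X) : ℝ :=
  fderiv ℝ lam x v₀ / ((lam x - mu x) * inner ℝ (Z x) (fderiv ℝ F x v₀))

omit [FiniteDimensional ℝ X] [FiniteDimensional ℝ V] in
include h hx in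
theorem contDiffAt_kappa : ContDiffAt ℝ ∞ (kappa F Z lam mu v₀) x := by
  have hF : ContDiffAt ℝ ∞ (fderiv ℝ F) x := (h.contDiffAt_F hx).fderiv_right (by simp)
  have hl : ContDiffAt ℝ ∞ (fderiv ℝ lam) x := (h.contDiffAt_lam hx).fderiv_right (by simp)
  refine (hl.clm_apply contDiffAt_const).div (((h.contDiffAt_lam hx).sub (h.contDiffAt_mu hx)).mul
    ((h.contDiffAt_Z hx).inner ℝ (hF.clm_apply contDiffAt_const))) ?_
  exact mul_ne_zero (sub_ne_zero.2 (h.ne x hx)) (h.inner_ne x hx)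

section
omit [FiniteDimensional ℝ V]
include hX h hx

/-- The form `d lam` vanishes on the complement of `Z`, so it is fixed by its value at `v₀`;
subtracting a multiple of `v₀` moves `v` into that complement. -/
theorem deriv_lam (v : X) : fderiv ℝ lam x v =
    (lam x - mu x) * kappa F Z lam mu v₀ x * inner ℝ (Z x) (fderiv ℝ F x v) := by
  have h1 := h.inner_ne x hx
  have h2 := sub_ne_zero.2 (h.ne x hx)
  set a := inner ℝ (Z x) (fderiv ℝ F x v) with ha
  set b := inner ℝ (Z x) (fderiv ℝ F x v₀) with hb
  have h3 : fderiv ℝ lam x (v - (a / b) • v₀) = 0 := by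
    refine h.deriv_lam_eq_zero hX hx ?_
    rw [map_sub, map_smul, inner_sub_right, real_inner_smul_right, ← ha, ← hb]
    field_simp; ring
  rw [map_sub, map_smul, sub_eq_zero, smul_eq_mul] at h3
  rw [h3, kappa, ← hb]
  field_simp

/-- In the Codazzi equation for `u` and the direction of `Z`, the `Z`-component gives `⟨dZ e, dF u⟩
= 0`; the rest is `lam - mu` times the claim. Geometrically, the leaves tangent to the eigenspace of
`lam` are umbilic in the hypersurface. -/
theorem deriv_Z_of_orthogonal {u : X} (hu : inner ℝ (Z x) (fderiv ℝ F x u) = (0 : ℝ)) :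
    fderiv ℝ Z x u = -(kappa F Z lam mu v₀ x • fderiv ℝ F x u) := by
  obtain ⟨e, he⟩ := h.exists_dir x hx
  have hc := h.codazzi hx u e
  have h2 := sub_ne_zero.2 (h.ne x hx)
  have hZ := h.norm_Z x hx
  rw [h.deriv_lam_eq_zero hX hx hu, h.deriv_mu_eq_zero hX hx hu, he, hu, hZ,
    h.deriv_lam hX hx e, he, hZ] at hc
  have hc2 := congrArg (fun y ↦ inner ℝ y (Z x)) hc
  simp only [inner_add_left, inner_sub_left, inner_neg_left, real_inner_smul_left, inner_zero_left,
    h.inner_derivZ_Z hx, hZ, (real_inner_comm _ _).trans hu] at hc2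
  simp only [mul_zero, sub_zero, add_zero, mul_one, zero_add, neg_zero, zero_sub] at hc2
  have h3 : inner ℝ (fderiv ℝ Z x e) (fderiv ℝ F x u) = (0 : ℝ) := by
    simpa [h2] using hc2
  rw [h.inner_derivZ_Z hx, h3] at hc
  have h4 : (lam x - mu x) • (fderiv ℝ Z x u + kappa F Z lam mu v₀ x • fderiv ℝ F x u) = 0 := by
    rw [← hc]; module
  exact eq_neg_of_add_eq_zero_left ((smul_eq_zero.1 h4).resolve_left h2)

/-- Geometrically, the integral curves of `Z` are geodesics of the hypersurface. -/
theorem inner_derivZ_dir {e u : X} (he : fderiv ℝ F x e = Z x)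
    (hu : inner ℝ (Z x) (fderiv ℝ F x u) = (0 : ℝ)) :
    inner ℝ (fderiv ℝ Z x e) (fderiv ℝ F x u) = (0 : ℝ) := by
  have hc := congrArg (fun y ↦ inner ℝ y (Z x)) (h.codazzi hx u e)
  have h2 := sub_ne_zero.2 (h.ne x hx)
  have hu' : inner ℝ (fderiv ℝ F x u) (Z x) = (0 : ℝ) := by rw [real_inner_comm]; exact hu
  simp only [inner_add_left, inner_sub_left, inner_neg_left, real_inner_smul_left, inner_zero_left,
    h.inner_derivZ_Z hx, h.norm_Z x hx, he, hu, hu', h.deriv_lam_eq_zero hX hx hu,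
    h.deriv_mu_eq_zero hX hx hu] at hc
  simpa [h2] using hc

end

section
include hV h hx

/-- By dimension, `F`, `G` and the range of `dF` span the ambient space. -/
theorem eq_zero_of_orthogonal {R : V} (hF : inner ℝ R (F x) = (0 : ℝ))
    (hG : inner ℝ R (G x) = (0 : ℝ)) (hd : ∀ u, inner ℝ R (fderiv ℝ F x u) = (0 : ℝ)) :
    R = 0 := by
  let L : (X × ℝ × ℝ) →ₗ[ℝ] V := ((fderiv ℝ F x : X →ₗ[ℝ] V)).coprod
    ((LinearMap.toSpanSingleton ℝ V (F x)).coprod (LinearMap.toSpanSingleton ℝ V (G x)))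
  have hL : ∀ u a b, L (u, a, b) = fderiv ℝ F x u + (a • F x + b • G x) := fun u a b ↦ by simp [L]
  have hinj : Function.Injective L := by
    rw [← LinearMap.ker_eq_bot, LinearMap.ker_eq_bot']
    rintro ⟨u, a, b⟩ h0
    rw [hL] at h0
    have hFG : inner ℝ (F x) (G x) = (0 : ℝ) := by rw [real_inner_comm]; exact h.inner_G_F x hx
    have ha := congrArg (fun y ↦ inner ℝ (F x) y) h0
    have hb := congrArg (fun y ↦ inner ℝ (G x) y) h0
    simp only [inner_add_right, real_inner_smul_right, inner_zero_right, h.inner_F_deriv hx,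
      h.inner_G_deriv x hx, h.norm_F x hx, h.norm_G x hx, h.inner_G_F x hx, hFG] at ha hb
    have ha' : a = 0 := by linarith
    have hb' : b = 0 := by linarith
    subst ha' hb'
    simp only [zero_smul, add_zero] at h0
    have : u = 0 := h.injective x hx (h0.trans (map_zero _).symm)
    simp [this]
  have hsurj : Function.Surjective L := by
    refine (LinearMap.injective_iff_surjective_of_finrank_eq_finrank ?_).1 hinj
    rw [hV]; simp
  obtain ⟨⟨u, a, b⟩, huab⟩ := hsurj R
  have : inner ℝ R R = (0 : ℝ) := by
    nth_rewrite 2 [← huab]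
    rw [hL, inner_add_right, inner_add_right, real_inner_smul_right, real_inner_smul_right, hF, hG,
      hd]
    simp
  exact inner_self_eq_zero.1 this

end

include hX hV h

/-- Because the `Z`-curves are geodesics, their acceleration has only the component `-F` normal to
the sphere and the component `mu G` normal to the hypersurface. All three kinds of components are
compared. -/
theorem deriv_Z_dir (hx : x ∈ U) {e : X} (he : fderiv ℝ F x e = Z x) :
    fderiv ℝ Z x e = -F x + mu x • G x := by
  have h0 : fderiv ℝ Z x e + F x - mu x • G x = 0 := by
    have hFG : inner ℝ (F x) (G x) = (0 : ℝ) := by rw [real_inner_comm]; exact h.inner_G_F x hx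
    refine h.eq_zero_of_orthogonal hV hx ?_ ?_ fun u ↦ ?_
    · rw [inner_sub_left, inner_add_left, real_inner_smul_left, h.inner_derivZ_F hx, h.norm_F x hx,
        h.inner_G_F x hx, he, h.norm_Z x hx]
      simp
    · rw [inner_sub_left, inner_add_left, real_inner_smul_left, h.inner_derivZ_G hx, h.norm_G x hx,
        hFG, he, h.norm_Z x hx]
      simp
    · rw [inner_sub_left, inner_add_left, real_inner_smul_left, h.inner_F_deriv hx,
        h.inner_G_deriv x hx]
      set a : ℝ := inner ℝ (Z x) (fderiv ℝ F x u) with ha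
      have h1 : inner ℝ (fderiv ℝ Z x e) (fderiv ℝ F x (u - a • e)) = (0 : ℝ) := by
        refine h.inner_derivZ_dir hX hx he ?_
        rw [map_sub, map_smul, he, inner_sub_right, real_inner_smul_right, h.norm_Z x hx]
        simp [ha]
      rw [map_sub, map_smul, he, inner_sub_right, real_inner_smul_right, h.inner_derivZ_Z hx] at h1
      linarith
  rw [sub_eq_zero] at h0
  rw [← h0]; abel

theorem deriv_Z (hx : x ∈ U) (u : X) : fderiv ℝ Z x u =
    -(kappa F Z lam mu v₀ x • (fderiv ℝ F x u - inner ℝ (Z x) (fderiv ℝ F x u) • Z x))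
      + inner ℝ (Z x) (fderiv ℝ F x u) • (-F x + mu x • G x) := by
  obtain ⟨e, he⟩ := h.exists_dir x hx
  set a : ℝ := inner ℝ (Z x) (fderiv ℝ F x u) with ha
  have h1 := h.deriv_Z_of_orthogonal hX hx (u := u - a • e) (by
    rw [map_sub, map_smul, he, inner_sub_right, real_inner_smul_right, h.norm_Z x hx]
    simp [ha])
  rw [map_sub, map_sub, map_smul, map_smul, he, h.deriv_Z_dir hX hV hx he, sub_eq_iff_eq_add] at h1
  rw [h1]

/-- The integrability condition of the structure equation `deriv_Z`. -/
theorem deriv_Z_integrability (hx : x ∈ U) (u v : X) :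
    -(fderiv ℝ (kappa F Z lam mu v₀) x u •
        (fderiv ℝ F x v - inner ℝ (Z x) (fderiv ℝ F x v) • Z x))
      + fderiv ℝ (kappa F Z lam mu v₀) x v •
        (fderiv ℝ F x u - inner ℝ (Z x) (fderiv ℝ F x u) • Z x)
      + (inner ℝ (fderiv ℝ Z x u) (fderiv ℝ F x v) - inner ℝ (fderiv ℝ Z x v) (fderiv ℝ F x u)) •
        (kappa F Z lam mu v₀ x • Z x - F x + mu x • G x)
      + inner ℝ (Z x) (fderiv ℝ F x v) • (kappa F Z lam mu v₀ x • fderiv ℝ Z x u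
        - fderiv ℝ F x u + fderiv ℝ mu x u • G x + mu x • fderiv ℝ G x u)
      - inner ℝ (Z x) (fderiv ℝ F x u) • (kappa F Z lam mu v₀ x • fderiv ℝ Z x v
        - fderiv ℝ F x v + fderiv ℝ mu x v • G x + mu x • fderiv ℝ G x v) = 0 := by
  -- As for Codazzi: differentiate `deriv_Z` and antisymmetrise.
  have key : ∀ u v : X, fderiv ℝ (fderiv ℝ Z) x u v =
      -(kappa F Z lam mu v₀ x • (fderiv ℝ (fderiv ℝ F) x u v
          - (inner ℝ (Z x) (fderiv ℝ F x v) • fderiv ℝ Z x u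
            + (inner ℝ (Z x) (fderiv ℝ (fderiv ℝ F) x u v)
              + inner ℝ (fderiv ℝ Z x u) (fderiv ℝ F x v)) • Z x))
        + fderiv ℝ (kappa F Z lam mu v₀) x u •
          (fderiv ℝ F x v - inner ℝ (Z x) (fderiv ℝ F x v) • Z x))
      + (inner ℝ (Z x) (fderiv ℝ F x v) • (-fderiv ℝ F x u + (mu x • fderiv ℝ G x u
          + fderiv ℝ mu x u • G x))
        + (inner ℝ (Z x) (fderiv ℝ (fderiv ℝ F) x u v)
          + inner ℝ (fderiv ℝ Z x u) (fderiv ℝ F x v)) • (-F x + mu x • G x)) := by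
    intro u v
    have hF := hasDerivAt_fderiv_comp_line (h.contDiffAt_F hx) u v
    have hk := hasDerivAt_comp_line ((h.contDiffAt_kappa hx).differentiableAt (by simp)) u
    have hZ := h.hasDerivAt_Z hx u
    have hε := hZ.inner ℝ hF
    have hR := ((hk.smul (hF.sub (hε.smul hZ))).neg).add
      (hε.smul ((h.hasDerivAt_F hx u).neg.add ((h.hasDerivAt_mu hx u).smul (h.hasDerivAt_G hx u))))
    have hL := hasDerivAt_fderiv_comp_line (h.contDiffAt_Z hx) u v
    have := hL.unique (hR.congr_of_eventuallyEq
      ((eventually_line_mem h.isOpen hx u).mono fun t ht ↦ h.deriv_Z hX hV ht v))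
    simpa using this
  have h1 := key u v
  rw [fderiv_fderiv_symm (h.contDiffAt_Z hx), key v u,
    fderiv_fderiv_symm (h.contDiffAt_F hx) v u] at h1
  rw [← sub_eq_zero] at h1
  have h2 : ∀ a b : V, a = b → b = 0 → a = 0 := fun a b h h' ↦ h.trans h'
  refine h2 _ _ ?_ (neg_eq_zero.2 h1)
  module

/-- The argument of `deriv_lam_eq_zero`, with the integrability condition of `deriv_Z` in place of
Codazzi. -/
theorem deriv_kappa_eq_zero (hx : x ∈ U) {v : X}
    (hv : inner ℝ (Z x) (fderiv ℝ F x v) = (0 : ℝ)) :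
    fderiv ℝ (kappa F Z lam mu v₀) x v = 0 := by
  obtain ⟨u, hu0, hu1, hu2⟩ := h.exists_orthogonal hX hx v
  have hc := h.deriv_Z_integrability hX hV hx u v
  rw [h.deriv_Z_of_orthogonal hX hx hu1, h.deriv_Z_of_orthogonal hX hx hv, hu1, hv,
    inner_neg_left, inner_neg_left, real_inner_smul_left, real_inner_smul_left,
    real_inner_comm (fderiv ℝ F x v)] at hc
  have hc := congrArg (fun y ↦ inner ℝ y (fderiv ℝ F x u)) hc
  simp only [inner_add_left, inner_neg_left, real_inner_smul_left, hu2,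
    zero_smul, sub_self, sub_zero, add_zero,
    mul_zero, inner_zero_left, neg_zero, zero_add] at hc
  exact (mul_eq_zero.1 hc).resolve_right fun h0 ↦ hu0 (inner_self_eq_zero.1 h0)

/-- The coefficient of `dF u` in the integrability condition for `u` orthogonal to `Z` and the
direction `e` of `Z`. By Gauss, `1 + lam mu` is the sectional curvature of the plane spanned by the
two directions. -/
theorem deriv_kappa (hx : x ∈ U) (v : X) : fderiv ℝ (kappa F Z lam mu v₀) x v =
    (kappa F Z lam mu v₀ x ^ 2 + 1 + lam x * mu x) * inner ℝ (Z x) (fderiv ℝ F x v) := by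
  obtain ⟨e, he⟩ := h.exists_dir x hx
  obtain ⟨u, hu0, hu1, -⟩ := h.exists_orthogonal hX hx v
  have hZ := h.norm_Z x hx
  have hc := h.deriv_Z_integrability hX hV hx u e
  rw [he, hu1, hZ, h.inner_derivZ_Z hx, h.inner_derivZ_dir hX hx he hu1,
    h.deriv_mu_eq_zero hX hx hu1, h.deriv_Z_of_orthogonal hX hx hu1, h.weingarten x hx, hu1] at hc
  have hc2 : (fderiv ℝ (kappa F Z lam mu v₀) x e
      - (kappa F Z lam mu v₀ x ^ 2 + 1 + lam x * mu x)) • fderiv ℝ F x u = 0 := by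
    rw [← hc]; module
  have hc3 := sub_eq_zero.1 ((smul_eq_zero.1 hc2).resolve_right hu0)
  set a : ℝ := inner ℝ (Z x) (fderiv ℝ F x v) with ha
  have h1 := h.deriv_kappa_eq_zero hX hV hx (v := v - a • e) (by
    rw [map_sub, map_smul, he, inner_sub_right, real_inner_smul_right, h.norm_Z x hx]
    simp [ha])
  rw [map_sub, map_smul, hc3, sub_eq_zero, smul_eq_mul] at h1
  rw [h1, mul_comm]

-- Together with `deriv_eta` this is a closed linear system for `G + lam F` and `Z + κ F`, so the
-- plane they span does not move.
omit hV [FiniteDimensional ℝ V] in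
theorem deriv_xi (hx : x ∈ U) (u : X) : fderiv ℝ (fun y ↦ G y + lam y • F y) x u =
    ((lam x - mu x) * inner ℝ (Z x) (fderiv ℝ F x u)) • (Z x + kappa F Z lam mu v₀ x • F x) := by
  have hF := (h.contDiffAt_F hx).differentiableAt (by simp)
  have hG := (h.contDiffAt_G hx).differentiableAt (by simp)
  have hl := (h.contDiffAt_lam hx).differentiableAt (by simp)
  have h1 := (hasDerivAt_comp_line (hG.add (hl.smul hF)) u).unique
    ((h.hasDerivAt_G hx u).add ((h.hasDerivAt_lam hx u).smul (h.hasDerivAt_F hx u)))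
  refine h1.trans ?_
  rw [h.weingarten x hx, h.deriv_lam hX hx u]
  simp only [zero_smul, add_zero]
  module

theorem deriv_eta (hx : x ∈ U) (u : X) :
    fderiv ℝ (fun y ↦ Z y + kappa F Z lam mu v₀ y • F y) x u =
      inner ℝ (Z x) (fderiv ℝ F x u) • (kappa F Z lam mu v₀ x •
        (Z x + kappa F Z lam mu v₀ x • F x) + mu x • (G x + lam x • F x)) := by
  have hF := (h.contDiffAt_F hx).differentiableAt (by simp)
  have hZ := (h.contDiffAt_Z hx).differentiableAt (by simp)
  have hl := (h.contDiffAt_kappa hx).differentiableAt (by simp)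
  have h1 := (hasDerivAt_comp_line (hZ.add (hl.smul hF)) u).unique
    ((h.hasDerivAt_Z hx u).add ((hasDerivAt_comp_line hl u).smul (h.hasDerivAt_F hx u)))
  refine h1.trans ?_
  rw [h.deriv_Z hX hV hx, h.deriv_kappa hX hV hx u]
  simp only [zero_smul, add_zero]
  module

end FiniteDimensional
end LocalPrincipalFrame
end LocalTheory

/-! ### Constancy of the profile plane; smoothness of principal curvatures and directions -/

section LocalTheory

variable {X : Type*} [NormedAddCommGroup X] [NormedSpace ℝ X]
  {V : Type*} [NormedAddCommGroup V] [InnerProductSpace ℝ V]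
  {F G Z : X → V} {lam mu : X → ℝ} {v₀ : X} {U : Set X}

namespace LocalPrincipalFrame

variable [FiniteDimensional ℝ X] [FiniteDimensional ℝ V] (hX : 3 ≤ Module.finrank ℝ X)
  (hV : Module.finrank ℝ V = Module.finrank ℝ X + 2)
  (h : LocalPrincipalFrame F G Z lam mu v₀ U) {x : X} (hx : x ∈ U)

/-- The plane spanned by `G + lam F` and its derivatives. -/
def plane (F G : X → V) (lam : X → ℝ) (x : X) : Submodule ℝ V :=
  Submodule.span ℝ {G x + lam x • F x} ⊔
    LinearMap.range (fderiv ℝ (fun y ↦ G y + lam y • F y) x : X →ₗ[ℝ] V)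

-- By `deriv_xi` the derivative of `G + lam F` has as range the line of `Z + κ F`, as `lam ≠ mu`. So
-- this span is the same for every local frame, whatever the sign of `Z`.
omit [FiniteDimensional ℝ V] in
include hX h hx in
theorem plane_eq_span : plane F G lam x =
    Submodule.span ℝ {G x + lam x • F x, Z x + kappa F Z lam mu v₀ x • F x} := by
  rw [plane, Submodule.span_insert]
  congr 1
  have h2 := sub_ne_zero.2 (h.ne x hx)
  have h3 := h.inner_ne x hx
  apply le_antisymm
  · rintro _ ⟨u, rfl⟩
    exact Submodule.mem_span_singleton.2 ⟨_, (h.deriv_xi hX hx u).symm⟩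
  · rw [Submodule.span_singleton_le_iff_mem]
    refine ⟨((lam x - mu x) * inner ℝ (Z x) (fderiv ℝ F x v₀))⁻¹ • v₀, ?_⟩
    change fderiv ℝ _ x _ = _
    rw [map_smul, h.deriv_xi hX hx, smul_smul, inv_mul_cancel₀ (mul_ne_zero h2 h3), one_smul]

omit [FiniteDimensional ℝ V] in
include hX h hx in
theorem finrank_plane : Module.finrank ℝ (plane F G lam x) = 2 := by
  have hli : LinearIndependent ℝ
      ![G x + lam x • F x, Z x + kappa F Z lam mu v₀ x • F x] := by
    rw [LinearIndependent.pair_iff]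
    intro a b hab
    have hFG : inner ℝ (F x) (G x) = (0 : ℝ) := by rw [real_inner_comm]; exact h.inner_G_F x hx
    have hFZ : inner ℝ (F x) (Z x) = (0 : ℝ) := by rw [real_inner_comm]; exact h.inner_Z_F hx
    have hGZ : inner ℝ (G x) (Z x) = (0 : ℝ) := by rw [real_inner_comm]; exact h.inner_Z_G hx
    have h1 := congrArg (fun y ↦ inner ℝ y (G x)) hab
    have h2 := congrArg (fun y ↦ inner ℝ y (Z x)) hab
    simp only [inner_add_left, real_inner_smul_left, hFG, hFZ, hGZ, h.norm_G x hx, h.norm_Z x hx,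
      h.inner_Z_G hx, inner_zero_left] at h1 h2
    constructor <;> linarith
  rw [h.plane_eq_span hX hx, ← Matrix.range_cons_cons_empty, finrank_span_eq_card hli]
  simp

-- Let `b` be orthogonal to the plane at `x`. Along a segment its scalar products with `G + lam F`
-- and `Z + κ F` solve a homogeneous linear system with zero initial value, hence vanish. So the
-- plane at `y` lies in the plane at `x`, and both have dimension two.
include hX hV h hx in
theorem eventually_plane_eq : ∀ᶠ y in nhds x, plane F G lam y = plane F G lam x := by
  obtain ⟨δ, hδ, hball⟩ := Metric.isOpen_iff.1 h.isOpen x hx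
  filter_upwards [Metric.ball_mem_nhds x hδ] with y hy
  set k := kappa F Z lam mu v₀ with hk
  have hseg : ∀ t ∈ Set.Icc (0 : ℝ) 1, x + t • (y - x) ∈ U := by
    intro t ht
    apply hball
    rw [mem_ball_iff_norm, add_sub_cancel_left, norm_smul, Real.norm_of_nonneg ht.1]
    rw [mem_ball_iff_norm] at hy
    nlinarith [norm_nonneg (y - x), ht.2]
  have hle : plane F G lam y ≤ plane F G lam x := by
    rw [← Submodule.orthogonal_le_orthogonal_iff]
    intro b hb
    have hp := h.plane_eq_span hX hx
    rw [hp, Submodule.mem_orthogonal] at hb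
    rw [h.plane_eq_span hX (hball hy), Submodule.mem_orthogonal]
    have hb1 := hb _ (Submodule.subset_span (Set.mem_insert _ _))
    have hb2 := hb _ (Submodule.subset_span (Set.mem_insert_of_mem _ rfl))
    let q : ℝ → X := fun t ↦ x + t • (y - x)
    have hq : ∀ t, HasDerivAt q (y - x) t := fun t ↦ by
      simpa only [id, one_smul] using ((hasDerivAt_id t).smul_const (y - x)).const_add x
    let P : X → V := fun z ↦ G z + lam z • F z
    let Q : X → V := fun z ↦ Z z + k z • F z
    have hPs : ContDiffOn ℝ ∞ P U := h.smooth_G.add (h.smooth_lam.smul h.smooth_F)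
    have hQs : ContDiffOn ℝ ∞ Q U := h.smooth_Z.add
      (ContDiffOn.smul (fun z hz ↦ (h.contDiffAt_kappa hz).contDiffWithinAt) h.smooth_F)
    have hPd : ∀ z ∈ U, HasFDerivAt P (fderiv ℝ P z) z := fun z hz ↦
      ((hPs.contDiffAt (h.isOpen.mem_nhds hz)).differentiableAt (by simp)).hasFDerivAt
    have hQd : ∀ z ∈ U, HasFDerivAt Q (fderiv ℝ Q z) z := fun z hz ↦
      ((hQs.contDiffAt (h.isOpen.mem_nhds hz)).differentiableAt (by simp)).hasFDerivAt
    let ε : ℝ → ℝ := fun t ↦ inner ℝ (Z (q t)) (fderiv ℝ F (q t) (y - x))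
    let φ : ℝ → ℝ × ℝ := fun t ↦ (inner ℝ (P (q t)) b, inner ℝ (Q (q t)) b)
    let φ' : ℝ → ℝ × ℝ := fun t ↦
      (((lam (q t) - mu (q t)) * ε t) * (φ t).2,
        (ε t * k (q t)) * (φ t).2 + (ε t * mu (q t)) * (φ t).1)
    have hφ : ∀ t ∈ Set.Icc (0 : ℝ) 1, HasDerivAt φ (φ' t) t := by
      intro t ht
      have hz := hseg t ht
      have h1 := ((hPd _ hz).comp_hasDerivAt t (hq t)).inner ℝ (hasDerivAt_const t b)
      have h2 := ((hQd _ hz).comp_hasDerivAt t (hq t)).inner ℝ (hasDerivAt_const t b)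
      convert! h1.prodMk h2 using 1
      simp only [φ', φ, inner_zero_right, zero_add, P, Q, k]
      rw [h.deriv_xi hX hz, h.deriv_eta hX hV hz]
      simp only [inner_smul_left, inner_add_left, ε, q]
      simp only [conj_trivial, Prod.mk.injEq]
      exact ⟨trivial, by ring⟩
    have hcont : ∀ g : X → ℝ, (∀ z ∈ U, ContDiffAt ℝ ∞ g z) →
        ContinuousOn (fun t ↦ g (q t)) (Set.Icc (0 : ℝ) 1) := fun g hg t ht ↦
      (ContinuousAt.comp (f := q) (hg _ (hseg t ht)).continuousAt
        (hq t).continuousAt).continuousWithinAt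
    have hεc : ContinuousOn ε (Set.Icc (0 : ℝ) 1) :=
      hcont (fun z ↦ inner ℝ (Z z) (fderiv ℝ F z (y - x))) fun z hz ↦
        (h.contDiffAt_Z hz).inner ℝ
          (((h.contDiffAt_F hz).fderiv_right (m := ∞) (by simp)).clm_apply contDiffAt_const)
    have hlc := hcont lam fun z hz ↦ h.contDiffAt_lam hz
    have hmc := hcont mu fun z hz ↦ h.contDiffAt_mu hz
    have hkc := hcont k fun z hz ↦ h.contDiffAt_kappa hz
    obtain ⟨C₁, hC₁⟩ := isCompact_Icc.exists_bound_of_continuousOn ((hlc.sub hmc).mul hεc)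
    obtain ⟨C₂, hC₂⟩ := isCompact_Icc.exists_bound_of_continuousOn (hεc.mul hkc)
    obtain ⟨C₃, hC₃⟩ := isCompact_Icc.exists_bound_of_continuousOn (hεc.mul hmc)
    -- Grönwall, in the maximum norm of `ℝ × ℝ`: `C₁` controls the first component of `φ'` and `C₂ +
    -- C₃` the second.
    have hzero := eq_zero_of_abs_deriv_le_mul_abs_self_of_eq_zero_right (f := φ) (f' := φ')
      (K := C₁ + (C₂ + C₃))
      (a := 0) (b := 1) (fun t ht ↦ (hφ t ht).continuousAt.continuousWithinAt)
      (fun t ht ↦ (hφ t (Set.Ico_subset_Icc_self ht)).hasDerivWithinAt)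
      (by simp only [φ, q, zero_smul, add_zero, P, Q, hb1]; rw [hb2]; rfl)
      (by
        intro t ht
        have ht' := Set.Ico_subset_Icc_self ht
        have e1 := hC₁ t ht'
        have e2 := hC₂ t ht'
        have e3 := hC₃ t ht'
        have f1 := norm_fst_le (φ t)
        have f2 := norm_snd_le (φ t)
        have g0 := norm_nonneg (φ t)
        have n1 := (norm_nonneg _).trans e1
        have n2 := (norm_nonneg _).trans e2
        have n3 := (norm_nonneg _).trans e3
        have b1 : ‖(φ' t).1‖ ≤ C₁ * ‖φ t‖ := by
          change ‖((lam (q t) - mu (q t)) * ε t) * (φ t).2‖ ≤ _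
          rw [norm_mul]
          exact mul_le_mul e1 f2 (norm_nonneg _) n1
        have b2 : ‖(φ' t).2‖ ≤ C₂ * ‖φ t‖ + C₃ * ‖φ t‖ := by
          refine (norm_add_le _ _).trans (add_le_add ?_ ?_)
          · rw [norm_mul]
            exact mul_le_mul e2 f2 (norm_nonneg _) n2
          · rw [norm_mul]
            exact mul_le_mul e3 f1 (norm_nonneg _) n3
        rw [Prod.norm_def]
        refine max_le (b1.trans ?_) (b2.trans ?_)
        · have := mul_nonneg n2 g0
          have := mul_nonneg n3 g0
          nlinarith
        · have := mul_nonneg n1 g0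
          nlinarith) 1 ⟨zero_le_one, le_rfl⟩
    have hq1 : q 1 = y := by simp [q]
    have z1 : inner ℝ (P y) b = (0 : ℝ) := by
      have := congrArg Prod.fst hzero; simpa only [φ, hq1, Prod.fst_zero] using this
    have z2 : inner ℝ (Q y) b = (0 : ℝ) := by
      have := congrArg Prod.snd hzero; simpa only [φ, hq1, Prod.snd_zero] using this
    intro u hu
    obtain ⟨s, t, rfl⟩ := Submodule.mem_span_pair.1 hu
    rw [inner_add_left, real_inner_smul_left, real_inner_smul_left]
    change s * inner ℝ (P y) b + t * inner ℝ (Q y) b = 0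
    rw [z1, z2]; simp
  exact Submodule.eq_of_le_of_finrank_eq hle
    ((h.finrank_plane hX (hball hy)).trans (h.finrank_plane hX hx).symm)

end LocalPrincipalFrame

/-- A piece of hypersurface of the unit sphere in coordinates, with two principal curvatures `lam`
and `mu`, the second one being simple; no regularity of the principal curvatures is required. -/
structure LocalHypersurface (F G : X → V) (lam mu : X → ℝ) (U : Set X) : Prop where
  isOpen : IsOpen U
  smooth_F : ContDiffOn ℝ ∞ F U
  smooth_G : ContDiffOn ℝ ∞ G U
  norm_F : ∀ x ∈ U, inner ℝ (F x) (F x) = (1 : ℝ)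
  norm_G : ∀ x ∈ U, inner ℝ (G x) (G x) = (1 : ℝ)
  inner_G_F : ∀ x ∈ U, inner ℝ (G x) (F x) = (0 : ℝ)
  inner_G_deriv : ∀ x ∈ U, ∀ v, inner ℝ (G x) (fderiv ℝ F x v) = (0 : ℝ)
  injective : ∀ x ∈ U, Function.Injective (fderiv ℝ F x)
  ne : ∀ x ∈ U, lam x ≠ mu x
  weingarten : ∀ x ∈ U, ∃ e, inner ℝ (fderiv ℝ F x e) (fderiv ℝ F x e) = (1 : ℝ) ∧
    ∀ v, fderiv ℝ G x v = -(lam x • fderiv ℝ F x v) +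
      ((lam x - mu x) * inner ℝ (fderiv ℝ F x e) (fderiv ℝ F x v)) • fderiv ℝ F x e

/-- For the values `l` (taken `N - 1` times) and `m`, the third central moment divided by the second
is `(m - l)(N - 2) / N`, while the mean exceeds `l` by `(m - l) / N`. Thus `N ≠ 2` allows `l` to be
recovered rationally from the power sums. -/
theorem eq_of_power_sums {N l m t₁ t₂ t₃ : ℝ} (hN : 3 ≤ N) (hlm : l ≠ m)
    (h₁ : t₁ = N * l + (m - l)) (h₂ : t₂ = N * l ^ 2 + (m ^ 2 - l ^ 2))
    (h₃ : t₃ = N * l ^ 3 + (m ^ 3 - l ^ 3)) :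
    t₂ - t₁ ^ 2 / N ≠ 0 ∧
    l = t₁ / N - (1 / (N - 2)) * ((t₃ - 3 * t₂ * t₁ / N + 2 * t₁ ^ 3 / N ^ 2) /
      (t₂ - t₁ ^ 2 / N)) := by
  have hd := sub_ne_zero.2 hlm
  have hN0 : N ≠ 0 := by linarith
  have hN1 : N - 1 ≠ 0 := by intro h; linarith
  have hN2 : N - 2 ≠ 0 := by intro h; linarith
  have e1 : t₂ - t₁ ^ 2 / N = (l - m) ^ 2 * (N - 1) / N := by
    rw [h₁, h₂]; field_simp; ring
  have e2 : t₃ - 3 * t₂ * t₁ / N + 2 * t₁ ^ 3 / N ^ 2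
      = -((l - m) ^ 3 * (N - 1) * (N - 2) / N ^ 2) := by
    rw [h₁, h₂, h₃]; field_simp; ring
  rw [e1, e2]
  refine ⟨div_ne_zero (mul_ne_zero (pow_ne_zero _ hd) hN1) hN0, ?_⟩
  rw [h₁]; field_simp; ring

namespace LocalHypersurface

variable [FiniteDimensional ℝ X] [FiniteDimensional ℝ V] (hX : 3 ≤ Module.finrank ℝ X)
  (h : LocalHypersurface F G lam mu U) {x₀ : X} (hx₀ : x₀ ∈ U)
include hX h hx₀

/-- The traces of the powers of the shape operator are smooth, and `eq_of_power_sums` expresses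
`lam` rationally in the first three; `mu` then follows from the trace. -/
theorem contDiffAt_curvatures : ContDiffAt ℝ ∞ lam x₀ ∧ ContDiffAt ℝ ∞ mu x₀ := by
  obtain ⟨L₀, hL₀⟩ := (fderiv ℝ F x₀ : X →ₗ[ℝ] V).exists_leftInverse_of_injective
    (LinearMap.ker_eq_bot.2 (h.injective x₀ hx₀))
  let L : V →L[ℝ] X := L₀.toContinuousLinearMap
  have hF : ContDiffAt ℝ ∞ (fderiv ℝ F) x₀ :=
    (h.smooth_F.contDiffAt (h.isOpen.mem_nhds hx₀)).fderiv_right (by simp)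
  have hG : ContDiffAt ℝ ∞ (fderiv ℝ G) x₀ :=
    (h.smooth_G.contDiffAt (h.isOpen.mem_nhds hx₀)).fderiv_right (by simp)
  have hLF : ContDiffAt ℝ ∞ (fun x ↦ L.comp (fderiv ℝ F x)) x₀ := contDiffAt_const.clm_comp hF
  have hLG : ContDiffAt ℝ ∞ (fun x ↦ L.comp (fderiv ℝ G x)) x₀ := contDiffAt_const.clm_comp hG
  have hid : L.comp (fderiv ℝ F x₀) = ((ContinuousLinearEquiv.refl ℝ X : X ≃L[ℝ] X) : X →L[ℝ] X) := by
    ext v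
    exact DFunLike.congr_fun hL₀ v
  -- Near `x₀` this is the shape operator: composing with the left inverse `L` of `dF x₀` makes `dF
  -- x` an invertible endomorphism for nearby `x`.
  let A : X → X →L[ℝ] X := fun x ↦
    -((ContinuousLinearMap.inverse (L.comp (fderiv ℝ F x))).comp (L.comp (fderiv ℝ G x)))
  have hA : ContDiffAt ℝ ∞ A x₀ := by
    have hinv : ContDiffAt ℝ ∞ (fun x ↦ ContinuousLinearMap.inverse (L.comp (fderiv ℝ F x))) x₀ := by
      refine ContDiffAt.comp x₀ (g := ContinuousLinearMap.inverse) ?_ hLF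
      rw [hid]
      exact contDiffAt_map_inverse _
    exact (hinv.clm_comp hLG).neg
  have hev : ∀ᶠ x in nhds x₀, x ∈ U ∧
      L.comp (fderiv ℝ F x) ∈ Set.range ((↑) : (X ≃L[ℝ] X) → (X →L[ℝ] X)) := by
    have hUx : ∀ᶠ x in nhds x₀, x ∈ U := h.isOpen.mem_nhds hx₀
    refine hUx.and (hLF.continuousAt.eventually (ContinuousLinearEquiv.isOpen.mem_nhds ?_))
    exact ⟨_, hid.symm⟩
  let tr : (X →L[ℝ] X) →ₗ[ℝ] ℝ := (LinearMap.trace ℝ X).comp (ContinuousLinearMap.coeLM ℝ)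
  let trc : (X →L[ℝ] X) →L[ℝ] ℝ := tr.toContinuousLinearMap
  have ht : ∀ k : ℕ, ContDiffAt ℝ ∞ (fun x ↦ trc (A x ^ k)) x₀ := fun k ↦
    trc.contDiff.contDiffAt.comp x₀ (hA.pow k)
  obtain ⟨N, hN⟩ : ∃ N : ℝ, N = (Module.finrank ℝ X : ℝ) := ⟨_, rfl⟩
  have hN3 : 3 ≤ N := by rw [hN]; exact_mod_cast hX
  have htr : ∀ᶠ x in nhds x₀, x ∈ U ∧
      ∀ k : ℕ, trc (A x ^ k) = N * lam x ^ k + (mu x ^ k - lam x ^ k) := by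
    filter_upwards [hev] with x ⟨hx, e, he⟩
    refine ⟨hx, ?_⟩
    obtain ⟨d, hd1, hd2⟩ := h.weingarten x hx
    let ε : X →L[ℝ] ℝ := (innerSL ℝ (fderiv ℝ F x d)).comp (fderiv ℝ F x)
    -- The projection onto the `mu`-direction: idempotent of trace one, so that the powers of `A =
    -- lam + (mu - lam) R` are explicit.
    let R : X →L[ℝ] X := ε.smulRight d
    have hεd : ε d = 1 := hd1
    have hRR : R * R = R := by
      ext v
      change ε (ε v • d) • d = ε v • d
      rw [map_smul, hεd, smul_eq_mul, mul_one]
    have hAx : A x = lam x • (1 : X →L[ℝ] X) + (mu x - lam x) • R := by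
      ext v
      simp only [A]
      rw [← he, ContinuousLinearMap.inverse_equiv]
      change -(e.symm (L (fderiv ℝ G x v))) = lam x • v + (mu x - lam x) • (ε v • d)
      have heL : ∀ w, L (fderiv ℝ F x w) = e w := fun w ↦ by
        exact (DFunLike.congr_fun he w).symm
      rw [hd2 v, map_add, map_neg, map_smul, map_smul, heL, heL, map_add, map_neg, map_smul,
        map_smul, e.symm_apply_apply, e.symm_apply_apply]
      change -(-(lam x • v) + ((lam x - mu x) * ε v) • d) = _
      module
    have hpow : ∀ k : ℕ, A x ^ k
        = (lam x ^ k) • (1 : X →L[ℝ] X) + (mu x ^ k - lam x ^ k) • R := by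
      intro k
      induction k with
      | zero => simp
      | succ k ih =>
        rw [pow_succ, ih, hAx]
        simp only [add_mul, mul_add, smul_mul_smul_comm, mul_one, one_mul, hRR]
        module
    intro k
    have h1 : trc (1 : X →L[ℝ] X) = N := (LinearMap.trace_id ℝ X).trans hN.symm
    have h2 : trc R = 1 := by
      have : trc R = ε d := LinearMap.trace_smulRight (ε : X →ₗ[ℝ] ℝ) d
      rw [this, hεd]
    rw [hpow, map_add, map_smul, map_smul, h1, h2, smul_eq_mul, smul_eq_mul]
    ring
  have hden : trc (A x₀ ^ 2) - trc (A x₀ ^ 1) ^ 2 / N ≠ 0 := by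
    obtain ⟨hx, hk⟩ := htr.self_of_nhds
    exact (eq_of_power_sums hN3 (h.ne x₀ hx) (by simpa using hk 1) (hk 2) (hk 3)).1
  have hlam : ContDiffAt ℝ ∞ lam x₀ := by
    have hR : ContDiffAt ℝ ∞ (fun x ↦ trc (A x ^ 1) / N - (1 / (N - 2)) *
        ((trc (A x ^ 3) - 3 * trc (A x ^ 2) * trc (A x ^ 1) / N
          + 2 * trc (A x ^ 1) ^ 3 / N ^ 2) / (trc (A x ^ 2) - trc (A x ^ 1) ^ 2 / N))) x₀ := by
      have t1 := ht 1
      have t2 := ht 2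
      have t3 := ht 3
      exact (t1.div_const N).sub (contDiffAt_const.mul
        (((t3.sub (((contDiffAt_const.mul t2).mul t1).div_const N)).add
          ((contDiffAt_const.mul (t1.pow 3)).div_const (N ^ 2))).div
            (t2.sub ((t1.pow 2).div_const N)) hden))
    refine hR.congr_of_eventuallyEq ?_
    filter_upwards [htr] with x ⟨hx, hk⟩
    exact (eq_of_power_sums hN3 (h.ne x hx) (by simpa using hk 1) (hk 2) (hk 3)).2
  refine ⟨hlam, ?_⟩
  refine ((ht 1).sub (contDiffAt_const.mul hlam : ContDiffAt ℝ ∞ (fun x ↦ (N - 1) * lam x) x₀)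
    ).congr_of_eventuallyEq ?_
  filter_upwards [htr] with x ⟨hx, hk⟩
  rw [hk 1]; ring

/-- The directions supplied by `weingarten` need not vary smoothly. With `e₀` frozen at `x₀`, the
smooth vector `dG e₀ + lam dF e₀` is a multiple of the principal direction wherever it is nonzero,
and at `x₀` it equals `(lam - mu) dF e₀`. Normalising it gives `Z`. -/
theorem exists_frame {φ : ℝ → ℝ} (hφ : ∀ x ∈ U, DifferentiableAt ℝ φ (lam x))
    (hmu : ∀ x ∈ U, mu x = φ (lam x)) :
    ∃ (Z : X → V) (v₀ : X) (W : Set X), x₀ ∈ W ∧ W ⊆ U ∧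
      LocalPrincipalFrame F G Z lam mu v₀ W := by
  obtain ⟨e₀, he₀, hw₀⟩ := h.weingarten x₀ hx₀
  have hlam : ContDiffOn ℝ ∞ lam U := fun x hx ↦
    (h.contDiffAt_curvatures hX hx).1.contDiffWithinAt
  have hmus : ContDiffOn ℝ ∞ mu U := fun x hx ↦
    (h.contDiffAt_curvatures hX hx).2.contDiffWithinAt
  have hdF : ContDiffOn ℝ ∞ (fderiv ℝ F) U := h.smooth_F.fderiv_of_isOpen h.isOpen (by simp)
  have hdG : ContDiffOn ℝ ∞ (fderiv ℝ G) U := h.smooth_G.fderiv_of_isOpen h.isOpen (by simp)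
  let w : X → V := fun x ↦ fderiv ℝ G x e₀ + lam x • fderiv ℝ F x e₀
  have hws : ContDiffOn ℝ ∞ w U := (hdG.clm_apply contDiffOn_const).add
    (hlam.smul (hdF.clm_apply contDiffOn_const))
  let W : Set X := U ∩ w ⁻¹' {0}ᶜ
  have hWo : IsOpen W := hws.continuousOn.isOpen_inter_preimage h.isOpen isOpen_compl_singleton
  have hWU : W ⊆ U := Set.inter_subset_left
  let Z : X → V := fun x ↦ ‖w x‖⁻¹ • w x
  have hw : ∀ x ∈ W, ∃ e, fderiv ℝ F x e = Z x ∧ inner ℝ (Z x) (Z x) = (1 : ℝ) ∧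
      inner ℝ (Z x) (fderiv ℝ F x e₀) ≠ (0 : ℝ) ∧
      ∀ v, fderiv ℝ G x v = -(lam x • fderiv ℝ F x v)
        + ((lam x - mu x) * inner ℝ (Z x) (fderiv ℝ F x v)) • Z x := by
    rintro x ⟨hx, hwx⟩
    have hwx : w x ≠ 0 := hwx
    obtain ⟨e, he, hG⟩ := h.weingarten x hx
    set ε : ℝ := inner ℝ (fderiv ℝ F x e) (fderiv ℝ F x e₀) with hε
    have hwe : w x = ((lam x - mu x) * ε) • fderiv ℝ F x e := by
      simp only [w, hG e₀]; rw [← hε]; abel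
    set c := (lam x - mu x) * ε with hc
    have hn : ‖fderiv ℝ F x e‖ = 1 := by
      rw [real_inner_self_eq_norm_sq] at he
      nlinarith [norm_nonneg (fderiv ℝ F x e)]
    have hc0 : c ≠ 0 := fun h0 ↦ hwx (by rw [hwe, h0, zero_smul])
    set σ := |c|⁻¹ * c with hσ
    have hσ2 : σ * σ = 1 := by
      rw [hσ]
      have : |c| ≠ 0 := abs_ne_zero.2 hc0
      field_simp
      exact (sq_abs c).symm
    have hZ : Z x = σ • fderiv ℝ F x e := by
      simp only [Z]
      rw [hwe, norm_smul, hn, mul_one, Real.norm_eq_abs, smul_smul]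
    refine ⟨σ • e, by rw [map_smul, hZ], ?_, ?_, fun v ↦ ?_⟩
    · rw [hZ, real_inner_smul_left, real_inner_smul_right, he, mul_one, hσ2]
    · rw [hZ, real_inner_smul_left, ← hε]
      refine mul_ne_zero (fun h0 ↦ by simp [h0] at hσ2) fun h0 ↦ hc0 (by rw [hc, h0, mul_zero])
    · rw [hG v, hZ, real_inner_smul_left, smul_smul]
      congr 2
      linear_combination (-(lam x - mu x) * inner ℝ (fderiv ℝ F x e) (fderiv ℝ F x v)) * hσ2
  refine ⟨Z, e₀, W, ⟨hx₀, ?_⟩, hWU, ⟨hWo, h.smooth_F.mono hWU, h.smooth_G.mono hWU, ?_,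
    hlam.mono hWU, hmus.mono hWU, fun x hx ↦ h.norm_F x (hWU hx), fun x hx ↦ h.norm_G x (hWU hx),
    fun x hx ↦ ?_, fun x hx ↦ h.inner_G_F x (hWU hx), fun x hx ↦ h.inner_G_deriv x (hWU hx),
    fun x hx ↦ h.injective x (hWU hx), fun x hx ↦ ?_, fun x hx ↦ ?_, fun x hx ↦ h.ne x (hWU hx),
    fun x hx u hu ↦ ?_, fun x hx ↦ ?_⟩⟩
  · have hwe : w x₀ = (lam x₀ - mu x₀) • fderiv ℝ F x₀ e₀ := by
      simp only [w, hw₀ e₀, he₀, mul_one]; abel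
    change w x₀ ≠ 0
    rw [hwe]
    refine smul_ne_zero (sub_ne_zero.2 (h.ne x₀ hx₀)) fun h0 ↦ ?_
    rw [h0, inner_zero_left] at he₀
    exact zero_ne_one he₀
  · have hWs := hws.mono hWU
    exact ((hWs.norm ℝ fun x hx ↦ hx.2).inv fun x hx ↦ norm_ne_zero_iff.2 hx.2).smul hWs
  · obtain ⟨e, -, h2, -, -⟩ := hw x hx
    exact h2
  · obtain ⟨e, h1, -⟩ := hw x hx
    exact ⟨e, h1⟩
  · obtain ⟨e, -, -, -, h2⟩ := hw x hx
    exact h2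
  · have hd : HasFDerivAt mu (deriv φ (lam x) • fderiv ℝ lam x) x := by
      have h1 := (hφ x (hWU hx)).hasDerivAt.comp_hasFDerivAt x
        ((h.contDiffAt_curvatures hX (hWU hx)).1.differentiableAt (by simp)).hasFDerivAt
      refine h1.congr_of_eventuallyEq ?_
      filter_upwards [h.isOpen.mem_nhds (hWU hx)] with y hy using hmu y hy
    rw [hd.fderiv, smul_apply, hu, smul_zero]
  · obtain ⟨e, -, -, h2, -⟩ := hw x hx
    exact h2

end LocalHypersurface
end LocalTheory

/-! ### Transferring smoothness and derivatives through the immersion -/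

section Immersion

open Topology

variable {n : ℕ} {M : Type*} [EMetricSpace M] [ChartedSpace (EE n) M]
  [Bundle.RiemannianBundle (fun x : M ↦ TangentSpace (𝓡 n) x)]
  {f N : M → EE (n + 2)}

namespace IsOrientedHypersurface

variable (h : IsOrientedHypersurface f N)
include h

theorem mdifferentiableAt (x : M) : MDifferentiableAt (𝓡 n) 𝓘(ℝ, EE (n + 2)) f x :=
  h.contMDiff.contMDiffAt.mdifferentiableAt (by simp)

theorem mdifferentiableAt_normal (x : M) : MDifferentiableAt (𝓡 n) 𝓘(ℝ, EE (n + 2)) N x :=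
  h.contMDiff_normal.contMDiffAt.mdifferentiableAt (by simp)

theorem diffl_injective (x : M) : Function.Injective (diffl (n := n) f x) := by
  rw [← LinearMap.ker_eq_bot, LinearMap.ker_eq_bot']
  intro w hw
  have hw2 := h.isometric x w w
  rw [hw, inner_zero_left] at hw2
  exact inner_self_eq_zero.1 hw2.symm

theorem inner_self (x : M) : inner ℝ (f x) (f x) = (1 : ℝ) := by
  have := h.mem_sphere x
  rw [mem_sphere_zero_iff_norm] at this
  rw [real_inner_self_eq_norm_sq, this]; norm_num

theorem inner_normal_self (x : M) : inner ℝ (N x) (N x) = (1 : ℝ) := by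
  rw [real_inner_self_eq_norm_sq, h.norm_normal]; norm_num

theorem inner_diffl (x : M) (v : TangentSpace (𝓡 n) x) :
    inner ℝ (f x) (diffl f x v) = (0 : ℝ) := by
  have := inner_diffl_add (h.mdifferentiableAt x) (h.mdifferentiableAt x) h.inner_self v
  linarith [real_inner_comm (f x) (diffl f x v)]

theorem exists_diffl_eq {x : M} {y : EE (n + 2)} (h1 : inner ℝ (f x) y = (0 : ℝ))
    (h2 : inner ℝ (N x) y = (0 : ℝ)) : ∃ v, diffl (n := n) f x v = y := by
  let L : (TangentSpace (𝓡 n) x × ℝ × ℝ) →ₗ[ℝ] EE (n + 2) := (diffl f x).coprod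
    ((LinearMap.toSpanSingleton ℝ _ (f x)).coprod (LinearMap.toSpanSingleton ℝ _ (N x)))
  have hL : ∀ u a b, L (u, a, b) = diffl f x u + (a • f x + b • N x) := fun u a b ↦ by simp [L]
  have hFG : inner ℝ (f x) (N x) = (0 : ℝ) := by
    rw [real_inner_comm]; exact h.normal_tangent_sphere x
  have hip : ∀ u a b, inner ℝ (f x) (L (u, a, b)) = a ∧ inner ℝ (N x) (L (u, a, b)) = b := by
    intro u a b
    rw [hL]
    simp only [inner_add_right, real_inner_smul_right, h.inner_diffl, h.normal_orthogonal,
      h.inner_self, h.inner_normal_self, hFG, h.normal_tangent_sphere]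
    constructor <;> ring
  have hinj : Function.Injective L := by
    rw [← LinearMap.ker_eq_bot, LinearMap.ker_eq_bot']
    rintro ⟨u, a, b⟩ h0
    have hab := hip u a b
    rw [h0, inner_zero_right, inner_zero_right] at hab
    obtain ⟨rfl, rfl⟩ := hab
    rw [hL] at h0
    simp only [zero_smul, add_zero] at h0
    have : u = 0 := h.diffl_injective x (h0.trans (map_zero _).symm)
    rw [this]; rfl
  have hsurj : Function.Surjective L := by
    refine (LinearMap.injective_iff_surjective_of_finrank_eq_finrank ?_).1 hinj
    have : Module.finrank ℝ (TangentSpace (𝓡 n) x) = n := finrank_euclideanSpace_fin (𝕜 := ℝ)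
    rw [Module.finrank_prod, Module.finrank_prod, this]
    simp
  obtain ⟨⟨u, a, b⟩, rfl⟩ := hsurj y
  have hab := hip u a b
  rw [h1, h2] at hab
  obtain ⟨rfl, rfl⟩ := hab
  exact ⟨u, by rw [hL]; simp⟩

variable [IsManifold (𝓡 n) ∞ M]

/-- A smooth local left inverse of an immersion. -/
theorem exists_localRetraction (x₀ : M) : ∃ (ρ : EE (n + 2) → M) (W : Set (EE (n + 2))),
    IsOpen W ∧ f x₀ ∈ W ∧ ContMDiffOn 𝓘(ℝ, EE (n + 2)) (𝓡 n) ∞ ρ W ∧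
    ∀ᶠ x in 𝓝 x₀, ρ (f x) = x := by
  obtain ⟨L₀, hL₀⟩ := (diffl (n := n) f x₀).exists_leftInverse_of_injective
    (LinearMap.ker_eq_bot.2 (h.diffl_injective x₀))
  let L₁ : EE (n + 2) →ₗ[ℝ] EE n := L₀
  let L : EE (n + 2) →L[ℝ] EE n := L₁.toContinuousLinearMap
  have hs : ContMDiff (𝓡 n) 𝓘(ℝ, EE n) ∞ (fun x ↦ L (f x)) :=
    L.contDiff.contMDiff.comp h.contMDiff
  have hd : HasMFDerivAt (𝓡 n) 𝓘(ℝ, EE n) (fun x ↦ L (f x)) x₀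
      (ContinuousLinearMap.comp (L : EE (n + 2) →L[ℝ] EE n)
        (mfderiv (𝓡 n) 𝓘(ℝ, EE (n + 2)) f x₀ : EE n →L[ℝ] EE (n + 2))) :=
    HasMFDerivAt.comp x₀ L.hasMFDerivAt (h.mdifferentiableAt x₀).hasMFDerivAt
  have hid : ∀ v, mfderiv (𝓡 n) 𝓘(ℝ, EE n) (fun x ↦ L (f x)) x₀ v = v := by
    intro v
    rw [hd.mfderiv]
    exact DFunLike.congr_fun hL₀ v
  -- The differential of `L ∘ f` at `x₀` is the identity, so `L ∘ f` is locally invertible. Its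
  -- inverse composed with `L` is defined on an open set of the ambient space.
  have hloc := isLocalDiffeomorphAt_of_bijective hs x₀
    ⟨fun a b hab ↦ by rw [hid, hid] at hab; exact hab, fun b ↦ ⟨b, hid b⟩⟩
  refine ⟨fun y ↦ hloc.localInverse (L y), L ⁻¹' hloc.localInverse.source,
    hloc.localInverse_open_source.preimage L.continuous, hloc.localInverse_mem_source, ?_, ?_⟩
  · exact hloc.contmdiffOn_localInverse.comp L.contDiff.contMDiff.contMDiffOn fun y hy ↦ hy
  · exact hloc.localInverse_eventuallyEq_left

theorem isLocallyInjective : IsLocallyInjective f := by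
  rw [isLocallyInjective_iff_nhds]
  intro x
  obtain ⟨ρ, -, -, -, -, h1⟩ := h.exists_localRetraction x
  refine ⟨_, h1, fun a ha b hb hab ↦ ?_⟩
  have ha' : ρ (f a) = a := ha
  have hb' : ρ (f b) = b := hb
  rw [← ha', hab, hb']

section Transfer

variable {E' : Type*} [NormedAddCommGroup E'] [NormedSpace ℝ E'] {H' : Type*} [TopologicalSpace H']
  {J : ModelWithCorners ℝ E' H'} {Q : Type*} [TopologicalSpace Q] [ChartedSpace H' Q]

/-- A continuous map into `M` is as smooth as its composition with the immersion. -/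
theorem contMDiffAt_of_comp {g : Q → M} {q : Q} {k : ℕ∞} (hg : ContinuousAt g q)
    (hfg : ContMDiffAt J 𝓘(ℝ, EE (n + 2)) k (f ∘ g) q) : ContMDiffAt J (𝓡 n) k g q := by
  obtain ⟨ρ, W, hW, hxW, hρ, h1⟩ := h.exists_localRetraction (g q)
  have hρ' : ContMDiffAt 𝓘(ℝ, EE (n + 2)) (𝓡 n) k ρ (f (g q)) :=
    (hρ.contMDiffAt (hW.mem_nhds hxW)).of_le (WithTop.coe_le_coe.2 le_top)
  refine (ContMDiffAt.comp q (g := ρ) (f := f ∘ g) hρ' hfg).congr_of_eventuallyEq ?_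
  exact (hg.eventually h1).mono fun y hy ↦ hy.symm

end Transfer

/-- A continuous curve in `M` is differentiable if its composition with the immersion is. -/
theorem hasMFDerivAt_of_comp {γ : ℝ → M} {t : ℝ} {v : TangentSpace (𝓡 n) (γ t)}
    (hγ : ContinuousAt γ t) (hfγ : HasDerivAt (f ∘ γ) (diffl f (γ t) v) t) :
    HasMFDerivAt 𝓘(ℝ, ℝ) (𝓡 n) γ t ((1 : ℝ →L[ℝ] ℝ).smulRight v) := by
  have hs : MDifferentiableAt 𝓘(ℝ, ℝ) (𝓡 n) γ t := by
    obtain ⟨ρ, W, hW, hxW, hρ, h1⟩ := h.exists_localRetraction (γ t)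
    have hρ' : MDifferentiableAt 𝓘(ℝ, EE (n + 2)) (𝓡 n) ρ (f (γ t)) :=
      (hρ.contMDiffAt (hW.mem_nhds hxW)).mdifferentiableAt (by simp)
    refine (MDifferentiableAt.comp t (g := ρ) (f := f ∘ γ) hρ'
      hfγ.differentiableAt.mdifferentiableAt).congr_of_eventuallyEq ?_
    exact (hγ.eventually h1).mono fun y hy ↦ hy.symm
  have h2 := hs.hasMFDerivAt
  have h3 : HasMFDerivAt 𝓘(ℝ, ℝ) 𝓘(ℝ, EE (n + 2)) (f ∘ γ) t
      ((mfderiv (𝓡 n) 𝓘(ℝ, EE (n + 2)) f (γ t)).comp (mfderiv 𝓘(ℝ, ℝ) (𝓡 n) γ t)) :=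
    (h.mdifferentiableAt (γ t)).hasMFDerivAt.comp t h2
  have h4 := hasMFDerivAt_unique h3 hfγ.hasFDerivAt.hasMFDerivAt
  have h6 : (1 : ℝ →L[ℝ] ℝ).smulRight v = mfderiv 𝓘(ℝ, ℝ) (𝓡 n) γ t := by
    refine ContinuousLinearMap.ext_ring ?_
    apply h.diffl_injective (γ t)
    have h5 := DFunLike.congr_fun h4 (1 : ℝ)
    refine Eq.trans ?_ h5.symm
    change diffl f (γ t) ((1 : ℝ) • v) = (1 : ℝ) • diffl f (γ t) v
    rw [map_smul]
  rw [h6]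
  exact h2

omit [IsManifold (𝓡 n) ∞ M] in
theorem hasDerivAt_comp {γ : ℝ → M} {t : ℝ} {v : TangentSpace (𝓡 n) (γ t)}
    (hγ : HasMFDerivAt 𝓘(ℝ, ℝ) (𝓡 n) γ t ((1 : ℝ →L[ℝ] ℝ).smulRight v)) :
    HasDerivAt (f ∘ γ) (diffl f (γ t) v) t := by
  let L : ℝ →L[ℝ] EE (n + 2) := ContinuousLinearMap.comp
    (mfderiv (𝓡 n) 𝓘(ℝ, EE (n + 2)) f (γ t) : EE n →L[ℝ] EE (n + 2))
    ((1 : ℝ →L[ℝ] ℝ).smulRight (v : EE n))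
  have h3 : HasFDerivAt (f ∘ γ) L t :=
    (HasMFDerivAt.comp t (h.mdifferentiableAt (γ t)).hasMFDerivAt hγ).hasFDerivAt
  have h4 : L 1 = diffl f (γ t) v := by
    change diffl f (γ t) ((1 : ℝ) • v) = diffl f (γ t) v
    rw [one_smul]
  exact h4 ▸ h3.hasDerivAt

/-- A tangent vector field is smooth if its image under the immersion is. -/
theorem contMDiff_vectorField {Y : M → EE (n + 2)} (hY : ContMDiff (𝓡 n) 𝓘(ℝ, EE (n + 2)) ∞ Y)
    {v : ∀ x : M, TangentSpace (𝓡 n) x} (hv : ∀ x, diffl f x (v x) = Y x) :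
    ContMDiff (𝓡 n) (𝓡 n).tangent 1 (fun x ↦ (⟨x, v x⟩ : TangentBundle (𝓡 n) M)) := by
  intro x₀
  rw [Bundle.contMDiffAt_section]
  obtain ⟨ρ, W, hW, hxW, hρ, h1⟩ := h.exists_localRetraction x₀
  have hx₀ : ρ (f x₀) = x₀ := h1.self_of_nhds
  have hc : ContMDiffAt (𝓡 n) 𝓘(ℝ, EE n) ∞ (extChartAt (𝓡 n) x₀) x₀ := contMDiffAt_extChartAt
  -- Near `x₀`, `g ∘ f` is the chart, so in the trivialization at `x₀` the field reads `x ↦ Dg (f x)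
  -- (Y x)`.
  let g : EE (n + 2) → EE n := extChartAt (𝓡 n) x₀ ∘ ρ
  have hg : ContDiffAt ℝ ∞ g (f x₀) := by
    rw [← contMDiffAt_iff_contDiffAt]
    refine ContMDiffAt.comp (f x₀) (g := extChartAt (𝓡 n) x₀) ?_ (hρ.contMDiffAt (hW.mem_nhds hxW))
    rw [hx₀]; exact hc
  have hg' : ContMDiffAt 𝓘(ℝ, EE (n + 2)) 𝓘(ℝ, EE (n + 2) →L[ℝ] EE n) 1 (fderiv ℝ g) (f x₀) :=
    (hg.fderiv_right (m := 1) two_le_infty).contMDiffAt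
  have hle : (1 : WithTop ℕ∞) ≤ ∞ := WithTop.coe_le_coe.2 le_top
  have hfin : ContMDiffAt (𝓡 n) 𝓘(ℝ, EE n) 1 (fun x ↦ fderiv ℝ g (f x) (Y x)) x₀ :=
    (ContMDiffAt.comp x₀ (g := fderiv ℝ g) (f := f) hg' (h.contMDiff.contMDiffAt.of_le hle)).clm_apply
      (hY.contMDiffAt.of_le hle)
  refine hfin.congr_of_eventuallyEq ?_
  have hWx : ∀ᶠ x in 𝓝 x₀, f x ∈ W := h.contMDiff.continuous.continuousAt.eventually
    (hW.mem_nhds hxW)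
  filter_upwards [h1.eventually_nhds, hWx, (chartAt (EE n) x₀).open_source.mem_nhds
    (mem_chart_source (EE n) x₀)] with x hx hxW hxs
  have hρx : MDifferentiableAt 𝓘(ℝ, EE (n + 2)) (𝓡 n) ρ (f x) :=
    (hρ.contMDiffAt (hW.mem_nhds hxW)).mdifferentiableAt (by simp)
  have hρfx : ρ (f x) = x := hx.self_of_nhds
  have hcx : MDifferentiableAt (𝓡 n) 𝓘(ℝ, EE n) (extChartAt (𝓡 n) x₀) x :=
    mdifferentiableAt_extChartAt hxs
  have hgx : MDifferentiableAt 𝓘(ℝ, EE (n + 2)) 𝓘(ℝ, EE n) g (f x) :=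
    MDifferentiableAt.comp (f x) (by rw [hρfx]; exact hcx) hρx
  have e1 : HasMFDerivAt (𝓡 n) 𝓘(ℝ, EE n) (g ∘ f) x
      ((mfderiv 𝓘(ℝ, EE (n + 2)) 𝓘(ℝ, EE n) g (f x)).comp
        (mfderiv (𝓡 n) 𝓘(ℝ, EE (n + 2)) f x)) :=
    hgx.hasMFDerivAt.comp x (h.mdifferentiableAt x).hasMFDerivAt
  have e2 : g ∘ f =ᶠ[𝓝 x] extChartAt (𝓡 n) x₀ := hx.mono fun y hy ↦ by
    simp only [g, Function.comp, hy]
  have e3 := hasMFDerivAt_unique (e1.congr_of_eventuallyEq e2.symm) hcx.hasMFDerivAt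
  have e4 := DFunLike.congr_fun e3 (v x)
  rw [mfderiv_eq_fderiv] at e4
  have e5 : fderiv ℝ g (f x) (Y x) = mfderiv (𝓡 n) 𝓘(ℝ, EE n) (extChartAt (𝓡 n) x₀) x (v x) := by
    rw [← hv x]; exact e4
  have e6 : (trivializationAt (EE n) (TangentSpace (𝓡 n)) x₀).continuousLinearMapAt ℝ x (v x)
      = (trivializationAt (EE n) (TangentSpace (𝓡 n)) x₀ ⟨x, v x⟩).2 := by
    rw [Bundle.Trivialization.continuousLinearMapAt_apply,
      Bundle.Trivialization.linearMapAt_apply, if_pos (by simpa using hxs)]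
  exact e6.symm.trans ((DFunLike.congr_fun
    (TangentBundle.continuousLinearMapAt_trivializationAt hxs) (v x)).trans e5.symm)

/-- Integral curves of smooth vector fields are smooth. -/
theorem contMDiffOn_integralCurve {Y : M → EE (n + 2)}
    (hY : ContMDiff (𝓡 n) 𝓘(ℝ, EE (n + 2)) ∞ Y)
    {v : ∀ x : M, TangentSpace (𝓡 n) x} (hv : ∀ x, diffl f x (v x) = Y x) {γ : ℝ → M} {s : Set ℝ}
    (hs : IsOpen s) (hγ : IsMIntegralCurveOn γ v s) : ContMDiffOn 𝓘(ℝ, ℝ) (𝓡 n) ∞ γ s := by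
  have hd : ∀ t ∈ s, HasDerivAt (f ∘ γ) (Y (γ t)) t := fun t ht ↦ by
    rw [← hv]; exact h.hasDerivAt_comp ((hγ t ht).hasMFDerivAt (hs.mem_nhds ht))
  -- Bootstrap: the derivative of `f ∘ γ` is `Y ∘ γ`, so each order of smoothness yields the next.
  have hk : ∀ k : ℕ, ContMDiffOn 𝓘(ℝ, ℝ) (𝓡 n) k γ s := by
    intro k
    induction k with
    | zero => exact contMDiffOn_zero_iff.2 hγ.continuousOn
    | succ k ih =>
      have h1 : ContDiffOn ℝ ((k : WithTop ℕ∞) + 1) (f ∘ γ) s := by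
        rw [contDiffOn_succ_iff_deriv_of_isOpen hs]
        refine ⟨fun t ht ↦ (hd t ht).differentiableAt.differentiableWithinAt,
          fun h0 ↦ by simp at h0, ?_⟩
        have h2 : ContDiffOn ℝ k (Y ∘ γ) s := by
          rw [← contMDiffOn_iff_contDiffOn]
          have hle : (k : WithTop ℕ∞) ≤ ∞ := by exact_mod_cast (WithTop.coe_le_coe.2 le_top)
          exact (hY.of_le hle).comp_contMDiffOn ih
        exact h2.congr fun t ht ↦ (hd t ht).deriv
      intro t ht
      have h3 : ContMDiffAt 𝓘(ℝ, ℝ) 𝓘(ℝ, EE (n + 2)) (((k + 1 : ℕ) : ℕ∞) : WithTop ℕ∞)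
          (f ∘ γ) t := by
        rw [contMDiffAt_iff_contDiffAt]
        have := h1.contDiffAt (hs.mem_nhds ht)
        exact_mod_cast this
      have := h.contMDiffAt_of_comp (hγ.continuousOn.continuousAt (hs.mem_nhds ht)) h3
      exact_mod_cast this.contMDiffWithinAt
  exact contMDiffOn_infty.2 hk

end IsOrientedHypersurface

end Immersion

/-! ### Completeness of bounded vector fields -/

section Completeness

open Topology Set

variable {n : ℕ} {M : Type*} [EMetricSpace M] [ChartedSpace (EE n) M] [IsManifold (𝓡 n) ∞ M]
  [Bundle.RiemannianBundle (fun x : M ↦ TangentSpace (𝓡 n) x)]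
  {f N : M → EE (n + 2)}

namespace IsOrientedHypersurface

variable (h : IsOrientedHypersurface f N) {Y : M → EE (n + 2)}
    (hY : ContMDiff (𝓡 n) 𝓘(ℝ, EE (n + 2)) ∞ Y)
    {v : ∀ x : M, TangentSpace (𝓡 n) x} (hv : ∀ x, diffl f x (v x) = Y x)

include h hv in
omit [IsManifold (𝓡 n) ∞ M] in
theorem norm_vectorField (x : M) : ‖v x‖ = ‖Y x‖ := by
  have h1 := h.isometric x (v x) (v x)
  rw [hv, real_inner_self_eq_norm_sq, real_inner_self_eq_norm_sq] at h1
  exact ((sq_eq_sq₀ (norm_nonneg _) (norm_nonneg _)).1 h1).symm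

include h hY hv

/-- The Riemannian distance is at most the length of the curve, whose speed is the norm of `Y`. This
is what connects metric completeness with flows. -/
theorem edist_integralCurve_le [IsRiemannianManifold (𝓡 n) M] {C : NNReal} (hC : ∀ x, ‖Y x‖ ≤ C)
    {γ : ℝ → M} {a b : ℝ} (hγ : IsMIntegralCurveOn γ v (Ioo a b)) {s t : ℝ} (hs : s ∈ Ioo a b)
    (ht : t ∈ Ioo a b) (hst : s ≤ t) : edist (γ s) (γ t) ≤ C * edist s t := by
  have hsub : Icc s t ⊆ Ioo a b := fun r hr ↦ ⟨hs.1.trans_le hr.1, hr.2.trans_lt ht.2⟩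
  have hsm : ContMDiffOn 𝓘(ℝ, ℝ) (𝓡 n) 1 γ (Icc s t) :=
    ((h.contMDiffOn_integralCurve hY hv isOpen_Ioo hγ).mono hsub).of_le
      (WithTop.coe_le_coe.2 le_top)
  rw [IsRiemannianManifold.out (I := 𝓡 n) (γ s) (γ t)]
  refine (Manifold.riemannianEDist_le_pathELength hsm rfl rfl hst).trans ?_
  rw [Manifold.pathELength_eq_lintegral_mfderiv_Icc]
  have hbound : ∀ r ∈ Icc s t, ‖mfderiv 𝓘(ℝ, ℝ) (𝓡 n) γ r 1‖ₑ ≤ (C : ENNReal) := by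
    intro r hr
    have hd := (hγ r (hsub hr)).hasMFDerivAt (isOpen_Ioo.mem_nhds (hsub hr))
    rw [hd.mfderiv]
    have e : ((1 : ℝ →L[ℝ] ℝ).smulRight (v (γ r))) 1 = v (γ r) := by
      change (1 : ℝ) • v (γ r) = v (γ r)
      rw [one_smul]
    have e' : ‖v (γ r)‖ₑ ≤ (C : ENNReal) := by
      rw [← ofReal_norm, h.norm_vectorField hv, ← ENNReal.ofReal_coe_nnreal]
      exact ENNReal.ofReal_le_ofReal (hC _)
    exact e.symm ▸ e'
  calc _ ≤ ∫⁻ r in Icc s t, (C : ENNReal) :=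
        MeasureTheory.setLIntegral_mono measurable_const hbound
    _ = C * edist s t := by
        rw [MeasureTheory.setLIntegral_const, Real.volume_Icc, edist_comm, edist_dist,
          Real.dist_eq, abs_of_nonneg (sub_nonneg.2 hst)]

/-- An integral curve of a bounded vector field on a complete manifold extends beyond the end of
its interval of definition. -/
theorem exists_extend_integralCurve [IsRiemannianManifold (𝓡 n) M] [CompleteSpace M]
    {C : NNReal} (hC : ∀ x, ‖Y x‖ ≤ C) {γ : ℝ → M} {a b : ℝ} (hab : a < b)
    (hγ : IsMIntegralCurveOn γ v (Ioo a b)) :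
    ∃ δ > 0, ∃ γ' : ℝ → M, EqOn γ' γ (Ioo a b) ∧ IsMIntegralCurveOn γ' v (Ioo a (b + δ)) := by
  have hlip : LipschitzOnWith C γ (Ioo a b) := by
    intro s hs t ht
    rcases le_total s t with hst | hst
    · exact h.edist_integralCurve_le hY hv hC hγ hs ht hst
    · rw [edist_comm, edist_comm s]
      exact h.edist_integralCurve_le hY hv hC hγ ht hs hst
  -- A Lipschitz curve is Cauchy at its end. Its limit `z` is the starting point of the continuation
  -- `η`.
  have hcau : Cauchy (Filter.map γ (𝓝[Ioo a b] b)) := by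
    have : (𝓝[Ioo a b] b).NeBot := by
      rw [← mem_closure_iff_nhdsWithin_neBot, closure_Ioo hab.ne]
      exact right_mem_Icc.2 hab.le
    exact (cauchy_nhds.mono nhdsWithin_le_nhds).map_of_le hlip.uniformContinuousOn inf_le_right
  obtain ⟨z, hz⟩ := CompleteSpace.complete hcau
  have hvs := h.contMDiff_vectorField hY hv
  have : IsManifold (𝓡 n) 1 M := IsManifold.of_le (n := ∞) (WithTop.coe_le_coe.2 le_top)
  obtain ⟨η, hηb, hη⟩ := exists_isMIntegralCurveAt_of_contMDiffAt_boundaryless b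
    (hvs.contMDiffAt (x := z))
  obtain ⟨δ, hδ, hη⟩ := isMIntegralCurveAt_iff'.1 hη
  have hball : ball b δ = Ioo (b - δ) (b + δ) := Real.ball_eq_Ioo b δ
  rw [hball] at hη
  let γ' : ℝ → M := fun t ↦ if t < b then γ t else η t
  have hγ'lt : ∀ t, t < b → γ' t = γ t := fun t ht ↦ if_pos ht
  have hγ'ge : ∀ t, b ≤ t → γ' t = η t := fun t ht ↦ if_neg ht.not_gt
  have hγ'b : γ' b = z := by rw [hγ'ge b le_rfl, hηb]
  refine ⟨δ, hδ, γ', fun t ht ↦ hγ'lt t ht.2, fun t ht ↦ ?_⟩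
  rcases lt_trichotomy t b with htb | htb | htb
  · have htm : t ∈ Ioo a b := ⟨ht.1, htb⟩
    have h1 := (hγ t htm).hasMFDerivAt (isOpen_Ioo.mem_nhds htm)
    have h2 : γ' =ᶠ[𝓝 t] γ := by
      filter_upwards [Iio_mem_nhds htb] with r hr using hγ'lt r hr
    rw [← hγ'lt t htb] at h1
    exact (h1.congr_of_eventuallyEq h2).hasMFDerivWithinAt
  · rw [htb]
    have hmem : Ioo a b ∈ 𝓝[<] b := Ioo_mem_nhdsLT hab
    have hηc : ContinuousAt η b :=
      ((hη b ⟨by linarith, by linarith⟩).hasMFDerivAt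
        (isOpen_Ioo.mem_nhds ⟨by linarith, by linarith⟩)).continuousAt
    have hγz : Filter.Tendsto γ (𝓝[<] b) (𝓝 z) := by
      have : Filter.map γ (𝓝[<] b) ≤ 𝓝 z :=
        (Filter.map_mono (nhdsWithin_le_iff.2 hmem)).trans hz
      exact this
    have hcl : ContinuousWithinAt γ' (Iio b) b := by
      have : Filter.Tendsto γ' (𝓝[<] b) (𝓝 z) := by
        refine hγz.congr' ?_
        filter_upwards [self_mem_nhdsWithin] with r hr using (hγ'lt r hr).symm
      rw [ContinuousWithinAt, hγ'b]; exact this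
    have hcr : ContinuousWithinAt γ' (Ici b) b :=
      hηc.continuousWithinAt.congr (fun r hr ↦ hγ'ge r hr) (hγ'ge b le_rfl)
    have hc : ContinuousAt γ' b := by
      rw [continuousAt_iff_continuous_left'_right']
      exact ⟨hcl, hcr.mono Ioi_subset_Ici_self⟩
    have hdγ : ∀ r ∈ Ioo a b, HasDerivAt (f ∘ γ') (Y (γ r)) r := by
      intro r hr
      have h1 := h.hasDerivAt_comp ((hγ r hr).hasMFDerivAt (isOpen_Ioo.mem_nhds hr))
      rw [hv] at h1
      refine h1.congr_of_eventuallyEq ?_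
      filter_upwards [Iio_mem_nhds hr.2] with u hu
      simp only [Function.comp, hγ'lt u hu]
    -- At the junction both one-sided derivatives of `f ∘ γ'` equal `Y z`: on the left as a limit of
    -- the derivatives `Y (γ r)`, on the right from `η`.
    have hl : HasDerivWithinAt (f ∘ γ') (Y z) (Iic b) b := by
      refine hasDerivWithinAt_Iic_of_tendsto_deriv (s := Ioo a b)
        (fun r hr ↦ (hdγ r hr).differentiableAt.differentiableWithinAt) ?_ hmem ?_
      · exact ((h.contMDiff.continuous.continuousAt.comp hc).continuousWithinAt)
      · refine ((hY.continuous.tendsto z).comp hγz).congr' ?_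
        filter_upwards [hmem] with r hr using (hdγ r hr).deriv.symm
    have hr : HasDerivWithinAt (f ∘ γ') (Y z) (Ici b) b := by
      have h1 := h.hasDerivAt_comp ((hη b ⟨by linarith, by linarith⟩).hasMFDerivAt
        (isOpen_Ioo.mem_nhds ⟨by linarith, by linarith⟩))
      rw [hv, hηb] at h1
      exact h1.hasDerivWithinAt.congr (fun r hr ↦ congrArg f (hγ'ge r hr))
        (congrArg f (hγ'ge b le_rfl))
    have hd : HasDerivAt (f ∘ γ') (diffl f (γ' b) (v (γ' b))) b := by
      rw [hv, hγ'b, ← hasDerivWithinAt_univ, ← Iic_union_Ici (a := b)]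
      exact hl.union hr
    exact (h.hasMFDerivAt_of_comp hc hd).hasMFDerivWithinAt
  · have htm : t ∈ Ioo (b - δ) (b + δ) := ⟨by linarith, ht.2⟩
    have h1 := (hη t htm).hasMFDerivAt (isOpen_Ioo.mem_nhds htm)
    have h2 : γ' =ᶠ[𝓝 t] η := by
      filter_upwards [Ioi_mem_nhds htb] with r hr using hγ'ge r (le_of_lt hr)
    rw [← hγ'ge t htb.le] at h1
    exact (h1.congr_of_eventuallyEq h2).hasMFDerivWithinAt

-- Extend forwards, reverse time, extend the resulting integral curve of `-v` forwards, and reverse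
-- again.
omit hv hY in
theorem exists_extend_integralCurve_symm [IsRiemannianManifold (𝓡 n) M] [CompleteSpace M]
    {Y : M → EE (n + 2)} (hY : ContMDiff (𝓡 n) 𝓘(ℝ, EE (n + 2)) ∞ Y)
    {v : ∀ x : M, TangentSpace (𝓡 n) x} (hv : ∀ x, diffl f x (v x) = Y x)
    {C : NNReal} (hC : ∀ x, ‖Y x‖ ≤ C) {γ : ℝ → M} {a : ℝ} (ha : 0 < a)
    (hγ : IsMIntegralCurveOn γ v (Ioo (-a) a)) :
    ∃ δ > 0, ∃ γ' : ℝ → M, γ' 0 = γ 0 ∧ IsMIntegralCurveOn γ' v (Ioo (-(a + δ)) (a + δ)) := by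
  obtain ⟨δ₁, hδ₁, γ₁, hγ₁, h₁⟩ := h.exists_extend_integralCurve hY hv hC (by linarith) hγ
  have h₂ := h₁.comp_mul (-1)
  have hset : {t : ℝ | t * -1 ∈ Ioo (-a) (a + δ₁)} = Ioo (-(a + δ₁)) a := by
    ext t
    simp only [mem_Ioo, mem_ofPred]
    constructor <;> rintro ⟨h1, h2⟩ <;> constructor <;> linarith
  rw [hset] at h₂
  have hY' : ContMDiff (𝓡 n) 𝓘(ℝ, EE (n + 2)) ∞ (fun x ↦ -Y x) := hY.neg
  obtain ⟨δ₂, hδ₂, γ₂, hγ₂, h₃⟩ := h.exists_extend_integralCurve (Y := fun x ↦ -Y x)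
    (v := (-1 : ℝ) • v) hY' (fun x ↦ by
      change diffl f x ((-1 : ℝ) • v x) = _
      rw [map_smul, hv, neg_one_smul]) (fun x ↦ by rw [norm_neg]; exact hC x) (by linarith) h₂
  have h₄ := h₃.comp_mul (-1)
  rw [smul_smul, neg_one_mul, neg_neg, one_smul] at h₄
  refine ⟨min δ₁ δ₂, lt_min hδ₁ hδ₂, γ₂ ∘ (· * -1), ?_, h₄.mono fun t ht ↦ ?_⟩
  · simp only [Function.comp]
    rw [zero_mul, hγ₂ ⟨by linarith, ha⟩]
    simp only [Function.comp]
    rw [zero_mul, hγ₁ ⟨by linarith, ha⟩]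
  · simp only [mem_ofPred, mem_Ioo] at ht ⊢
    have := min_le_left δ₁ δ₂
    have := min_le_right δ₁ δ₂
    constructor <;> linarith [ht.1, ht.2]

/-- Bounded smooth vector fields on a complete manifold are complete. -/
theorem exists_integralCurve [IsRiemannianManifold (𝓡 n) M] [CompleteSpace M]
    {C : NNReal} (hC : ∀ x, ‖Y x‖ ≤ C) (x : M) : ∃ γ : ℝ → M, γ 0 = x ∧ IsMIntegralCurve γ v := by
  have hvs := h.contMDiff_vectorField hY hv
  have : IsManifold (𝓡 n) 1 M := IsManifold.of_le (n := ∞) (WithTop.coe_le_coe.2 le_top)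
  let s := {a | ∃ γ, γ 0 = x ∧ IsMIntegralCurveOn γ v (Ioo (-a) a)}
  suffices hbdd : ¬BddAbove s by
    rw [not_bddAbove_iff] at hbdd
    rw [exists_isMIntegralCurve_iff_exists_isMIntegralCurveOn_Ioo hvs]
    intro a
    obtain ⟨y, ⟨γ, hγ1, hγ2⟩, hlt⟩ := hbdd a
    exact ⟨γ, hγ1, hγ2.mono <| Ioo_subset_Ioo (neg_le_neg hlt.le) hlt.le⟩
  intro hbdd
  obtain ⟨η, hη0, hη⟩ := exists_isMIntegralCurveAt_of_contMDiffAt_boundaryless 0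
    (hvs.contMDiffAt (x := x))
  obtain ⟨ε, hε, hη⟩ := isMIntegralCurveAt_iff'.1 hη
  rw [Real.ball_eq_Ioo, zero_sub, zero_add] at hη
  have hεs : ε ∈ s := ⟨η, hη0, hη⟩
  set a := sSup s with ha
  have ha0 : 0 < a := lt_of_lt_of_le hε (le_csSup hbdd hεs)
  have hlt : ∀ b, ∃ γ : ℝ → M, b < a → γ 0 = x ∧ IsMIntegralCurveOn γ v (Ioo (-b) b) := by
    intro b
    by_cases hb : b < a
    swap
    · exact ⟨fun _ ↦ x, fun h ↦ absurd h hb⟩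
    obtain ⟨c, ⟨γ, hγ1, hγ2⟩, hbc⟩ := exists_lt_of_lt_csSup ⟨ε, hεs⟩ hb
    exact ⟨γ, fun _ ↦ ⟨hγ1, hγ2.mono <| Ioo_subset_Ioo (neg_le_neg hbc.le) hbc.le⟩⟩
  choose γ hγ using hlt
  have heq : ∀ b c t, b < a → c < a → |t| < b → |t| < c → γ b t = γ c t := by
    intro b c t hb hc htb htc
    set d := min b c with hd
    have hd' : |t| < d := lt_min htb htc
    have hd0 : 0 < d := (abs_nonneg t).trans_lt hd'
    refine isMIntegralCurveOn_Ioo_eqOn_of_contMDiff_boundaryless (t₀ := 0) (a := -d) (b := d)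
      ⟨by linarith, hd0⟩ hvs ((hγ b hb).2.mono ?_) ((hγ c hc).2.mono ?_)
      ((hγ b hb).1.trans (hγ c hc).1.symm) (abs_lt.1 hd')
    · exact Ioo_subset_Ioo (neg_le_neg (min_le_left _ _)) (min_le_left _ _)
    · exact Ioo_subset_Ioo (neg_le_neg (min_le_right _ _)) (min_le_right _ _)
  -- Any index strictly between `|t|` and `a` would serve, by uniqueness of integral curves. The
  -- glued curve lives on the extremal interval, so extending it contradicts the choice of `a` as a
  -- supremum.
  let γ₀ : ℝ → M := fun t ↦ γ ((|t| + a) / 2) t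
  have hγ₀ : IsMIntegralCurveOn γ₀ v (Ioo (-a) a) := by
    intro t ht
    have hta : |t| < a := abs_lt.2 ht
    set c := (|t| + a) / 2 with hc
    have hca : c < a := by linarith
    have htc : |t| < c := by linarith
    have htm : t ∈ Ioo (-c) c := abs_lt.1 htc
    have h1 := ((hγ c hca).2 t htm).hasMFDerivAt (isOpen_Ioo.mem_nhds htm)
    have h2 : γ₀ =ᶠ[𝓝 t] γ c := by
      filter_upwards [isOpen_Ioo.mem_nhds htm] with r hr
      have hr' : |r| < c := abs_lt.2 hr
      exact heq _ _ r (by linarith) hca (by linarith [hr'.trans hca]) hr'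
    exact (h1.congr_of_eventuallyEq h2).hasMFDerivWithinAt
  obtain ⟨δ, hδ, γ', hγ'0, hγ'⟩ := h.exists_extend_integralCurve_symm hY hv hC ha0 hγ₀
  have hmem : a + δ ∈ s := by
    refine ⟨γ', hγ'0.trans (hγ _ ?_).1, hγ'⟩
    rw [abs_zero]; linarith
  linarith [le_csSup hbdd hmem]

end IsOrientedHypersurface
end Completeness

/-! ### Linear algebra of an operator with two eigenvalues -/

section Algebra

/-- A symmetric endomorphism with two eigenvalues, the second one being simple. -/
theorem exists_unit_eigenvector {T : Type*} [NormedAddCommGroup T] [InnerProductSpace ℝ T]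
    [FiniteDimensional ℝ T] {A : Module.End ℝ T} (hA : ∀ u v, inner ℝ (A u) v = inner ℝ u (A v))
    {l m : ℝ} (hlm : l ≠ m)
    (hl : Module.finrank ℝ (Module.End.eigenspace A l) = Module.finrank ℝ T - 1)
    (hm : Module.finrank ℝ (Module.End.eigenspace A m) = 1) :
    ∃ e : T, inner ℝ e e = (1 : ℝ) ∧ ∀ v, A v = l • v + ((m - l) * inner ℝ e v) • e := by
  obtain ⟨e₀, he₀, hne⟩ := Submodule.exists_mem_ne_zero_of_ne_bot
    (p := Module.End.eigenspace A m) fun h0 ↦ by rw [h0, finrank_bot] at hm; exact zero_ne_one hm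
  set e := ‖e₀‖⁻¹ • e₀ with he
  have hn : ‖e₀‖ ≠ 0 := norm_ne_zero_iff.2 hne
  have hee : inner ℝ e e = (1 : ℝ) := by
    rw [he, real_inner_smul_left, real_inner_smul_right, real_inner_self_eq_norm_sq]
    field_simp
  have hAe : A e = m • e := by
    rw [he, map_smul, Module.End.mem_eigenspace_iff.1 he₀, smul_comm]
  have hle : Module.End.eigenspace A l ≤ (Submodule.span ℝ {e})ᗮ := by
    intro a ha
    rw [Submodule.mem_orthogonal_singleton_iff_inner_right]
    have h1 := hA e a
    rw [hAe, Module.End.mem_eigenspace_iff.1 ha, real_inner_smul_left, real_inner_smul_right] at h1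
    have h2 : (l - m) * inner ℝ e a = 0 := by linarith
    exact (mul_eq_zero.1 h2).resolve_left (sub_ne_zero.2 hlm)
  have hfr : Module.finrank ℝ (Submodule.span ℝ {e})ᗮ = Module.finrank ℝ T - 1 := by
    have h1 := Submodule.finrank_add_finrank_orthogonal (Submodule.span ℝ {e})
    rw [finrank_span_singleton (fun h0 ↦ by simp [h0] at hee)] at h1
    omega
  have heq := Submodule.eq_of_le_of_finrank_eq hle (hl.trans hfr.symm)
  refine ⟨e, hee, fun v ↦ ?_⟩
  have hw : v - inner ℝ e v • e ∈ Module.End.eigenspace A l := by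
    rw [heq, Submodule.mem_orthogonal_singleton_iff_inner_right, inner_sub_right,
      real_inner_smul_right, hee]
    ring
  have h1 := Module.End.mem_eigenspace_iff.1 hw
  rw [map_sub, map_smul, hAe, sub_eq_iff_eq_add] at h1
  rw [h1]
  module

theorem esymm_cons (a : ℝ) (s : Multiset ℝ) (k : ℕ) :
    (a ::ₘ s).esymm (k + 1) = s.esymm (k + 1) + a * s.esymm k := by
  simp only [Multiset.esymm, Multiset.powersetCard_cons, Multiset.map_add, Multiset.sum_add,
    Multiset.map_map, Function.comp_def, Multiset.prod_cons, Multiset.sum_map_mul_left]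

theorem esymm_replicate (a : ℝ) (N k : ℕ) :
    (Multiset.replicate N a).esymm k = N.choose k * a ^ k := by
  induction N generalizing k with
  | zero =>
    cases k with
    | zero => simp [Multiset.esymm]
    | succ k => simp [Multiset.esymm, Multiset.powersetCard_zero_right]
  | succ N ih =>
    cases k with
    | zero => simp [Multiset.esymm]
    | succ k =>
      rw [Multiset.replicate_succ, esymm_cons, ih, ih, Nat.choose_succ_succ]
      push_cast; ring

/-- Eigenspace dimensions bound the root multiplicities from below, and here they already add up to
the degree. -/
theorem charpoly_roots_eq {T : Type*} [AddCommGroup T] [Module ℝ T] [FiniteDimensional ℝ T]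
    (A : Module.End ℝ T) {N : ℕ} (hT : Module.finrank ℝ T = N + 1) {l m : ℝ} (hlm : l ≠ m)
    (hl : Module.finrank ℝ (Module.End.eigenspace A l) = N)
    (hm : Module.finrank ℝ (Module.End.eigenspace A m) = 1) :
    A.charpoly.roots = m ::ₘ Multiset.replicate N l := by
  symm
  apply Multiset.eq_of_le_of_card_le
  · rw [Multiset.le_iff_count]
    intro a
    rw [Polynomial.count_roots]
    have h1 := LinearMap.finrank_genEigenspace_le A a 1
    rw [Multiset.count_cons, Multiset.count_replicate]
    by_cases ha : a = l
    · subst ha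
      rw [if_pos rfl, if_neg hlm]
      exact (hl ▸ h1 : _)
    · by_cases hb : a = m
      · subst hb
        rw [if_neg hlm, if_pos rfl]
        exact (hm ▸ h1 : _)
      · rw [if_neg (fun h ↦ ha h.symm), if_neg hb]
        exact Nat.zero_le _
  · refine (Polynomial.card_roots' _).trans ?_
    rw [LinearMap.charpoly_natDegree, hT]
    simp

end Algebra

/-! ### Derivatives in charts -/

section Chart

variable {n : ℕ} {M : Type*} [EMetricSpace M] [ChartedSpace (EE n) M] [IsManifold (𝓡 n) ∞ M]

/-- The derivatives of functions in an extended chart. -/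
theorem exists_equiv_fderiv_comp_extChartAt_symm {x₀ : M} {y : EE n}
    (hy : y ∈ (extChartAt (𝓡 n) x₀).target) :
    ∃ D : EE n ≃ₗ[ℝ] TangentSpace (𝓡 n) ((extChartAt (𝓡 n) x₀).symm y),
      (∀ (k : ℕ) (g : M → EE k),
        MDifferentiableAt (𝓡 n) 𝓘(ℝ, EE k) g ((extChartAt (𝓡 n) x₀).symm y) →
        ∀ w, fderiv ℝ (g ∘ (extChartAt (𝓡 n) x₀).symm) y w
          = diffl g ((extChartAt (𝓡 n) x₀).symm y) (D w)) ∧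
      (∀ g : M → ℝ,
        MDifferentiableAt (𝓡 n) 𝓘(ℝ, ℝ) g ((extChartAt (𝓡 n) x₀).symm y) →
        ∀ w, fderiv ℝ (g ∘ (extChartAt (𝓡 n) x₀).symm) y w
          = mfderiv (𝓡 n) 𝓘(ℝ, ℝ) g ((extChartAt (𝓡 n) x₀).symm y) (D w)) := by
  have : IsManifold (𝓡 n) 1 M := IsManifold.of_le (n := ∞) (WithTop.coe_le_coe.2 le_top)
  obtain ⟨D, hD⟩ := isInvertible_mfderivWithin_extChartAt_symm hy
  have hd : MDifferentiableAt 𝓘(ℝ, EE n) (𝓡 n) (extChartAt (𝓡 n) x₀).symm y := by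
    have := mdifferentiableWithinAt_extChartAt_symm hy
    rwa [(𝓡 n).range_eq_univ, mdifferentiableWithinAt_univ] at this
  have hDe : mfderiv 𝓘(ℝ, EE n) (𝓡 n) (extChartAt (𝓡 n) x₀).symm y = D := by
    rw [hD, (𝓡 n).range_eq_univ, mfderivWithin_univ]
  refine ⟨D.toLinearEquiv, fun k g hg w ↦ ?_, fun g hg w ↦ ?_⟩ <;>
  · rw [← mfderiv_eq_fderiv, mfderiv_comp y hg hd, hDe]
    rfl

theorem contDiffOn_chart {k : ℕ} {g : M → EE k} (hg : ContMDiff (𝓡 n) 𝓘(ℝ, EE k) ∞ g) (x₀ : M) :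
    ContDiffOn ℝ ∞ (g ∘ (extChartAt (𝓡 n) x₀).symm) (extChartAt (𝓡 n) x₀).target := by
  rw [← contMDiffOn_iff_contDiffOn]
  exact hg.comp_contMDiffOn (contMDiffOn_extChartAt_symm x₀)

end Chart

/-! ### The shape operator and the mean curvature -/

section Structure

variable {n : ℕ} {M : Type*} [EMetricSpace M] [ChartedSpace (EE n) M] [IsManifold (𝓡 n) ∞ M]
  [Bundle.RiemannianBundle (fun x : M ↦ TangentSpace (𝓡 n) x)]
  {f N : M → EE (n + 2)}

omit [IsManifold (𝓡 n) ∞ M] [Bundle.RiemannianBundle (fun x : M ↦ TangentSpace (𝓡 n) x)] in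
theorem finrank_tangentSpace (x : M) : Module.finrank ℝ (TangentSpace (𝓡 n) x) = n :=
  finrank_euclideanSpace_fin (𝕜 := ℝ)

namespace IsOrientedHypersurface

variable (h : IsOrientedHypersurface f N)
include h

omit [IsManifold (𝓡 n) ∞ M] in
theorem diffl_normal (x : M) (v : TangentSpace (𝓡 n) x) :
    diffl N x v = -diffl f x (shapeOperator f N x v) := by
  rw [h.diffl_shapeOperator, neg_neg]

/-- Differentiating `⟨N, df b⟩ = 0` in a chart gives `⟨A a, b⟩ = ⟨N, D²f (a, b)⟩`, which is
symmetric. -/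
theorem shapeOperator_symmetric (x : M) (u v : TangentSpace (𝓡 n) x) :
    inner ℝ (shapeOperator f N x u) v = inner ℝ u (shapeOperator f N x v) := by
  obtain ⟨x₀, y, hy, rfl⟩ : ∃ (x₀ : M) (y : EE n), y ∈ (extChartAt (𝓡 n) x₀).target ∧
      (extChartAt (𝓡 n) x₀).symm y = x :=
    ⟨x, extChartAt (𝓡 n) x x, mem_extChartAt_target x, extChartAt_to_inv x⟩
  set U := (extChartAt (𝓡 n) x₀).target with hU
  have hUo : IsOpen U := isOpen_extChartAt_target x₀
  have hF := (contDiffOn_chart h.contMDiff x₀).contDiffAt (hUo.mem_nhds hy)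
  have hG := (contDiffOn_chart h.contMDiff_normal x₀).contDiffAt (hUo.mem_nhds hy)
  set F := f ∘ (extChartAt (𝓡 n) x₀).symm with hFdef
  set G := N ∘ (extChartAt (𝓡 n) x₀).symm with hGdef
  obtain ⟨D, hD, -⟩ := exists_equiv_fderiv_comp_extChartAt_symm hy
  have hDf := hD _ f (h.mdifferentiableAt _)
  have hDN := hD _ N (h.mdifferentiableAt_normal _)
  obtain ⟨a, rfl⟩ := D.surjective u
  obtain ⟨b, rfl⟩ := D.surjective v
  have key : ∀ a b : EE n, inner ℝ (G y) (fderiv ℝ (fderiv ℝ F) y a b)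
      + inner ℝ (fderiv ℝ G y a) (fderiv ℝ F y b) = 0 := by
    intro a b
    have h1 := (hasDerivAt_comp_line (hG.differentiableAt (by simp)) a).inner ℝ
      (hasDerivAt_fderiv_comp_line hF a b)
    have h2 : HasDerivAt (fun _ : ℝ ↦ (0 : ℝ)) 0 0 := hasDerivAt_const _ _
    have h3 := h1.unique (h2.congr_of_eventuallyEq
      ((eventually_line_mem hUo hy a).mono fun t ht ↦ by
        obtain ⟨D', hD', -⟩ := exists_equiv_fderiv_comp_extChartAt_symm ht
        change inner ℝ (N ((extChartAt (𝓡 n) x₀).symm (y + t • a)))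
          (fderiv ℝ (f ∘ (extChartAt (𝓡 n) x₀).symm) (y + t • a) b) = 0
        rw [hD' _ f (h.mdifferentiableAt _)]
        exact h.normal_orthogonal _ _))
    simpa using h3
  have h1 := key a b
  have h2 := key b a
  rw [fderiv_fderiv_symm hF] at h1
  have h3 : inner ℝ (fderiv ℝ G y a) (fderiv ℝ F y b)
      = inner ℝ (fderiv ℝ G y b) (fderiv ℝ F y a) := by linarith
  rw [hDf, hDf, hDN, hDN, h.diffl_normal, h.diffl_normal, inner_neg_left, inner_neg_left,
    neg_inj, h.isometric, h.isometric] at h3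
  rw [h3, real_inner_comm]

theorem exists_principal_direction {lam mu : M → ℝ}
    (hlm : HasTwoPrincipalCurvatures f N lam mu) (x : M) :
    ∃ e : TangentSpace (𝓡 n) x, inner ℝ e e = (1 : ℝ) ∧
      ∀ v, shapeOperator f N x v = lam x • v + ((mu x - lam x) * inner ℝ e v) • e := by
  refine exists_unit_eigenvector (T := TangentSpace (𝓡 n) x) (h.shapeOperator_symmetric x)
    (hlm.distinct x) ?_ (hlm.simple x)
  rw [finrank_tangentSpace]
  exact hlm.multiplicity x

end IsOrientedHypersurface

omit [IsManifold (𝓡 n) ∞ M] [Bundle.RiemannianBundle (fun x : M ↦ TangentSpace (𝓡 n) x)] in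
/-- The `m`-th mean curvature of a hypersurface with two principal curvatures, one of which is
simple. -/
theorem HasTwoPrincipalCurvatures.meanCurvature_eq {lam mu : M → ℝ}
    (hlm : HasTwoPrincipalCurvatures f N lam mu) {m : ℕ} (hm : 1 ≤ m) (hmn : m ≤ n) (x : M) :
    n * meanCurvature f N m x = (n - m) * lam x ^ m + m * lam x ^ (m - 1) * mu x := by
  obtain ⟨k, rfl⟩ : ∃ k, m = k + 1 := ⟨m - 1, by omega⟩
  obtain ⟨N', rfl⟩ : ∃ N', n = N' + 1 := ⟨n - 1, by omega⟩
  have hr : principalCurvatures f N x = mu x ::ₘ Multiset.replicate N' (lam x) :=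
    charpoly_roots_eq (T := TangentSpace (𝓡 (N' + 1)) x) _ (finrank_tangentSpace x)
      (hlm.distinct x) (hlm.multiplicity x) (hlm.simple x)
  rw [meanCurvature, hr, esymm_cons, esymm_replicate, esymm_replicate, Nat.add_sub_cancel]
  have hc : ((N' + 1).choose (k + 1) : ℝ) ≠ 0 := by
    exact_mod_cast (Nat.choose_pos hmn).ne'
  have h1 : ((N' + 1 : ℕ) : ℝ) * (N'.choose k : ℝ) = (N' + 1).choose (k + 1) * ((k + 1 : ℕ) : ℝ) := by
    exact_mod_cast Nat.add_one_mul_choose_eq N' k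
  have h2 : ((N' + 1).choose (k + 1) : ℝ) = N'.choose k + N'.choose (k + 1) := by
    exact_mod_cast Nat.choose_succ_succ N' k
  rw [mul_div_assoc', div_eq_iff hc]
  have h3 : ((N' + 1 : ℕ) : ℝ) * (N'.choose (k + 1) : ℝ)
      = (N' + 1).choose (k + 1) * (((N' + 1 : ℕ) : ℝ) - ((k + 1 : ℕ) : ℝ)) := by
    rw [mul_sub, ← h1, h2]; ring
  linear_combination lam x ^ (k + 1) * h3 + mu x * lam x ^ k * h1

end Structure

/-! ### The profile plane on the manifold -/

section ProfilePlane

variable {n : ℕ} {M : Type*} [EMetricSpace M] [ChartedSpace (EE n) M]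

/-- The plane spanned by `N + lam f` and its derivatives. -/
def profilePlane (f N : M → EE (n + 2)) (lam : M → ℝ) (x : M) : Submodule ℝ (EE (n + 2)) :=
  Submodule.span ℝ {N x + lam x • f x} ⊔
    LinearMap.range (diffl (n := n) (fun y ↦ N y + lam y • f y) x)

variable [IsManifold (𝓡 n) ∞ M] [Bundle.RiemannianBundle (fun x : M ↦ TangentSpace (𝓡 n) x)]
  {f N : M → EE (n + 2)} {lam mu : M → ℝ}

theorem IsOrientedHypersurface.localHypersurface (h : IsOrientedHypersurface f N)
    (hlm : HasTwoPrincipalCurvatures f N lam mu) (x₀ : M) :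
    LocalHypersurface (f ∘ (extChartAt (𝓡 n) x₀).symm) (N ∘ (extChartAt (𝓡 n) x₀).symm)
      (lam ∘ (extChartAt (𝓡 n) x₀).symm) (mu ∘ (extChartAt (𝓡 n) x₀).symm)
      (extChartAt (𝓡 n) x₀).target where
  isOpen := isOpen_extChartAt_target x₀
  smooth_F := contDiffOn_chart h.contMDiff x₀
  smooth_G := contDiffOn_chart h.contMDiff_normal x₀
  norm_F y _ := h.inner_self _
  norm_G y _ := h.inner_normal_self _
  inner_G_F y _ := h.normal_tangent_sphere _
  inner_G_deriv y hy v := by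
    obtain ⟨D, hD, -⟩ := exists_equiv_fderiv_comp_extChartAt_symm hy
    rw [hD _ f (h.mdifferentiableAt _)]
    exact h.normal_orthogonal _ _
  injective y hy := by
    obtain ⟨D, hD, -⟩ := exists_equiv_fderiv_comp_extChartAt_symm hy
    intro a b hab
    rw [hD _ f (h.mdifferentiableAt _), hD _ f (h.mdifferentiableAt _)] at hab
    exact D.injective (h.diffl_injective _ hab)
  ne y _ := hlm.distinct _
  weingarten y hy := by
    obtain ⟨D, hD, -⟩ := exists_equiv_fderiv_comp_extChartAt_symm hy
    have hDf := hD _ f (h.mdifferentiableAt _)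
    have hDN := hD _ N (h.mdifferentiableAt_normal _)
    obtain ⟨e, he, hA⟩ := h.exists_principal_direction hlm ((extChartAt (𝓡 n) x₀).symm y)
    refine ⟨D.symm e, ?_, fun v ↦ ?_⟩
    · rw [hDf, D.apply_symm_apply, h.isometric, he]
    · rw [hDN, hDf, hDf, D.apply_symm_apply, h.isometric, h.diffl_normal, hA, map_add, map_smul,
        map_smul]
      simp only [Function.comp_apply]
      module

variable [Fact (3 ≤ n)] {m : ℕ} {H : ℝ}

theorem IsOrientedHypersurface.contMDiff_curvatures (h : IsOrientedHypersurface f N)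
    (hlm : HasTwoPrincipalCurvatures f N lam mu) :
    ContMDiff (𝓡 n) 𝓘(ℝ, ℝ) ∞ lam ∧ ContMDiff (𝓡 n) 𝓘(ℝ, ℝ) ∞ mu := by
  have hX : 3 ≤ Module.finrank ℝ (EE n) := by
    rw [finrank_euclideanSpace_fin]; exact Fact.out
  have key : ∀ (g : M → ℝ) (x₀ : M), ContDiffAt ℝ ∞ (g ∘ (extChartAt (𝓡 n) x₀).symm)
      (extChartAt (𝓡 n) x₀ x₀) → ContMDiffAt (𝓡 n) 𝓘(ℝ, ℝ) ∞ g x₀ := by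
    intro g x₀ hg
    have h1 := hg.contMDiffAt.comp x₀ (contMDiffAt_extChartAt (I := 𝓡 n) (n := ∞) (x := x₀))
    refine h1.congr_of_eventuallyEq ?_
    filter_upwards [(isOpen_extChartAt_source (I := 𝓡 n) x₀).mem_nhds (mem_extChartAt_source x₀)]
      with x hx
    simp only [Function.comp_apply]
    rw [(extChartAt (𝓡 n) x₀).left_inv hx]
  have hc := fun x₀ ↦ (h.localHypersurface hlm x₀).contDiffAt_curvatures hX
    (mem_extChartAt_target x₀)
  exact ⟨fun x₀ ↦ key lam x₀ (hc x₀).1, fun x₀ ↦ key mu x₀ (hc x₀).2⟩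

/-- Constancy of the mean curvature can be solved for `mu` as a function of `lam`, since the
coefficient `m lam^(m-1)` is nonzero by positivity of `lam`. -/
theorem IsOrientedHypersurface.exists_localPrincipalFrame (h : IsOrientedHypersurface f N)
    (hlm : HasTwoPrincipalCurvatures f N lam mu) (hm : 1 ≤ m) (hmn : m ≤ n)
    (hH : ∀ x, meanCurvature f N m x = H) (hpos : ∀ x, 0 < lam x) (x₀ : M) :
    ∃ Z v₀ W, extChartAt (𝓡 n) x₀ x₀ ∈ W ∧ W ⊆ (extChartAt (𝓡 n) x₀).target ∧
      LocalPrincipalFrame (f ∘ (extChartAt (𝓡 n) x₀).symm) (N ∘ (extChartAt (𝓡 n) x₀).symm) Z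
        (lam ∘ (extChartAt (𝓡 n) x₀).symm) (mu ∘ (extChartAt (𝓡 n) x₀).symm) v₀ W := by
  have hX : 3 ≤ Module.finrank ℝ (EE n) := by
    rw [finrank_euclideanSpace_fin]; exact Fact.out
  have hm0 : (m : ℝ) ≠ 0 := by exact_mod_cast (by omega : m ≠ 0)
  refine (h.localHypersurface hlm x₀).exists_frame hX (mem_extChartAt_target x₀)
    (φ := fun t ↦ (n * H - (n - m) * t ^ m) / (m * t ^ (m - 1))) (fun y _ ↦ ?_) (fun y _ ↦ ?_)
  · have := (hpos ((extChartAt (𝓡 n) x₀).symm y)).ne'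
    refine DifferentiableAt.div (by fun_prop) (by fun_prop) ?_
    exact mul_ne_zero hm0 (pow_ne_zero _ this)
  · have := (hpos ((extChartAt (𝓡 n) x₀).symm y)).ne'
    have h1 := hlm.meanCurvature_eq hm hmn ((extChartAt (𝓡 n) x₀).symm y)
    rw [hH] at h1
    simp only [Function.comp_apply]
    rw [h1, eq_div_iff (mul_ne_zero hm0 (pow_ne_zero _ this))]
    ring

omit [Fact (3 ≤ n)] in
theorem profilePlane_eq_plane (h : IsOrientedHypersurface f N)
    (hl : ContMDiff (𝓡 n) 𝓘(ℝ, ℝ) ∞ lam) {x₀ : M} {y : EE n}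
    (hy : y ∈ (extChartAt (𝓡 n) x₀).target) :
    profilePlane f N lam ((extChartAt (𝓡 n) x₀).symm y) =
      LocalPrincipalFrame.plane (f ∘ (extChartAt (𝓡 n) x₀).symm)
        (N ∘ (extChartAt (𝓡 n) x₀).symm) (lam ∘ (extChartAt (𝓡 n) x₀).symm) y := by
  obtain ⟨D, hD, -⟩ := exists_equiv_fderiv_comp_extChartAt_symm hy
  have hξ : ContMDiff (𝓡 n) 𝓘(ℝ, EE (n + 2)) ∞ (fun y ↦ N y + lam y • f y) :=
    h.contMDiff_normal.add (hl.smul h.contMDiff)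
  have hDξ := hD _ _ (hξ.contMDiffAt.mdifferentiableAt (by simp))
  rw [profilePlane, LocalPrincipalFrame.plane]
  congr 1
  ext z
  constructor
  · rintro ⟨v, rfl⟩
    obtain ⟨w, rfl⟩ := D.surjective v
    exact ⟨w, hDξ w⟩
  · rintro ⟨w, rfl⟩
    exact ⟨D w, (hDξ w).symm⟩

/-- The coordinate results in invariant form. The pair `(e, κ)` is determined up to a simultaneous
change of sign; at this stage the sign is chosen point by point. -/
theorem exists_principal_data (h : IsOrientedHypersurface f N)
    (hlm : HasTwoPrincipalCurvatures f N lam mu) (hm : 1 ≤ m) (hmn : m ≤ n)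
    (hH : ∀ x, meanCurvature f N m x = H) (hpos : ∀ x, 0 < lam x) (x : M) :
    (∃ (e : TangentSpace (𝓡 n) x) (κ : ℝ), inner ℝ e e = (1 : ℝ) ∧
      (∀ v, shapeOperator f N x v = lam x • v + ((mu x - lam x) * inner ℝ e v) • e) ∧
      (∀ v, mfderiv (𝓡 n) 𝓘(ℝ, ℝ) lam x v = (lam x - mu x) * κ * inner ℝ e v) ∧
      profilePlane f N lam x =
        Submodule.span ℝ {N x + lam x • f x, diffl f x e + κ • f x}) ∧
    Module.finrank ℝ (profilePlane f N lam x) = 2 ∧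
    ∀ᶠ y in nhds x, profilePlane f N lam y = profilePlane f N lam x := by
  have hX : 3 ≤ Module.finrank ℝ (EE n) := by
    rw [finrank_euclideanSpace_fin]; exact Fact.out
  have hV : Module.finrank ℝ (EE (n + 2)) = Module.finrank ℝ (EE n) + 2 := by
    rw [finrank_euclideanSpace_fin, finrank_euclideanSpace_fin]
  have hl := (h.contMDiff_curvatures hlm).1
  obtain ⟨Z, v₀, W, hxW, hW, hfr⟩ := h.exists_localPrincipalFrame hlm hm hmn hH hpos x
  set y := extChartAt (𝓡 n) x x with hy
  have hyt : y ∈ (extChartAt (𝓡 n) x).target := hW hxW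
  have hyx : (extChartAt (𝓡 n) x).symm y = x := extChartAt_to_inv x
  have hpl := profilePlane_eq_plane h hl hyt
  refine ⟨?_, ?_, ?_⟩
  · obtain ⟨D, hD, hD'⟩ := exists_equiv_fderiv_comp_extChartAt_symm hyt
    have hDf := hD _ f (h.mdifferentiableAt _)
    have hDN := hD _ N (h.mdifferentiableAt_normal _)
    have hDl := hD' lam (hl.contMDiffAt.mdifferentiableAt (by simp))
    rw [← hyx]
    obtain ⟨a, ha⟩ := hfr.exists_dir y hxW
    rw [hDf] at ha
    refine ⟨D a, LocalPrincipalFrame.kappa (f ∘ (extChartAt (𝓡 n) x).symm) Z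
      (lam ∘ (extChartAt (𝓡 n) x).symm) (mu ∘ (extChartAt (𝓡 n) x).symm) v₀ y,
      ?_, fun v ↦ ?_, fun v ↦ ?_, ?_⟩
    · rw [← h.isometric, ha, hfr.norm_Z y hxW]
    · apply h.diffl_injective
      obtain ⟨v, rfl⟩ := D.surjective v
      have h1 := hfr.weingarten y hxW v
      rw [hDN, hDf, h.diffl_normal, ← ha, h.isometric] at h1
      rw [map_add, map_smul, map_smul, ← neg_inj, h1]
      simp only [Function.comp_apply]
      module
    · obtain ⟨v, rfl⟩ := D.surjective v
      have h1 := hfr.deriv_lam hX hxW v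
      rw [hDl, hDf, ← ha, h.isometric] at h1
      exact h1
    · rw [hpl, hfr.plane_eq_span hX hxW, ha]
      rfl
  · rw [← hyx, hpl, hfr.finrank_plane hX hxW]
  · have h1 := hfr.eventually_plane_eq hX hV hxW
    have hc : ContinuousAt (extChartAt (𝓡 n) x) x := continuousAt_extChartAt x
    filter_upwards [hc.eventually h1,
      (isOpen_extChartAt_source (I := 𝓡 n) x).mem_nhds (mem_extChartAt_source x)] with z hz hzs
    rw [hyx] at hpl
    have h2 := profilePlane_eq_plane h hl ((extChartAt (𝓡 n) x).map_source hzs)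
    rw [(extChartAt (𝓡 n) x).left_inv hzs] at h2
    rw [h2, hpl, hz]

theorem profilePlane_eq [ConnectedSpace M] (h : IsOrientedHypersurface f N)
    (hlm : HasTwoPrincipalCurvatures f N lam mu) (hm : 1 ≤ m) (hmn : m ≤ n)
    (hH : ∀ x, meanCurvature f N m x = H) (hpos : ∀ x, 0 < lam x) (x y : M) :
    profilePlane f N lam x = profilePlane f N lam y := by
  have : IsLocallyConstant (profilePlane f N lam) :=
    (IsLocallyConstant.iff_eventually_eq _).2 fun x ↦
      (exists_principal_data h hlm hm hmn hH hpos x).2.2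
  exact this.apply_eq_of_preconnectedSpace x y

end ProfilePlane

/-! ### Splitting the ambient space along the profile plane -/

section Splitting

/-- The rotation of the plane by a quarter turn. -/
def rot (y : EE 2) : EE 2 := !₂[-y 1, y 0]

theorem inner_two (y z : EE 2) : inner ℝ y z = y 0 * z 0 + y 1 * z 1 := by
  simp [PiLp.inner_apply, Fin.sum_univ_two, mul_comm]

theorem inner_rot_self (y : EE 2) : inner ℝ (rot y) y = (0 : ℝ) := by
  rw [inner_two]; simp [rot]; ring

theorem inner_rot_rot (y z : EE 2) : inner ℝ (rot y) (rot z) = inner ℝ y z := by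
  rw [inner_two, inner_two]; simp [rot]; ring

theorem rot_rot (y : EE 2) : rot (rot y) = -y := by
  ext i; fin_cases i <;> simp [rot]

/-- The quarter turn as a continuous linear map. -/
def rotL : EE 2 →L[ℝ] EE 2 := LinearMap.toContinuousLinearMap
  { toFun := rot
    map_add' := fun x y ↦ by ext i; fin_cases i <;> simp [rot]; ring
    map_smul' := fun c x ↦ by ext i; fin_cases i <;> simp [rot] }

theorem rotL_apply (y : EE 2) : rotL y = rot y := rfl

/-- In the plane, a vector orthogonal to `y` is determined up to sign by its length. -/
theorem eq_or_eq_neg_smul_rot {y z : EE 2} {r : ℝ} (hy : y ≠ 0) (h : inner ℝ z y = (0 : ℝ))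
    (hz : inner ℝ z z = r ^ 2 * inner ℝ y y) : z = r • rot y ∨ z = -(r • rot y) := by
  have hyy : inner ℝ y y ≠ (0 : ℝ) := fun h0 ↦ hy (inner_self_eq_zero.1 h0)
  set t := inner ℝ z (rot y) / inner ℝ y y with ht
  have hz' : z = t • rot y := by
    have e1 : inner ℝ y y • z = inner ℝ z (rot y) • rot y := by
      rw [inner_two] at h
      ext i
      fin_cases i
      · simp only [inner_two, rot, Fin.zero_eta, Fin.isValue, PiLp.smul_apply, smul_eq_mul,
          Matrix.cons_val_zero, Matrix.cons_val_one]
        linear_combination y 0 * h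
      · simp only [inner_two, rot, Fin.mk_one, Fin.isValue, PiLp.smul_apply, smul_eq_mul,
          Matrix.cons_val_zero, Matrix.cons_val_one]
        linear_combination y 1 * h
    rw [ht, div_eq_inv_mul, mul_smul, ← e1, smul_smul, inv_mul_cancel₀ hyy, one_smul]
  rw [hz', real_inner_smul_left, real_inner_smul_right, inner_rot_rot, ← mul_assoc] at hz
  have h2 := mul_right_cancel₀ hyy hz
  rcases mul_self_eq_mul_self_iff.1 (h2.trans (sq r)) with h3 | h3
  · left; rw [hz', h3]
  · right; rw [hz', h3, neg_smul]

theorem exists_splitting {n : ℕ} (P : Submodule ℝ (EE (n + 2))) (hP : Module.finrank ℝ P = 2) :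
    ∃ A : WithLp 2 (EE n × EE 2) ≃ₗᵢ[ℝ] EE (n + 2),
      (∀ z ∈ P, (A.symm z).fst = 0) ∧ (∀ z ∈ Pᗮ, (A.symm z).snd = 0) := by
  have hPo : Module.finrank ℝ Pᗮ = n := by
    have h1 := Submodule.finrank_add_finrank_orthogonal P
    rw [hP, finrank_euclideanSpace_fin] at h1
    omega
  let a : Pᗮ ≃ₗᵢ[ℝ] EE n := ((stdOrthonormalBasis ℝ Pᗮ).reindex (finCongr hPo)).repr
  let b : P ≃ₗᵢ[ℝ] EE 2 := ((stdOrthonormalBasis ℝ P).reindex (finCongr hP)).repr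
  let B : WithLp 2 (EE n × EE 2) →ₗᵢ[ℝ] EE (n + 2) :=
    { toFun := fun w ↦ (a.symm w.fst : EE (n + 2)) + b.symm w.snd
      map_add' := fun x y ↦ by
        simp only [WithLp.add_fst, WithLp.add_snd, map_add, Submodule.coe_add]; abel
      map_smul' := fun c x ↦ by
        simp only [WithLp.smul_fst, WithLp.smul_snd, map_smul, Submodule.coe_smul, smul_add,
          RingHom.id_apply]
      norm_map' := fun w ↦ by
        have h1 : inner ℝ (a.symm w.fst : EE (n + 2)) (b.symm w.snd : EE (n + 2)) = (0 : ℝ) :=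
          Submodule.inner_left_of_mem_orthogonal (b.symm w.snd).2 (a.symm w.fst).2
        have h2 := norm_add_sq_eq_norm_sq_add_norm_sq_of_inner_eq_zero _ _ h1
        have h4 : ‖(a.symm w.fst : EE (n + 2))‖ = ‖w.fst‖ := a.symm.norm_map _
        have h5 : ‖(b.symm w.snd : EE (n + 2))‖ = ‖w.snd‖ := b.symm.norm_map _
        rw [h4, h5] at h2
        have h3 := WithLp.prod_norm_sq_eq_of_L2 w
        exact (pow_left_inj₀ (norm_nonneg _) (norm_nonneg _) two_ne_zero).1
          (by rw [h3, sq, sq, sq]; exact h2) }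
  have hBA : ∀ w, B w = (a.symm w.fst : EE (n + 2)) + b.symm w.snd := fun _ ↦ rfl
  let A := B.toLinearIsometryEquiv (by
    rw [finrank_euclideanSpace_fin, (WithLp.linearEquiv 2 ℝ (EE n × EE 2)).finrank_eq,
      Module.finrank_prod, finrank_euclideanSpace_fin, finrank_euclideanSpace_fin])
  have hA : ∀ z, z = (a.symm (A.symm z).fst : EE (n + 2)) + b.symm (A.symm z).snd := fun z ↦ by
    rw [← hBA]; exact (A.apply_symm_apply z).symm
  refine ⟨A, fun z hz ↦ ?_, fun z hz ↦ ?_⟩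
  · have h1 : (a.symm (A.symm z).fst : EE (n + 2)) ∈ P := by
      rw [← sub_eq_iff_eq_add.2 (hA z)]
      exact P.sub_mem hz (b.symm _).2
    have h2 := Submodule.inner_right_of_mem_orthogonal h1 (a.symm (A.symm z).fst).2
    rw [inner_self_eq_zero, Submodule.coe_eq_zero] at h2
    simpa using h2
  · have h1 : (b.symm (A.symm z).snd : EE (n + 2)) ∈ Pᗮ := by
      rw [← sub_eq_iff_eq_add'.2 (hA z)]
      exact Pᗮ.sub_mem hz (a.symm _).2
    have h2 := Submodule.inner_right_of_mem_orthogonal (b.symm (A.symm z).snd).2 h1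
    rw [inner_self_eq_zero, Submodule.coe_eq_zero] at h2
    simpa using h2

end Splitting

/-! ### Global data of a rotational hypersurface -/

section RotationalData

variable {n : ℕ} {M : Type*} [EMetricSpace M] [ChartedSpace (EE n) M]
  [Bundle.RiemannianBundle (fun x : M ↦ TangentSpace (𝓡 n) x)]

/-- A hypersurface with a simple principal direction `e`, split by a linear isometry `A` of the
ambient space into a component `f₁` normal to the profile plane and a component `f₂` in it. -/
structure RotationalData (f N : M → EE (n + 2)) (lam mu : M → ℝ)
    (A : WithLp 2 (EE n × EE 2) ≃ₗᵢ[ℝ] EE (n + 2)) (f₁ : M → EE n) (f₂ ξ : M → EE 2)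
    (r κ : M → ℝ) (e : ∀ x : M, TangentSpace (𝓡 n) x) : Prop where
  smooth_lam : ContMDiff (𝓡 n) 𝓘(ℝ, ℝ) ∞ lam
  smooth_f₁ : ContMDiff (𝓡 n) 𝓘(ℝ, EE n) ∞ f₁
  smooth_f₂ : ContMDiff (𝓡 n) 𝓘(ℝ, EE 2) ∞ f₂
  smooth_ξ : ContMDiff (𝓡 n) 𝓘(ℝ, EE 2) ∞ ξ
  smooth_r : ContMDiff (𝓡 n) 𝓘(ℝ, ℝ) ∞ r
  smooth_κ : ContMDiff (𝓡 n) 𝓘(ℝ, ℝ) ∞ κ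
  f_eq : ∀ x, f x = A (WithLp.toLp 2 (f₁ x, f₂ x))
  N_eq : ∀ x, N x = A (WithLp.toLp 2 (-(lam x • f₁ x), ξ x - lam x • f₂ x))
  r_pos : ∀ x, 0 < r x
  norm_f₁ : ∀ x, ‖f₁ x‖ = r x
  r_sq : ∀ x, r x ^ 2 * (1 + lam x ^ 2 + κ x ^ 2) = 1
  inner_e : ∀ x, inner ℝ (e x) (e x) = (1 : ℝ)
  diffl_e : ∀ x, diffl f x (e x) = A (WithLp.toLp 2 (-(κ x • f₁ x), r x • rot (ξ x)))
  shape : ∀ x v, shapeOperator f N x v = lam x • v + ((mu x - lam x) * inner ℝ (e x) v) • e x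
  deriv_lam : ∀ x v, mfderiv (𝓡 n) 𝓘(ℝ, ℝ) lam x v = (lam x - mu x) * κ x * inner ℝ (e x) v
  κ_mul_r : ∀ x, κ x * r x = inner ℝ (rot (ξ x)) (f₂ x)
  norm_ξ : ∀ x, inner ℝ (ξ x) (ξ x) = 1 + lam x ^ 2
  inner_ξ_f₂ : ∀ x, inner ℝ (ξ x) (f₂ x) = lam x

variable {f N : M → EE (n + 2)} {lam mu : M → ℝ}

/-- Both `N + lam f` and `df e + κ f` lie in `P`, so their first components vanish, which gives
those of `N` and `df e`. The remaining formulas are scalar products split along the two factors. In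
the plane, orthogonality to `ξ` and the length fix the second component of `df e` up to sign. -/
theorem exists_split_point (h : IsOrientedHypersurface f N)
    {A : WithLp 2 (EE n × EE 2) ≃ₗᵢ[ℝ] EE (n + 2)} {P : Submodule ℝ (EE (n + 2))}
    (hA₁ : ∀ z ∈ P, (A.symm z).fst = 0) (hA₂ : ∀ z ∈ Pᗮ, (A.symm z).snd = 0) {x : M}
    {e : TangentSpace (𝓡 n) x} {κ : ℝ} (he : inner ℝ e e = (1 : ℝ))
    (hP : P = Submodule.span ℝ {N x + lam x • f x, diffl f x e + κ • f x}) :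
    0 < ‖(A.symm (f x)).fst‖ ∧
    ‖(A.symm (f x)).fst‖ ^ 2 * (1 + lam x ^ 2 + κ ^ 2) = 1 ∧
    (A.symm (N x)).fst = -(lam x • (A.symm (f x)).fst) ∧
    (A.symm (diffl f x e)).fst = -(κ • (A.symm (f x)).fst) ∧
    inner ℝ (A.symm (N x + lam x • f x)).snd (A.symm (N x + lam x • f x)).snd
      = 1 + lam x ^ 2 ∧
    inner ℝ (A.symm (N x + lam x • f x)).snd (A.symm (f x)).snd = lam x ∧
    inner ℝ (A.symm (diffl f x e)).snd (A.symm (f x)).snd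
      = κ * ‖(A.symm (f x)).fst‖ ^ 2 ∧
    ((A.symm (diffl f x e)).snd
      = ‖(A.symm (f x)).fst‖ • rot (A.symm (N x + lam x • f x)).snd ∨
    (A.symm (diffl f x e)).snd
      = -(‖(A.symm (f x)).fst‖ • rot (A.symm (N x + lam x • f x)).snd)) := by
  have ip : ∀ z w, inner ℝ z w = inner ℝ (A.symm z).fst (A.symm w).fst
      + inner ℝ (A.symm z).snd (A.symm w).snd := fun z w ↦ by
    rw [← A.symm.inner_map_map, WithLp.prod_inner_apply]; rfl
  have hc : 0 < 1 + lam x ^ 2 + κ ^ 2 := by positivity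
  have e1 := hA₁ _ (hP ▸ Submodule.subset_span (Set.mem_insert _ _) : N x + lam x • f x ∈ P)
  have e2 := hA₁ _ (hP ▸ Submodule.subset_span (Set.mem_insert_of_mem _ rfl) :
    diffl f x e + κ • f x ∈ P)
  have hff := h.inner_self x
  have hNN := h.inner_normal_self x
  have hNf := h.normal_tangent_sphere x
  have hfN : inner ℝ (f x) (N x) = (0 : ℝ) := by rw [real_inner_comm]; exact hNf
  have hfE := h.inner_diffl x e
  have hEf : inner ℝ (diffl f x e) (f x) = (0 : ℝ) := by rw [real_inner_comm]; exact hfE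
  have hNE := h.normal_orthogonal x e
  have hEN : inner ℝ (diffl f x e) (N x) = (0 : ℝ) := by rw [real_inner_comm]; exact hNE
  have hEE : inner ℝ (diffl f x e) (diffl f x e) = (1 : ℝ) := by rw [h.isometric, he]
  -- The orthogonal projection of `f` to `P`, obtained by inverting the Gram matrix of the two
  -- spanning vectors.
  have e3 : (A.symm (f x)).snd = (1 + lam x ^ 2 + κ ^ 2)⁻¹ •
      (lam x • (A.symm (N x + lam x • f x)).snd + κ • (A.symm (diffl f x e + κ • f x)).snd) := by
    have hz : f x - (1 + lam x ^ 2 + κ ^ 2)⁻¹ •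
        (lam x • (N x + lam x • f x) + κ • (diffl f x e + κ • f x)) ∈ Pᗮ := by
      rw [hP, Submodule.mem_orthogonal]
      intro u hu
      induction hu using Submodule.span_induction with
      | mem u hu =>
        rcases hu with rfl | hu
        · simp only [inner_sub_right, inner_add_left, inner_add_right, real_inner_smul_left,
            real_inner_smul_right, hff, hNN, hNf, hfN, hfE, hNE]
          field_simp; ring
        · rw [Set.mem_singleton_iff] at hu
          subst hu
          simp only [inner_sub_right, inner_add_left, inner_add_right, real_inner_smul_left,
            real_inner_smul_right, hff, hEE, hEf, hfN, hfE, hEN]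
          field_simp; ring
      | zero => simp
      | add a b _ _ ha hb => rw [inner_add_left, ha, hb, add_zero]
      | smul t a _ ha => rw [real_inner_smul_left, ha, mul_zero]
    have := hA₂ _ hz
    simp only [map_sub, map_add, map_smul, WithLp.sub_snd, WithLp.smul_snd, WithLp.add_snd,
      sub_eq_zero] at this ⊢
    exact this
  have eN : (A.symm (N x)).fst = -(lam x • (A.symm (f x)).fst) := by
    rw [map_add, map_smul, WithLp.add_fst, WithLp.smul_fst] at e1
    exact eq_neg_of_add_eq_zero_left e1
  have eE : (A.symm (diffl f x e)).fst = -(κ • (A.symm (f x)).fst) := by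
    rw [map_add, map_smul, WithLp.add_fst, WithLp.smul_fst] at e2
    exact eq_neg_of_add_eq_zero_left e2
  have i1 : inner ℝ (A.symm (N x + lam x • f x)).snd (A.symm (f x)).snd = lam x := by
    have := ip (N x + lam x • f x) (f x)
    rw [e1, inner_zero_left, zero_add, inner_add_left, real_inner_smul_left, hNf, hff] at this
    linarith
  have i2 : inner ℝ (A.symm (diffl f x e + κ • f x)).snd (A.symm (f x)).snd = κ := by
    have := ip (diffl f x e + κ • f x) (f x)
    rw [e2, inner_zero_left, zero_add, inner_add_left, real_inner_smul_left, hEf, hff] at this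
    linarith
  have hr : ‖(A.symm (f x)).fst‖ ^ 2 * (1 + lam x ^ 2 + κ ^ 2) = 1 := by
    have h1 := ip (f x) (f x)
    have h2 : inner ℝ (A.symm (f x)).snd (A.symm (f x)).snd
        = (1 + lam x ^ 2 + κ ^ 2)⁻¹ * (lam x ^ 2 + κ ^ 2) := by
      nth_rw 1 [e3]
      rw [real_inner_smul_left, inner_add_left, real_inner_smul_left, real_inner_smul_left, i1, i2]
      ring
    rw [h2, hff, real_inner_self_eq_norm_sq] at h1
    field_simp at h1
    linarith
  have hr0 : 0 < ‖(A.symm (f x)).fst‖ := by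
    refine (norm_nonneg _).lt_of_ne fun h0 ↦ ?_
    rw [← h0] at hr
    norm_num at hr
  have hξξ : inner ℝ (A.symm (N x + lam x • f x)).snd (A.symm (N x + lam x • f x)).snd
      = 1 + lam x ^ 2 := by
    have := ip (N x + lam x • f x) (N x + lam x • f x)
    rw [e1, inner_zero_left, zero_add] at this
    rw [← this]
    simp only [inner_add_left, inner_add_right, real_inner_smul_left,
            real_inner_smul_right, hff, hNN, hNf, hfN]
    ring
  refine ⟨hr0, hr, eN, eE, hξξ, i1, ?_, ?_⟩
  · have := ip (diffl f x e) (f x)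
    rw [eE, hEf, inner_neg_left, real_inner_smul_left, real_inner_self_eq_norm_sq] at this
    linarith
  · apply eq_or_eq_neg_smul_rot
    · intro h0
      rw [h0, inner_zero_left] at hξξ
      nlinarith
    · have := ip (diffl f x e) (N x + lam x • f x)
      rw [e1, inner_zero_right, zero_add] at this
      rw [← this, inner_add_right, real_inner_smul_right, hEN, hEf]
      ring
    · have := ip (diffl f x e) (diffl f x e)
      rw [eE, hEE, inner_neg_left, inner_neg_right, real_inner_smul_left, real_inner_smul_right,
        real_inner_self_eq_norm_sq] at this
      rw [hξξ]
      linear_combination -this - hr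

variable [Fact (3 ≤ n)] [IsManifold (𝓡 n) ∞ M] {m : ℕ} {H : ℝ}

/-- The vector `ξ` never vanishes, so requiring the planar part of `df e` to be a positive multiple
of `rot ξ` fixes the sign of `e` everywhere at once. No covering or orientability argument is needed
to make `e` a smooth global field. -/
theorem exists_rotationalData [ConnectedSpace M] (h : IsOrientedHypersurface f N)
    (hlm : HasTwoPrincipalCurvatures f N lam mu) (hm : 1 ≤ m) (hmn : m ≤ n)
    (hH : ∀ x, meanCurvature f N m x = H) (hpos : ∀ x, 0 < lam x) :
    ∃ A f₁ f₂ ξ r κ e, RotationalData f N lam mu A f₁ f₂ ξ r κ e := by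
  obtain ⟨x₀⟩ := ‹ConnectedSpace M›.toNonempty
  obtain ⟨A, hA₁, hA₂⟩ := exists_splitting (profilePlane f N lam x₀)
    (exists_principal_data h hlm hm hmn hH hpos x₀).2.1
  have hl := (h.contMDiff_curvatures hlm).1
  let π₁ : EE (n + 2) →L[ℝ] EE n :=
    (WithLp.fstL 2 ℝ (EE n) (EE 2)).comp A.symm.toContinuousLinearEquiv.toContinuousLinearMap
  let π₂ : EE (n + 2) →L[ℝ] EE 2 :=
    (WithLp.sndL 2 ℝ (EE n) (EE 2)).comp A.symm.toContinuousLinearEquiv.toContinuousLinearMap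
  have hπ₁ : ∀ z, π₁ z = (A.symm z).fst := fun _ ↦ rfl
  have hπ₂ : ∀ z, π₂ z = (A.symm z).snd := fun _ ↦ rfl
  have hsplit : ∀ z, z = A (WithLp.toLp 2 (π₁ z, π₂ z)) := fun z ↦
    (A.apply_symm_apply z).symm
  have hpt : ∀ x, ∃ (e : TangentSpace (𝓡 n) x) (κ : ℝ), inner ℝ e e = (1 : ℝ) ∧
      (∀ v, shapeOperator f N x v = lam x • v + ((mu x - lam x) * inner ℝ e v) • e) ∧
      (∀ v, mfderiv (𝓡 n) 𝓘(ℝ, ℝ) lam x v = (lam x - mu x) * κ * inner ℝ e v) ∧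
      profilePlane f N lam x₀ = Submodule.span ℝ {N x + lam x • f x, diffl f x e + κ • f x} ∧
      π₂ (diffl f x e) = ‖π₁ (f x)‖ • rot (π₂ (N x + lam x • f x)) := by
    intro x
    obtain ⟨e, κ, he, hA, hd, hP⟩ := (exists_principal_data h hlm hm hmn hH hpos x).1
    rw [profilePlane_eq h hlm hm hmn hH hpos x x₀] at hP
    obtain ⟨-, -, -, -, -, -, -, hs | hs⟩ := exists_split_point h hA₁ hA₂ he hP
    · exact ⟨e, κ, he, hA, hd, hP, hs⟩
    · refine ⟨-e, -κ, ?_, fun v ↦ ?_, fun v ↦ ?_, ?_, ?_⟩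
      · rw [inner_neg_left, inner_neg_right, he, neg_neg]
      · rw [hA, inner_neg_left]; module
      · have hn : inner ℝ (-e) v = -(inner ℝ e v : ℝ) := inner_neg_left _ _
        rw [hd, hn, mul_neg, mul_neg, neg_mul, neg_neg]
      · rw [hP, map_neg, neg_smul, ← neg_add, Submodule.span_insert, Submodule.span_insert,
          ← Submodule.span_neg {diffl f x e + κ • f x}, Set.neg_singleton]
      · rw [map_neg, map_neg, hπ₂, hs, neg_neg]; rfl
  choose e κ' he hshape hd hP hs using hpt
  have hall := fun x ↦ exists_split_point h hA₁ hA₂ (he x) (hP x)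
  let f₁ : M → EE n := fun x ↦ π₁ (f x)
  let f₂ : M → EE 2 := fun x ↦ π₂ (f x)
  let ξ : M → EE 2 := fun x ↦ π₂ (N x + lam x • f x)
  let r : M → ℝ := fun x ↦ ‖f₁ x‖
  -- A manifestly smooth formula for the pointwise `κ'`.
  let κ : M → ℝ := fun x ↦ inner ℝ (rot (ξ x)) (f₂ x) / r x
  have hκr : ∀ x, κ x * r x = inner ℝ (rot (ξ x)) (f₂ x) := fun x ↦
    div_mul_cancel₀ _ (hall x).1.ne'
  have hκ : ∀ x, κ' x = κ x := fun x ↦ by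
    have h1 := (hall x).2.2.2.2.2.2.1
    rw [← hπ₂, hs, real_inner_smul_left] at h1
    change r x * inner ℝ (rot (ξ x)) (f₂ x) = κ' x * r x ^ 2 at h1
    have h2 : r x ≠ 0 := (hall x).1.ne'
    rw [eq_div_iff h2]
    apply mul_left_cancel₀ h2
    rw [h1]; ring
  have hf₁ : ContMDiff (𝓡 n) 𝓘(ℝ, EE n) ∞ f₁ := π₁.contDiff.contMDiff.comp h.contMDiff
  have hf₂ : ContMDiff (𝓡 n) 𝓘(ℝ, EE 2) ∞ f₂ := π₂.contDiff.contMDiff.comp h.contMDiff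
  have hξ : ContMDiff (𝓡 n) 𝓘(ℝ, EE 2) ∞ ξ :=
    π₂.contDiff.contMDiff.comp (h.contMDiff_normal.add (hl.smul h.contMDiff))
  have hr : ContMDiff (𝓡 n) 𝓘(ℝ, ℝ) ∞ r := fun x ↦
    (contDiffAt_norm ℝ (norm_pos_iff.1 (hall x).1)).contMDiffAt.comp x hf₁.contMDiffAt
  have hin : ContDiff ℝ ∞ fun p : EE 2 × EE 2 ↦ (inner ℝ (rot p.1) p.2 : ℝ) :=
    (rotL.contDiff.comp contDiff_fst).inner ℝ contDiff_snd
  have hκs : ContMDiff (𝓡 n) 𝓘(ℝ, ℝ) ∞ κ :=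
    (hin.contMDiff.comp (hξ.prodMk_space hf₂)).div₀ hr fun x ↦ (hall x).1.ne'
  refine ⟨A, f₁, f₂, ξ, r, κ, e, hl, hf₁, hf₂, hξ, hr, hκs, fun x ↦ hsplit _, fun x ↦ ?_,
    fun x ↦ (hall x).1, fun x ↦ rfl, fun x ↦ ?_, he, fun x ↦ ?_, hshape, fun x v ↦ ?_, hκr,
    fun x ↦ (hall x).2.2.2.2.1, fun x ↦ (hall x).2.2.2.2.2.1⟩
  · have h1 := hsplit (N x)
    rw [hπ₁, (hall x).2.2.1] at h1
    rw [h1]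
    congr 3
    simp only [ξ, f₂, map_add, map_smul]
    abel
  · rw [← hκ]; exact (hall x).2.1
  · have h1 := hsplit (diffl f x (e x))
    rw [hπ₁, (hall x).2.2.2.1, hs, hκ] at h1
    exact h1
  · rw [hd, hκ]

end RotationalData

/-! ### Differential equations along the profile curve -/

section ProfileODE

/-- The differential equations satisfied by the principal curvatures `l` and `mu`, and the geodesic
curvature `κ` of the slices, along the profile curve. -/
structure ProfileODE (n m : ℕ) (H : ℝ) (l mu κ : ℝ → ℝ) : Prop where
  one_le : 1 ≤ m
  le : m ≤ n
  smooth_l : ContDiff ℝ ∞ l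
  pos : ∀ s, 0 < l s
  ne : ∀ s, l s ≠ mu s
  deriv_l : ∀ s, HasDerivAt l ((l s - mu s) * κ s) s
  deriv_κ : ∀ s, HasDerivAt κ (1 + κ s ^ 2 + l s * mu s) s
  meanCurvature : ∀ s, n * H = (n - m) * l s ^ m + m * l s ^ (m - 1) * mu s

namespace ProfileODE

variable {n m : ℕ} {H : ℝ} {l mu κ : ℝ → ℝ} (h : ProfileODE n m H l mu κ)
include h

theorem natCast_pos : 0 < (n : ℝ) := by
  have := h.one_le
  have := h.le
  exact_mod_cast (by omega : 0 < n)

theorem mul_sub_eq (s : ℝ) : n * (l s ^ m - H) = m * l s ^ (m - 1) * (l s - mu s) := by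
  have h1 := h.meanCurvature s
  have h2 : l s ^ m = l s ^ (m - 1) * l s := by
    rw [← pow_succ, Nat.sub_add_cancel h.one_le]
  linear_combination -h1 + m * h2

theorem sub_ne_zero (s : ℝ) : l s ^ m - H ≠ 0 := by
  intro h0
  have h1 := h.mul_sub_eq s
  have hm : (m : ℝ) ≠ 0 := by have := h.one_le; exact_mod_cast (by omega : m ≠ 0)
  rw [h0, mul_zero] at h1
  exact mul_ne_zero (mul_ne_zero hm (pow_ne_zero _ (h.pos s).ne')) (_root_.sub_ne_zero.2 (h.ne s))
    h1.symm

/-- By `mul_sub_eq` the factor `l - mu` in `l'` reproduces `l ^ m - H`. The equation is linear with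
coefficient `n κ`, which explains the exponent `-1/n` in `w`. -/
theorem hasDerivAt_sub (s : ℝ) :
    HasDerivAt (fun t ↦ l t ^ m - H) (n * (l s ^ m - H) * κ s) s := by
  convert! ((h.deriv_l s).pow m).sub_const H using 1
  rw [h.mul_sub_eq]; ring

/-- The sign of `l ^ m - H` is determined by completeness. -/
theorem lt_pow (s : ℝ) : H < l s ^ m := by
  by_contra! hs
  have hneg : ∀ t, l t ^ m - H < 0 := by
    intro t
    by_contra! ht
    have hc : Continuous fun t ↦ l t ^ m - H := (h.smooth_l.continuous.pow m).sub continuous_const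
    obtain ⟨u, hu⟩ := mem_range_of_exists_le_of_exists_ge hc ⟨s, sub_nonpos.2 hs⟩ ⟨t, ht⟩
    exact h.sub_ne_zero u hu
  have hmu : ∀ t, l t < mu t := by
    intro t
    have h1 := h.mul_sub_eq t
    have h2 : (n : ℝ) * (l t ^ m - H) < 0 := mul_neg_of_pos_of_neg h.natCast_pos (hneg t)
    rw [h1] at h2
    have h3 : 0 ≤ (m : ℝ) * l t ^ (m - 1) := mul_nonneg (Nat.cast_nonneg _) (pow_pos (h.pos t) _).le
    by_contra! h4
    exact absurd (mul_nonneg h3 (sub_nonneg.2 h4)) (not_le.2 h2)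
  -- Since `l mu > 0`, `arctan κ` grows at least as fast as `t`. But its total increase is less than
  -- `π`, which is impossible on an interval of length `4 > π`.
  have hd : ∀ t, HasDerivAt (fun t ↦ Real.arctan (κ t) - t)
      (1 / (1 + κ t ^ 2) * (1 + κ t ^ 2 + l t * mu t) - 1) t := fun t ↦
    ((h.deriv_κ t).arctan).sub (hasDerivAt_id t)
  have hmono : Monotone fun t ↦ Real.arctan (κ t) - t := by
    refine monotone_of_deriv_nonneg (fun t ↦ (hd t).differentiableAt) fun t ↦ ?_
    rw [(hd t).deriv]
    have h1 : 0 < 1 + κ t ^ 2 := by positivity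
    have h2 : 0 < l t * mu t := mul_pos (h.pos t) ((h.pos t).trans (hmu t))
    have h3 : 1 / (1 + κ t ^ 2) * (1 + κ t ^ 2 + l t * mu t) - 1
        = l t * mu t / (1 + κ t ^ 2) := by field_simp; ring
    rw [h3]
    positivity
  have h1 := hmono (by norm_num : (0 : ℝ) ≤ 4)
  have h2 := Real.arctan_lt_pi_div_two (κ 4)
  have h3 := Real.neg_pi_div_two_lt_arctan (κ 0)
  have h4 := Real.pi_lt_four
  simp only at h1
  linarith

theorem wFun_eq (s : ℝ) : wFun n m H l s = (l s ^ m - H) ^ (-(1 / (n : ℝ))) := by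
  rw [wFun, abs_of_pos (sub_pos.2 (h.lt_pow s))]

theorem contDiff_wFun : ContDiff ℝ ∞ (wFun n m H l) := by
  have h1 : wFun n m H l = fun s ↦ (l s ^ m - H) ^ (-(1 / (n : ℝ))) := funext h.wFun_eq
  rw [h1]
  exact ((h.smooth_l.pow m).sub contDiff_const).rpow_const_of_ne h.sub_ne_zero

theorem hasDerivAt_wFun (s : ℝ) : HasDerivAt (wFun n m H l) (-(κ s * wFun n m H l s)) s := by
  have h1 : wFun n m H l = fun s ↦ (l s ^ m - H) ^ (-(1 / (n : ℝ))) := funext h.wFun_eq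
  have hn := h.natCast_pos.ne'
  rw [h1]
  convert! (h.hasDerivAt_sub s).rpow_const (p := -(1 / (n : ℝ))) (Or.inl (h.sub_ne_zero s)) using 1
  rw [Real.rpow_sub_one (h.sub_ne_zero s)]
  have := h.sub_ne_zero s
  field_simp

/-- Differentiate `w' = -κ w`; the terms in `κ²` cancel against the Riccati equation. -/
theorem deriv_deriv_wFun (s : ℝ) :
    deriv (deriv (wFun n m H l)) s = -((1 + l s * mu s) * wFun n m H l s) := by
  have h1 : deriv (wFun n m H l) = fun s ↦ -(κ s * wFun n m H l s) :=
    funext fun s ↦ (h.hasDerivAt_wFun s).deriv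
  have h2 := ((h.deriv_κ s).mul (h.hasDerivAt_wFun s)).neg
  rw [h1]
  refine h2.deriv.trans ?_
  ring

theorem wFun_pow (s : ℝ) : wFun n m H l s ^ n = (l s ^ m - H)⁻¹ := by
  rw [h.wFun_eq, ← Real.rpow_natCast, ← Real.rpow_mul (sub_pos.2 (h.lt_pow s)).le, neg_mul,
    one_div_mul_cancel h.natCast_pos.ne', Real.rpow_neg_one]

/-- Here `w⁻ⁿ + H = l ^ m`, whose power of exponent `(2 - m) / m` is `l^(2 - m)`. The first two
terms in the bracket are then `-l mu`, with `mu` eliminated by the mean curvature equation. -/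
theorem wFun_equation (s : ℝ) :
    deriv (deriv (wFun n m H l)) s - wFun n m H l s *
      (((n : ℝ) - m) * (wFun n m H l s ^ (-(n : ℤ)) + H) ^ ((2 - (m : ℝ)) / m)
          / (m * wFun n m H l s ^ n)
        - H * (wFun n m H l s ^ (-(n : ℤ)) + H) ^ ((2 - (m : ℝ)) / m) - 1) = 0 := by
  have hm : (m : ℝ) ≠ 0 := by have := h.one_le; exact_mod_cast (by omega : m ≠ 0)
  have hl := h.pos s
  have hq := h.sub_ne_zero s
  have h1 : (wFun n m H l s ^ (-(n : ℤ)) + H) ^ ((2 - (m : ℝ)) / m)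
      = l s * (l s ^ (m - 1))⁻¹ := by
    rw [zpow_neg, zpow_natCast, h.wFun_pow, inv_inv, sub_add_cancel, ← Real.rpow_natCast (l s) m,
      ← Real.rpow_mul hl.le, mul_div_cancel₀ _ hm, ← Real.rpow_natCast (l s) (m - 1),
      Nat.cast_sub h.one_le, ← Real.rpow_neg hl.le]
    nth_rw 2 [← Real.rpow_one (l s)]
    rw [← Real.rpow_add hl]
    congr 1
    push_cast; ring
  rw [h1, h.deriv_deriv_wFun, h.wFun_pow]
  have h2 := h.meanCurvature s
  have h3 := (pow_pos hl (m - 1)).ne'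
  have h4 : mu s = (n * H - (n - m) * l s ^ m) / (m * l s ^ (m - 1)) := by
    rw [eq_div_iff (mul_ne_zero hm h3)]
    linarith
  rw [h4]
  field_simp
  ring

/-- The logarithmic derivative of `|l ^ m - H|^(1/n)` is `κ`, by `hasDerivAt_sub`. -/
theorem sliceCurvature_eq (s : ℝ) : sliceCurvature n m H l s = κ s ^ 2 + l s ^ 2 + 1 := by
  have hn := h.natCast_pos.ne'
  have h1 : (fun t ↦ Real.log (|l t ^ m - H| ^ (1 / (n : ℝ))))
      = fun t ↦ 1 / (n : ℝ) * Real.log (l t ^ m - H) := by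
    funext t
    rw [abs_of_pos (sub_pos.2 (h.lt_pow t)), Real.log_rpow (sub_pos.2 (h.lt_pow t))]
  rw [sliceCurvature, h1, (((h.hasDerivAt_sub s).log (h.sub_ne_zero s)).const_mul _).deriv]
  have := h.sub_ne_zero s
  field_simp

end ProfileODE

end ProfileODE

/-! ### Derivatives of the rotational data along curves -/

section Curves

variable {n : ℕ} {M : Type*} [EMetricSpace M] [ChartedSpace (EE n) M]

theorem hasDerivAt_comp_curve {W : Type*} [NormedAddCommGroup W] [NormedSpace ℝ W] {g : M → W}
    {γ : ℝ → M} {t : ℝ} {v : TangentSpace (𝓡 n) (γ t)}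
    (hg : MDifferentiableAt (𝓡 n) 𝓘(ℝ, W) g (γ t))
    (hγ : HasMFDerivAt 𝓘(ℝ, ℝ) (𝓡 n) γ t ((1 : ℝ →L[ℝ] ℝ).smulRight v)) :
    HasDerivAt (fun s ↦ g (γ s)) (mfderiv (𝓡 n) 𝓘(ℝ, W) g (γ t) v : W) t := by
  let L : ℝ →L[ℝ] W := ContinuousLinearMap.comp
    (mfderiv (𝓡 n) 𝓘(ℝ, W) g (γ t) : EE n →L[ℝ] W)
    ((1 : ℝ →L[ℝ] ℝ).smulRight (v : EE n))
  have h3 : HasFDerivAt (g ∘ γ) L t := (HasMFDerivAt.comp t hg.hasMFDerivAt hγ).hasFDerivAt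
  have h4 : L 1 = mfderiv (𝓡 n) 𝓘(ℝ, W) g (γ t) v := by
    change (mfderiv (𝓡 n) 𝓘(ℝ, W) g (γ t) : EE n →L[ℝ] W) ((1 : ℝ) • (v : EE n)) = _
    rw [one_smul]
  rw [← h4]
  exact h3.hasDerivAt

variable [Bundle.RiemannianBundle (fun x : M ↦ TangentSpace (𝓡 n) x)]
  {f N : M → EE (n + 2)} {lam mu : M → ℝ} {A : WithLp 2 (EE n × EE 2) ≃ₗᵢ[ℝ] EE (n + 2)}
  {f₁ : M → EE n} {f₂ ξ : M → EE 2} {r κ : M → ℝ} {e : ∀ x : M, TangentSpace (𝓡 n) x}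

theorem hasDerivAt_split (A : WithLp 2 (EE n × EE 2) ≃ₗᵢ[ℝ] EE (n + 2)) {a : ℝ → EE n}
    {b : ℝ → EE 2} {u : EE n} {z : EE 2} {t : ℝ}
    (h : HasDerivAt (fun s ↦ A (WithLp.toLp 2 (a s, b s))) (A (WithLp.toLp 2 (u, z))) t) :
    HasDerivAt a u t ∧ HasDerivAt b z t := by
  let B : EE (n + 2) →L[ℝ] WithLp 2 (EE n × EE 2) :=
    A.symm.toContinuousLinearEquiv.toContinuousLinearMap
  have hB : ∀ w, B (A w) = w := A.symm_apply_apply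
  have e1 := ((WithLp.fstL 2 ℝ (EE n) (EE 2)).comp B).hasFDerivAt.comp_hasDerivAt t h
  have e2 := ((WithLp.sndL 2 ℝ (EE n) (EE 2)).comp B).hasFDerivAt.comp_hasDerivAt t h
  simp only [Function.comp_def, ContinuousLinearMap.comp_apply, hB] at e1 e2
  exact ⟨e1, e2⟩

theorem contDiff_split (A : WithLp 2 (EE n × EE 2) ≃ₗᵢ[ℝ] EE (n + 2)) :
    ContDiff ℝ ∞ fun w : EE n × EE 2 ↦ A (WithLp.toLp 2 w) :=
  A.toContinuousLinearEquiv.contDiff.comp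
    (WithLp.prodContinuousLinearEquiv 2 ℝ (EE n) (EE 2)).symm.contDiff

namespace RotationalData

variable (d : RotationalData f N lam mu A f₁ f₂ ξ r κ e) (h : IsOrientedHypersurface f N)

include d in
theorem contMDiff_direction : ContMDiff (𝓡 n) 𝓘(ℝ, EE (n + 2)) ∞
    fun x ↦ A (WithLp.toLp 2 (-(κ x • f₁ x), r x • rot (ξ x))) := by
  have h1 : ContMDiff (𝓡 n) 𝓘(ℝ, EE n × EE 2) ∞ fun x ↦ (-(κ x • f₁ x), r x • rotL (ξ x)) :=
    (d.smooth_κ.smul d.smooth_f₁).neg.prodMk_space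
      (d.smooth_r.smul (rotL.contDiff.contMDiff.comp d.smooth_ξ))
  exact (contDiff_split A).contMDiff.comp h1

section Tangent

variable {γ : ℝ → M} {t : ℝ} {v : TangentSpace (𝓡 n) (γ t)}
  (hγ : HasMFDerivAt 𝓘(ℝ, ℝ) (𝓡 n) γ t ((1 : ℝ →L[ℝ] ℝ).smulRight v))
include d hγ

theorem hasDerivAt_lam : HasDerivAt (fun s ↦ lam (γ s))
    ((lam (γ t) - mu (γ t)) * κ (γ t) * inner ℝ (e (γ t)) v) t := by
  rw [← d.deriv_lam]
  exact hasDerivAt_comp_curve (d.smooth_lam.contMDiffAt.mdifferentiableAt (by simp)) hγ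

include h

theorem hasDerivAt_f₁_f₂ {u : EE n} {z : EE 2} (hv : diffl f (γ t) v = A (WithLp.toLp 2 (u, z))) :
    HasDerivAt (fun s ↦ f₁ (γ s)) u t ∧ HasDerivAt (fun s ↦ f₂ (γ s)) z t := by
  apply hasDerivAt_split A
  have h1 : (fun s ↦ A (WithLp.toLp 2 (f₁ (γ s), f₂ (γ s)))) = fun s ↦ f (γ s) :=
    funext fun s ↦ (d.f_eq _).symm
  rw [← hv, h1]
  exact hasDerivAt_comp_curve (h.mdifferentiableAt (γ t)) hγ

theorem hasDerivAt_ξ {u : EE n} {z : EE 2} (hv : diffl f (γ t) v = A (WithLp.toLp 2 (u, z))) :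
    HasDerivAt (fun s ↦ ξ (γ s)) (((lam (γ t) - mu (γ t)) * inner ℝ (e (γ t)) v) •
      (r (γ t) • rot (ξ (γ t)) + κ (γ t) • f₂ (γ t))) t := by
  have hl := d.hasDerivAt_lam hγ
  have hf := (d.hasDerivAt_f₁_f₂ h hγ hv).2
  have hN := hasDerivAt_comp_curve (h.mdifferentiableAt_normal (γ t)) hγ
  have hA : diffl N (γ t) v = A (WithLp.toLp 2
      (-(lam (γ t) • u - ((mu (γ t) - lam (γ t)) * inner ℝ (e (γ t)) v) • κ (γ t) • f₁ (γ t)),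
        -(lam (γ t) • z + ((mu (γ t) - lam (γ t)) * inner ℝ (e (γ t)) v) •
          r (γ t) • rot (ξ (γ t))))) := by
    rw [← neg_eq_iff_eq_neg.2 (h.diffl_shapeOperator (γ t) v), d.shape, map_add, map_smul,
      map_smul, hv, d.diffl_e, ← map_smul, ← map_smul, ← map_add, ← map_neg]
    congr 1
    refine WithLp.ofLp_injective 2 (Prod.ext ?_ ?_)
    · change -(lam (γ t) • u + _ • -(κ (γ t) • f₁ (γ t))) = _
      rw [smul_neg, ← sub_eq_add_neg]
    · rfl
  have hN' : HasDerivAt (fun s ↦ N (γ s)) (diffl N (γ t) v) t := hN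
  rw [hA] at hN'
  simp only [d.N_eq] at hN'
  have h2 := (hasDerivAt_split A hN').2.add (hl.smul hf)
  convert! h2 using 1
  · funext s
    simp
  · module

end Tangent

section IntegralCurve

variable {γ : ℝ → M} (hγ : IsMIntegralCurve γ e)
include d h hγ

theorem hasDerivAt_f₁ (t : ℝ) : HasDerivAt (fun s ↦ f₁ (γ s)) (-(κ (γ t) • f₁ (γ t))) t :=
  (d.hasDerivAt_f₁_f₂ h (hγ t) (d.diffl_e _)).1

theorem hasDerivAt_f₂ (t : ℝ) : HasDerivAt (fun s ↦ f₂ (γ s)) (r (γ t) • rot (ξ (γ t))) t :=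
  (d.hasDerivAt_f₁_f₂ h (hγ t) (d.diffl_e _)).2

theorem hasDerivAt_r (t : ℝ) : HasDerivAt (fun s ↦ r (γ s)) (-(κ (γ t) * r (γ t))) t := by
  have h1 := (d.hasDerivAt_f₁ h hγ t).norm_sq.sqrt
    (pow_ne_zero 2 (by rw [d.norm_f₁]; exact (d.r_pos _).ne'))
  simp only [d.norm_f₁, Real.sqrt_sq (d.r_pos _).le, inner_neg_right, real_inner_smul_right,
    real_inner_self_eq_norm_sq] at h1
  convert! h1 using 1
  have := (d.r_pos (γ t)).ne'
  field_simp

/-- Both `f₁` and `r` satisfy the equation `y' = -κ y`. So an integral curve of `e` keeps its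
direction in the first factor, a fixed point of the sphere. -/
theorem inv_r_smul_f₁_eq (s t : ℝ) :
    (r (γ s))⁻¹ • f₁ (γ s) = (r (γ t))⁻¹ • f₁ (γ t) := by
  have h1 : ∀ t, HasDerivAt (fun s ↦ (r (γ s))⁻¹ • f₁ (γ s)) 0 t := fun t ↦ by
    convert! ((d.hasDerivAt_r h hγ t).inv (d.r_pos _).ne').smul (d.hasDerivAt_f₁ h hγ t) using 1
    have := (d.r_pos (γ t)).ne'
    rw [Pi.inv_apply, smul_neg, smul_smul, eq_comm, neg_add_eq_zero]
    congr 1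
    field_simp
  exact is_const_of_deriv_eq_zero (fun t ↦ (h1 t).differentiableAt) (fun t ↦ (h1 t).deriv) s t

/-- The Riccati equation again, now from the explicit formula for `κ`: `RotationalData` does not
record the derivative of `κ`. -/
theorem hasDerivAt_κ (t : ℝ) : HasDerivAt (fun s ↦ κ (γ s))
    (1 + κ (γ t) ^ 2 + lam (γ t) * mu (γ t)) t := by
  have h1 := d.hasDerivAt_ξ h (hγ t) (d.diffl_e _)
  have h2 := (rotL.hasFDerivAt.comp_hasDerivAt t h1).inner ℝ (d.hasDerivAt_f₂ h hγ t)
  have h3 := h2.div (d.hasDerivAt_r h hγ t) (d.r_pos _).ne'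
  have h4 : (fun s ↦ κ (γ s)) = fun s ↦ inner ℝ (rot (ξ (γ s))) (f₂ (γ s)) / r (γ s) := by
    funext s
    rw [← d.κ_mul_r, mul_div_cancel_right₀ _ (d.r_pos _).ne']
  rw [h4]
  convert! h3 using 1
  simp only [Function.comp_def, rotL_apply, map_smul, map_add, rot_rot, inner_rot_rot,
    real_inner_smul_left, real_inner_smul_right, inner_add_left, inner_neg_left, d.inner_e,
    d.norm_ξ, d.inner_ξ_f₂, inner_rot_self, ← d.κ_mul_r]
  have := (d.r_pos (γ t)).ne'
  field_simp
  ring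

variable [IsManifold (𝓡 n) ∞ M]

theorem contMDiff_integralCurve : ContMDiff 𝓘(ℝ, ℝ) (𝓡 n) ∞ γ := by
  exact contMDiffOn_univ.1 (h.contMDiffOn_integralCurve d.contMDiff_direction d.diffl_e isOpen_univ
    (hγ.isMIntegralCurveOn _))

theorem profileODE {m : ℕ} {H : ℝ} (hlm : HasTwoPrincipalCurvatures f N lam mu) (hm : 1 ≤ m)
    (hmn : m ≤ n) (hH : ∀ x, meanCurvature f N m x = H) (hpos : ∀ x, 0 < lam x) :
    ProfileODE n m H (fun s ↦ lam (γ s)) (fun s ↦ mu (γ s)) (fun s ↦ κ (γ s)) where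
  one_le := hm
  le := hmn
  smooth_l := contMDiff_iff_contDiff.1 (d.smooth_lam.comp (d.contMDiff_integralCurve h hγ))
  pos _ := hpos _
  ne _ := hlm.distinct _
  deriv_l s := by simpa only [d.inner_e, mul_one] using d.hasDerivAt_lam (hγ s)
  deriv_κ := d.hasDerivAt_κ h hγ
  meanCurvature s := by rw [← hlm.meanCurvature_eq hm hmn, hH]

end IntegralCurve

end RotationalData
end Curves

/-! ### Rotations of the first factor act on the hypersurface -/

section Rotation

variable {n : ℕ} {M : Type*} [EMetricSpace M] [ChartedSpace (EE n) M]
  [Bundle.RiemannianBundle (fun x : M ↦ TangentSpace (𝓡 n) x)]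
  {f N : M → EE (n + 2)} {lam mu : M → ℝ} {A : WithLp 2 (EE n × EE 2) ≃ₗᵢ[ℝ] EE (n + 2)}
  {f₁ : M → EE n} {f₂ ξ : M → EE 2} {r κ : M → ℝ} {e : ∀ x : M, TangentSpace (𝓡 n) x}

theorem inner_split (A : WithLp 2 (EE n × EE 2) ≃ₗᵢ[ℝ] EE (n + 2)) (a b : EE n) (y z : EE 2) :
    inner ℝ (A (WithLp.toLp 2 (a, y))) (A (WithLp.toLp 2 (b, z))) = inner ℝ a b + inner ℝ y z := by
  rw [A.inner_map_map, WithLp.prod_inner_apply]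

namespace RotationalData

variable (d : RotationalData f N lam mu A f₁ f₂ ξ r κ e) (h : IsOrientedHypersurface f N)
include d h

/-- A hypersurface of the kind considered is invariant under rotations of the first factor. -/
theorem exists_rotation_vector (p u : EE n) (x : M) :
    ∃ v, diffl (n := n) f x v =
      A (WithLp.toLp 2 ((inner ℝ (f₁ x) p : ℝ) • u - (inner ℝ (f₁ x) u : ℝ) • p, 0)) := by
  -- The rotation vector is orthogonal to `f₁`, and the first component of `N` is a multiple of
  -- `f₁`; hence it is orthogonal to `f` and to `N`.
  have hin : inner ℝ (f₁ x) ((inner ℝ (f₁ x) p : ℝ) • u - (inner ℝ (f₁ x) u : ℝ) • p)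
      = (0 : ℝ) := by
    rw [inner_sub_right, real_inner_smul_right, real_inner_smul_right]; ring
  apply h.exists_diffl_eq
  · rw [d.f_eq, inner_split, hin, inner_zero_right, add_zero]
  · rw [d.N_eq, inner_split, inner_neg_left, real_inner_smul_left, hin, inner_zero_right, mul_zero,
      neg_zero, add_zero]

variable [IsManifold (𝓡 n) ∞ M] [IsRiemannianManifold (𝓡 n) M] [CompleteSpace M]

/-- Follow the tangent field of rotations in the plane of `p` and `u`; it is bounded since `‖f₁‖ ≤
1`, hence complete. It has no component in the profile plane, so `f₂` is preserved, and it is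
orthogonal to `e`, so `ξ` and `lam` are preserved. -/
theorem exists_rotation_curve {p u : EE n} (hp : ‖p‖ = 1) (hu : ‖u‖ = 1)
    (hpu : inner ℝ p u = (0 : ℝ)) {x : M} (hx : f₁ x = r x • p) :
    ∃ β : ℝ → M, Continuous β ∧ β 0 = x ∧ ∀ θ,
      f₁ (β θ) = r x • (Real.cos θ • p + Real.sin θ • u) ∧ f₂ (β θ) = f₂ x ∧ ξ (β θ) = ξ x ∧
      lam (β θ) = lam x := by
  choose v hv using d.exists_rotation_vector h p u
  have hY : ContMDiff (𝓡 n) 𝓘(ℝ, EE (n + 2)) ∞ fun x ↦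
      A (WithLp.toLp 2 ((inner ℝ (f₁ x) p : ℝ) • u - (inner ℝ (f₁ x) u : ℝ) • p, 0)) := by
    have h1 : ContDiff ℝ ∞ fun z : EE n ↦
        (((inner ℝ z p : ℝ) • u - (inner ℝ z u : ℝ) • p, 0) : EE n × EE 2) := by
      refine ContDiff.prodMk (ContDiff.sub ?_ ?_) contDiff_const
      · exact (contDiff_id.inner ℝ contDiff_const).smul contDiff_const
      · exact (contDiff_id.inner ℝ contDiff_const).smul contDiff_const
    exact ((contDiff_split A).comp h1).contMDiff.comp d.smooth_f₁
  have hC : ∀ x, ‖A (WithLp.toLp 2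
      ((inner ℝ (f₁ x) p : ℝ) • u - (inner ℝ (f₁ x) u : ℝ) • p, (0 : EE 2)))‖ ≤ (2 : NNReal) := by
    intro x
    have h0 : ‖f₁ x‖ ≤ 1 := by
      have h1 := d.r_sq x
      rw [d.norm_f₁]
      nlinarith [sq_nonneg (lam x), sq_nonneg (κ x), d.r_pos x,
        mul_nonneg (sq_nonneg (r x)) (add_nonneg (sq_nonneg (lam x)) (sq_nonneg (κ x)))]
    have h1 : ∀ w : EE n, ‖w‖ = 1 → |(inner ℝ (f₁ x) w : ℝ)| ≤ 1 := fun w hw ↦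
      (abs_real_inner_le_norm _ _).trans (by rw [hw, mul_one]; exact h0)
    have h2 := norm_sub_le ((inner ℝ (f₁ x) p : ℝ) • u) ((inner ℝ (f₁ x) u : ℝ) • p)
    rw [norm_smul, norm_smul, hp, hu, mul_one, mul_one, Real.norm_eq_abs, Real.norm_eq_abs] at h2
    rw [A.norm_map, WithLp.norm_toLp_fst]
    have := h1 p hp
    have := h1 u hu
    push_cast
    linarith
  obtain ⟨β, hβ0, hβ⟩ := h.exists_integralCurve hY hv hC x
  have hev : ∀ x, inner ℝ (e x) (v x) = (0 : ℝ) := by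
    intro x
    rw [← h.isometric, d.diffl_e, hv, inner_split, inner_zero_right, add_zero, inner_neg_left,
      real_inner_smul_left, inner_sub_right, real_inner_smul_right, real_inner_smul_right]
    ring
  have hconst : ∀ {W : Type} [NormedAddCommGroup W] [NormedSpace ℝ W] (g : ℝ → W),
      (∀ t, HasDerivAt g 0 t) → ∀ t, g t = g 0 := fun g hg t ↦
    is_const_of_deriv_eq_zero (fun t ↦ (hg t).differentiableAt) (fun t ↦ (hg t).deriv) t 0
  refine ⟨β, continuous_iff_continuousAt.2 fun t ↦ (hβ t).continuousAt, hβ0, fun θ ↦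
    ⟨?_, ?_, ?_, ?_⟩⟩
  -- The difference from the expected circle solves a linear equation with skew-symmetric generator,
  -- so its norm is conserved, and it starts at zero.
  · let g : ℝ → EE n := fun θ ↦ f₁ (β θ) - r x • (Real.cos θ • p + Real.sin θ • u)
    have hg : ∀ θ, HasDerivAt g ((inner ℝ (g θ) p : ℝ) • u - (inner ℝ (g θ) u : ℝ) • p) θ := by
      intro θ
      have h1 := (d.hasDerivAt_f₁_f₂ h (hβ θ) (hv _)).1
      have h2 := (((Real.hasDerivAt_cos θ).smul_const p).add
        ((Real.hasDerivAt_sin θ).smul_const u)).const_smul (r x)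
      convert! h1.sub h2 using 1
      have hup : inner ℝ u p = (0 : ℝ) := by rw [real_inner_comm]; exact hpu
      simp only [g, inner_sub_left, inner_add_left, real_inner_smul_left, hpu, hup,
        real_inner_self_eq_norm_sq, hp, hu]
      module
    have h2 : ∀ θ, HasDerivAt (fun θ ↦ ‖g θ‖ ^ 2) 0 θ := by
      intro θ
      convert! (hg θ).norm_sq using 1
      rw [inner_sub_right, real_inner_smul_right, real_inner_smul_right]
      ring
    have h3 := hconst _ h2 θ
    have h4 : g 0 = 0 := by simp [g, hβ0, hx]
    rw [h4, norm_zero, zero_pow two_ne_zero, sq_eq_zero_iff, norm_eq_zero] at h3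
    exact sub_eq_zero.1 h3
  · rw [hconst (fun t ↦ f₂ (β t)) (fun t ↦ (d.hasDerivAt_f₁_f₂ h (hβ t) (hv _)).2), hβ0]
  · rw [hconst (fun t ↦ ξ (β t)) (fun t ↦ by
      simpa only [hev, mul_zero, zero_smul] using d.hasDerivAt_ξ h (hβ t) (hv _)), hβ0]
  · rw [hconst (fun t ↦ lam (β t)) (fun t ↦ by
      simpa only [hev, mul_zero] using d.hasDerivAt_lam (hβ t)), hβ0]

end RotationalData
end Rotation

/-! ### Polar coordinates on the sphere -/

section PolarCoordinates

variable {n : ℕ} (p : EE n)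

/-- Polar coordinates on the unit sphere. -/
def polar (a : Set.Icc 0 Real.pi × sphere (0 : (Submodule.span ℝ {p})ᗮ) 1) : EE n :=
  Real.cos a.1 • p + Real.sin a.1 • (a.2 : (Submodule.span ℝ {p})ᗮ)

theorem continuous_polar : Continuous (polar p) := by
  unfold polar
  fun_prop

variable {p} (hp : ‖p‖ = 1)

theorem inner_equator (a : sphere (0 : (Submodule.span ℝ {p})ᗮ) 1) :
    inner ℝ p (a : (Submodule.span ℝ {p})ᗮ) = (0 : ℝ) :=
  Submodule.inner_right_of_mem_orthogonal (Submodule.mem_span_singleton_self p) a.1.2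

theorem norm_equator (a : sphere (0 : (Submodule.span ℝ {p})ᗮ) 1) :
    ‖((a : (Submodule.span ℝ {p})ᗮ) : EE n)‖ = 1 := by
  have := a.2
  rwa [mem_sphere_zero_iff_norm, Submodule.coe_norm] at this

include hp

theorem norm_polar (a) : ‖polar p a‖ = 1 := by
  have h1 : ‖polar p a‖ ^ 2 = 1 := by
    rw [polar, ← real_inner_self_eq_norm_sq]
    simp only [inner_add_left, inner_add_right, real_inner_smul_left, real_inner_smul_right,
      inner_equator, real_inner_self_eq_norm_sq, norm_smul, norm_equator, hp, real_inner_comm p,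
      Real.norm_eq_abs, mul_one, sq_abs]
    linear_combination Real.cos_sq_add_sin_sq (a.1 : ℝ)
  exact (pow_eq_one_iff_of_nonneg (norm_nonneg _) two_ne_zero).1 h1

theorem inner_polar (a) : inner ℝ p (polar p a) = Real.cos a.1 := by
  rw [polar, inner_add_right, real_inner_smul_right, real_inner_smul_right, inner_equator,
    real_inner_self_eq_norm_sq, hp]
  ring

/-- The component along `p` determines the angle, `cos` being injective on `[0, π]`; the equatorial
point is lost only where `sin` vanishes, at the two poles. -/
theorem polar_eq_polar {a b} (hab : polar p a = polar p b) :
    a = b ∨ a.1 = b.1 ∧ ((a.1 : ℝ) = 0 ∨ (a.1 : ℝ) = Real.pi) := by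
  have h1 := congrArg (fun z ↦ (inner ℝ p z : ℝ)) hab
  simp only [inner_polar hp] at h1
  have h2 : a.1 = b.1 := Subtype.ext (Real.injOn_cos a.1.2 b.1.2 h1)
  by_cases hs : Real.sin a.1 = 0
  · refine Or.inr ⟨h2, ?_⟩
    by_contra! h3
    exact (Real.sin_pos_of_pos_of_lt_pi (a.1.2.1.lt_of_ne h3.1.symm)
      (a.1.2.2.lt_of_ne h3.2)).ne' hs
  · left
    rw [polar, polar, ← h2] at hab
    exact Prod.ext h2 (Subtype.ext (Subtype.ext (smul_right_injective _ hs (add_left_cancel hab))))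

theorem polar_surjective (hn : Nonempty (sphere (0 : (Submodule.span ℝ {p})ᗮ) 1)) {q : EE n}
    (hq : ‖q‖ = 1) : ∃ a, polar p a = q := by
  set c : ℝ := inner ℝ p q with hc
  have hc1 : |c| ≤ 1 := (abs_real_inner_le_norm _ _).trans (by rw [hp, hq, mul_one])
  have hw : q - c • p ∈ (Submodule.span ℝ {p})ᗮ := by
    rw [Submodule.mem_orthogonal_singleton_iff_inner_right, inner_sub_right, real_inner_smul_right,
      real_inner_self_eq_norm_sq, hp]
    ring
  have hwn : ‖q - c • p‖ = Real.sqrt (1 - c ^ 2) := by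
    rw [← Real.sqrt_sq (norm_nonneg _), ← real_inner_self_eq_norm_sq]
    congr 1
    have : inner ℝ q p = c := by rw [hc, real_inner_comm]
    simp only [inner_sub_left, inner_sub_right, real_inner_smul_left, real_inner_smul_right,
      real_inner_self_eq_norm_sq, norm_smul, Real.norm_eq_abs, hp, hq, this, ← hc, mul_one, sq_abs]
    ring
  have hcos : Real.cos (Real.arccos c) = c :=
    Real.cos_arccos (abs_le.1 hc1).1 (abs_le.1 hc1).2
  have hsin : Real.sin (Real.arccos c) = ‖q - c • p‖ := by rw [Real.sin_arccos, hwn]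
  obtain ⟨u, hu⟩ : ∃ u : sphere (0 : (Submodule.span ℝ {p})ᗮ) 1,
      ‖q - c • p‖ • ((u : (Submodule.span ℝ {p})ᗮ) : EE n) = q - c • p := by
    by_cases h0 : q - c • p = 0
    · exact ⟨hn.some, by rw [h0, norm_zero, zero_smul]⟩
    · have h1 := norm_ne_zero_iff.2 h0
      refine ⟨⟨⟨‖q - c • p‖⁻¹ • (q - c • p), Submodule.smul_mem _ _ hw⟩, ?_⟩, ?_⟩
      · rw [mem_sphere_zero_iff_norm, Submodule.coe_norm, norm_smul, norm_inv, norm_norm,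
          inv_mul_cancel₀ h1]
      · rw [smul_smul, mul_inv_cancel₀ h1, one_smul]
  refine ⟨(⟨Real.arccos c, Real.arccos_nonneg c, Real.arccos_le_pi c⟩, u), ?_⟩
  rw [polar, hcos, hsin, hu]
  abel

end PolarCoordinates

/-! ### Construction of the parametrization from rotations and profile curves -/

section RotationFamily

variable {n : ℕ} {M : Type*} [EMetricSpace M] [ChartedSpace (EE n) M]

/-- A map from `S^{n-1} × ℝ` which sends rotations of the sphere to rotations of the hypersurface
and whose second argument parametrizes integral curves of `e`. -/
structure IsRotationFamily (lam : M → ℝ) (f₁ : M → EE n) (f₂ : M → EE 2) (r : M → ℝ)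
    (e : ∀ x : M, TangentSpace (𝓡 n) x) (Ψ : USphere n × ℝ → M) : Prop where
  continuous : Continuous Ψ
  f₁_eq : ∀ p s, f₁ (Ψ (p, s)) = r (Ψ (p, s)) • (p : EE n)
  f₂_eq : ∀ p q s, f₂ (Ψ (p, s)) = f₂ (Ψ (q, s))
  r_eq : ∀ p q s, r (Ψ (p, s)) = r (Ψ (q, s))
  lam_eq : ∀ p q s, lam (Ψ (p, s)) = lam (Ψ (q, s))
  curve : ∀ p, IsMIntegralCurve (fun s ↦ Ψ (p, s)) e

variable [Bundle.RiemannianBundle (fun x : M ↦ TangentSpace (𝓡 n) x)]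
  {f N : M → EE (n + 2)} {lam mu : M → ℝ} {A : WithLp 2 (EE n × EE 2) ≃ₗᵢ[ℝ] EE (n + 2)}
  {f₁ : M → EE n} {f₂ ξ : M → EE 2} {r κ : M → ℝ} {e : ∀ x : M, TangentSpace (𝓡 n) x}

namespace RotationalData

variable (d : RotationalData f N lam mu A f₁ f₂ ξ r κ e) (h : IsOrientedHypersurface f N)
  [IsManifold (𝓡 n) ∞ M]
include d h

theorem contMDiff_e :
    ContMDiff (𝓡 n) (𝓡 n).tangent 1 (fun x ↦ (⟨x, e x⟩ : TangentBundle (𝓡 n) M)) := by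
  exact h.contMDiff_vectorField d.contMDiff_direction d.diffl_e

theorem exists_integralCurve [IsRiemannianManifold (𝓡 n) M] [CompleteSpace M] (x : M) :
    ∃ γ : ℝ → M, γ 0 = x ∧ IsMIntegralCurve γ e := by
  refine h.exists_integralCurve d.contMDiff_direction d.diffl_e (C := 1) (fun x ↦ ?_) x
  rw [← d.diffl_e, NNReal.coe_one]
  have h1 := h.isometric x (e x) (e x)
  rw [d.inner_e, real_inner_self_eq_norm_sq] at h1
  exact ((pow_eq_one_iff_of_nonneg (norm_nonneg _) two_ne_zero).1 h1).le

omit [IsManifold (𝓡 n) ∞ M] h in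
theorem κ_eq_of_eq {x y : M} (h₂ : f₂ x = f₂ y) (hr : r x = r y) (hξ : ξ x = ξ y) : κ x = κ y := by
  have h1 := d.κ_mul_r x
  rw [hξ, h₂, ← d.κ_mul_r y, hr] at h1
  exact mul_right_cancel₀ (d.r_pos y).ne' h1

variable [Fact (3 ≤ n)]

/-- Take the profile curve `γ` through `x`, with direction `p`, and rotate each `γ s` from `p`
towards all equatorial directions. In polar coordinates this defines a map on the sphere once the
poles are shown to be harmless: at angle `0` it is `γ s`, and at angle `π` it is independent of the
direction. -/
theorem exists_rotationFamily [IsRiemannianManifold (𝓡 n) M] [CompleteSpace M] (x : M) :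
    ∃ (Ψ : USphere n × ℝ → M) (p : USphere n), Ψ (p, 0) = x ∧
      IsRotationFamily lam f₁ f₂ r e Ψ := by
  have hn : 3 ≤ n := Fact.out
  obtain ⟨γ, hγ0, hγ⟩ := d.exists_integralCurve h x
  have hγc : Continuous γ := continuous_iff_continuousAt.2 fun t ↦ (hγ t).continuousAt
  set p : EE n := (r (γ 0))⁻¹ • f₁ (γ 0) with hpdef
  have hp : ‖p‖ = 1 := by
    rw [hpdef, norm_smul, d.norm_f₁, norm_inv, Real.norm_of_nonneg (d.r_pos _).le,
      inv_mul_cancel₀ (d.r_pos _).ne']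
  have hγp : ∀ s, f₁ (γ s) = r (γ s) • p := fun s ↦ by
    rw [hpdef, ← d.inv_r_smul_f₁_eq h hγ s 0, smul_smul, mul_inv_cancel₀ (d.r_pos _).ne', one_smul]
  let K := (Submodule.span ℝ {p})ᗮ
  have hK : 1 < Module.rank ℝ K := by
    have h1 := Submodule.finrank_add_finrank_orthogonal (Submodule.span ℝ {p})
    rw [finrank_span_singleton (norm_ne_zero_iff.1 (by rw [hp]; exact one_ne_zero)),
      finrank_euclideanSpace_fin] at h1
    rw [← Module.finrank_eq_rank, ← Nat.cast_one, Nat.cast_lt]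
    change 1 < Module.finrank ℝ (Submodule.span ℝ {p})ᗮ
    omega
  have : Nontrivial K := by
    rw [← rank_pos_iff_nontrivial (R := ℝ)]
    exact zero_lt_one.trans hK
  have hS : Nonempty (sphere (0 : K) 1) := (NormedSpace.sphere_nonempty.2 zero_le_one).to_subtype
  have hSc : PreconnectedSpace (sphere (0 : K) 1) :=
    Subtype.preconnectedSpace (isPreconnected_sphere hK _ _)
  have hcomp : CompactSpace (sphere (0 : K) 1) := isCompact_iff_compactSpace.1 (isCompact_sphere _ _)
  choose β hβc hβ0 hβ using fun (a : sphere (0 : K) 1 × ℝ) ↦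
    d.exists_rotation_curve h hp (norm_equator a.1) (inner_equator a.1) (hγp a.2)
  let G : ℝ × (sphere (0 : K) 1 × ℝ) → M := fun b ↦ β b.2 b.1
  have hfG : ∀ b, f (G b) = A (WithLp.toLp 2
      (r (γ b.2.2) • (Real.cos b.1 • p + Real.sin b.1 • ((b.2.1 : K) : EE n)), f₂ (γ b.2.2))) :=
    fun b ↦ by rw [d.f_eq, (hβ b.2 b.1).1, (hβ b.2 b.1).2.1]
  have : LocallyCompactSpace M := ChartedSpace.locallyCompactSpace (EE n) M
  have hsep : IsSeparatedMap f := T2Space.isSeparatedMap f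
  -- The rotation curves were chosen separately for each parameter. Their images under `f` depend
  -- continuously on everything, and they start on the continuous curve `γ`, so lifting gives joint
  -- continuity.
  have hG : Continuous G := by
    refine continuous_lift_of_isLocallyInjective h.contMDiff.continuous h.isLocallyInjective 0 ?_ ?_
      (fun a ↦ hβc a)
    · have h1 : f ∘ G = _ := funext hfG
      rw [h1]
      refine (contDiff_split A).continuous.comp (Continuous.prodMk ?_ ?_)
      · have := d.smooth_r.continuous
        fun_prop
      · have := d.smooth_f₂.continuous
        fun_prop
    · simp only [G, hβ0]
      exact hγc.comp continuous_snd
  -- At angle `π` the composition with `f` does not depend on the equatorial point. The equator is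
  -- connected because `n ≥ 3`, and `f` is locally injective.
  have hGπ : ∀ s u u', G (Real.pi, (u, s)) = G (Real.pi, (u', s)) := by
    intro s
    refine hsep.const_of_comp h.isLocallyInjective
      (g := fun u ↦ G (Real.pi, (u, s))) (hG.comp (by fun_prop)) fun u u' ↦ ?_
    rw [hfG, hfG]
    simp
  have hpol : ∀ q : USphere n, ∃ a, polar p a = (q : EE n) := fun q ↦
    polar_surjective hp hS (mem_sphere_zero_iff_norm.1 q.2)
  choose σ hσ using hpol
  let Ψ : USphere n × ℝ → M := fun q ↦ G ((σ q.1).1, ((σ q.1).2, q.2))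
  let φ : Set.Icc 0 Real.pi × sphere (0 : K) 1 → USphere n := fun a ↦
    ⟨polar p a, mem_sphere_zero_iff_norm.2 (norm_polar hp a)⟩
  have hΨφ : ∀ a s, Ψ (φ a, s) = G (a.1, (a.2, s)) := by
    intro a s
    rcases polar_eq_polar hp (hσ (φ a)) with hab | ⟨hab, h0 | hπ⟩
    · simp only [Ψ, hab]
    · simp only [Ψ, ← hab, h0, G, hβ0]
    · simp only [Ψ, ← hab, hπ]
      exact hGπ _ _ _
  have hφc : Continuous φ := (continuous_polar p).subtype_mk _
  have hφs : Function.Surjective φ := fun q ↦ ⟨σ q, Subtype.ext (hσ q)⟩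
  have hφp : IsProperMap φ := hφc.isProperMap
  -- Polar coordinates have compact domain, so they form a proper map; this survives the product
  -- with `ℝ` and lets continuity descend.
  have hquot : Topology.IsQuotientMap (Prod.map φ (id : ℝ → ℝ)) :=
    (hφp.prodMap isProperMap_id).isClosedMap.isQuotientMap (hφc.prodMap continuous_id)
      (hφs.prodMap Function.surjective_id)
  have hΨc : Continuous Ψ := by
    rw [hquot.continuous_iff]
    have h1 : Ψ ∘ Prod.map φ (id : ℝ → ℝ) = fun b ↦ G ((b.1.1 : ℝ), (b.1.2, b.2)) :=
      funext fun b ↦ hΨφ b.1 b.2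
    rw [h1]
    exact hG.comp (by fun_prop)
  have hf₁ : ∀ q s, f₁ (Ψ (q, s)) = r (γ s) • (q : EE n) := fun q s ↦ by
    rw [← hσ q]; exact (hβ ((σ q).2, s) (σ q).1).1
  have hf₂ : ∀ q s, f₂ (Ψ (q, s)) = f₂ (γ s) := fun q s ↦ (hβ ((σ q).2, s) (σ q).1).2.1
  have hξ : ∀ q s, ξ (Ψ (q, s)) = ξ (γ s) := fun q s ↦ (hβ ((σ q).2, s) (σ q).1).2.2.1
  have hl : ∀ q s, lam (Ψ (q, s)) = lam (γ s) := fun q s ↦ (hβ ((σ q).2, s) (σ q).1).2.2.2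
  have hr : ∀ q s, r (Ψ (q, s)) = r (γ s) := fun q s ↦ by
    rw [← d.norm_f₁, hf₁, norm_smul, Real.norm_of_nonneg (d.r_pos _).le,
      mem_sphere_zero_iff_norm.1 q.2, mul_one]
  refine ⟨Ψ, ⟨p, mem_sphere_zero_iff_norm.2 hp⟩, ?_, hΨc, fun q s ↦ by rw [hf₁, hr],
    fun q q' s ↦ by rw [hf₂, hf₂], fun q q' s ↦ by rw [hr, hr], fun q q' s ↦ by rw [hl, hl],
    fun q s ↦ ?_⟩
  · have h1 : (⟨p, mem_sphere_zero_iff_norm.2 hp⟩ : USphere n)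
        = φ (⟨0, le_rfl, Real.pi_pos.le⟩, hS.some) := by
      apply Subtype.ext
      simp [φ, polar]
    rw [h1, hΨφ]
    simp only [G, hβ0, hγ0]
  · refine h.hasMFDerivAt_of_comp (by fun_prop) ?_
    have h1 : f ∘ (fun s ↦ Ψ (q, s)) = fun s ↦
        A.toContinuousLinearEquiv.toContinuousLinearMap.comp
          (WithLp.prodContinuousLinearEquiv 2 ℝ (EE n) (EE 2)).symm.toContinuousLinearMap
          (r (γ s) • (q : EE n), f₂ (γ s)) := by
      funext s
      simp only [Function.comp_apply]
      rw [d.f_eq, hf₁, hf₂]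
      rfl
    rw [h1, d.diffl_e, hf₁, hr, hξ, d.κ_eq_of_eq (hf₂ q s) (hr q s) (hξ q s), smul_smul, ← neg_smul]
    exact (ContinuousLinearMap.hasFDerivAt _).comp_hasDerivAt s
      (((d.hasDerivAt_r h hγ s).smul_const (q : EE n)).prodMk (d.hasDerivAt_f₂ h hγ s))

end RotationalData

end RotationFamily

/-! ### Rigidity, metric and local invertibility of rotation families -/

section RotationFamilyGeometry

variable {n : ℕ} {M : Type*} [EMetricSpace M] [ChartedSpace (EE n) M]
  [Bundle.RiemannianBundle (fun x : M ↦ TangentSpace (𝓡 n) x)]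
  {f N : M → EE (n + 2)} {lam mu : M → ℝ} {A : WithLp 2 (EE n × EE 2) ≃ₗᵢ[ℝ] EE (n + 2)}
  {f₁ : M → EE n} {f₂ ξ : M → EE 2} {r κ : M → ℝ} {e : ∀ x : M, TangentSpace (𝓡 n) x}

/-- The differential of the inclusion of the sphere. -/
def coeDiff [Fact (3 ≤ n)] (p : USphere n) : TangentSpace (𝓡 (n - 1)) p →ₗ[ℝ] EE n :=
  (mfderiv (𝓡 (n - 1)) 𝓘(ℝ, EE n) (fun q : USphere n ↦ (q : EE n)) p :
    TangentSpace (𝓡 (n - 1)) p →L[ℝ] EE n).toLinearMap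

/-- The differential of a map from `S^{n-1} × ℝ`. -/
def familyDiff [Fact (3 ≤ n)] (Ψ : USphere n × ℝ → M) (p : USphere n) (s : ℝ)
    (u : TangentSpace (𝓡 (n - 1)) p) (a : ℝ) : TangentSpace (𝓡 n) (Ψ (p, s)) :=
  mfderiv ((𝓡 (n - 1)).prod 𝓘(ℝ, ℝ)) (𝓡 n) Ψ (p, s)
    ((u, a) : TangentSpace (𝓡 (n - 1)) p × ℝ)

theorem inner_coeDiff [Fact (3 ≤ n)] (p : USphere n) (u : TangentSpace (𝓡 (n - 1)) p) :
    inner ℝ (coeDiff p u) (p : EE n) = (0 : ℝ) := by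
  have h1 : coeDiff p u ∈ (Submodule.span ℝ {(p : EE n)})ᗮ := by
    rw [← range_mvfderiv_subtypeVal (n := n - 1) p]
    exact ⟨u, rfl⟩
  exact Submodule.inner_left_of_mem_orthogonal (Submodule.mem_span_singleton_self _) h1

theorem coeDiff_injective [Fact (3 ≤ n)] (p : USphere n) : Function.Injective (coeDiff p) :=
  injective_mvfderiv_subtypeVal_sphere (n := n - 1) p

namespace IsRotationFamily

variable {Ψ Ψ' : USphere n × ℝ → M} (hΨ : IsRotationFamily lam f₁ f₂ r e Ψ)
  (hΨ' : IsRotationFamily lam f₁ f₂ r e Ψ')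
  (d : RotationalData f N lam mu A f₁ f₂ ξ r κ e) (h : IsOrientedHypersurface f N)
include hΨ d

theorem f_eq (p₀ p : USphere n) (s : ℝ) :
    f (Ψ (p, s)) = A (WithLp.toLp 2 (r (Ψ (p₀, s)) • (p : EE n), f₂ (Ψ (p₀, s)))) := by
  rw [d.f_eq, hΨ.f₁_eq, hΨ.f₂_eq p p₀, hΨ.r_eq p p₀]

section Rigidity

variable [IsManifold (𝓡 n) ∞ M]
include hΨ' h

/-- Two rotation families which meet agree up to a translation. -/
theorem rigid [Fact (3 ≤ n)] {p p' : USphere n} {s s' : ℝ} (hp : Ψ (p, s) = Ψ' (p', s')) :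
    p = p' ∧ ∀ q t, Ψ (q, s + t) = Ψ' (q, s' + t) := by
  have h1 := hΨ.f₁_eq p s
  rw [hp, hΨ'.f₁_eq] at h1
  have h2 : p = p' := Subtype.ext (smul_right_injective _ (d.r_pos _).ne' h1).symm
  subst h2
  have h3 : (fun t ↦ Ψ (p, s + t)) = fun t ↦ Ψ' (p, s' + t) := by
    have e1 := (hΨ.curve p).comp_add s
    have e2 := (hΨ'.curve p).comp_add s'
    have e3 := isMIntegralCurve_Ioo_eq_of_contMDiff_boundaryless (t₀ := 0) (d.contMDiff_e h) e1 e2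
      (by simpa using hp)
    simpa only [Function.comp_def, add_comm] using e3
  refine ⟨rfl, fun q t ↦ ?_⟩
  have h4 : Ψ (p, s + t) = Ψ' (p, s' + t) := congrFun h3 t
  have hconn : PreconnectedSpace (USphere n) := by
    refine Subtype.preconnectedSpace (isPreconnected_sphere ?_ _ _)
    have hn : 3 ≤ n := Fact.out
    rw [← Module.finrank_eq_rank, ← Nat.cast_one, Nat.cast_lt, finrank_euclideanSpace_fin]
    omega
  -- On the slice at time `t` both maps lift the same map through `f`, agree at `p`, and the sphere
  -- is connected.
  refine congrFun ((T2Space.isSeparatedMap f).eq_of_comp_eq h.isLocallyInjective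
    (g₁ := fun q ↦ Ψ (q, s + t)) (g₂ := fun q ↦ Ψ' (q, s' + t))
    (hΨ.continuous.comp (by fun_prop)) (hΨ'.continuous.comp (by fun_prop)) ?_ p h4) q
  funext q
  simp only [Function.comp_apply]
  rw [hΨ.f_eq d p, hΨ'.f_eq d p, h4]

end Rigidity

section Differential

variable [Fact (3 ≤ n)] [IsManifold (𝓡 n) ∞ M]
include h

theorem contMDiff_comp :
    ContMDiff ((𝓡 (n - 1)).prod 𝓘(ℝ, ℝ)) 𝓘(ℝ, EE (n + 2)) ∞ (f ∘ Ψ) := by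
  intro q
  have hγ := d.contMDiff_integralCurve h (hΨ.curve q.1)
  have h1 : f ∘ Ψ = fun q' : USphere n × ℝ ↦
      A (WithLp.toLp 2 (r (Ψ (q.1, q'.2)) • (q'.1 : EE n), f₂ (Ψ (q.1, q'.2)))) :=
    funext fun q' ↦ hΨ.f_eq d q.1 q'.1 q'.2
  rw [h1]
  have h2 : ContMDiff ((𝓡 (n - 1)).prod 𝓘(ℝ, ℝ)) 𝓘(ℝ, EE n) ∞
      fun q' : USphere n × ℝ ↦ r (Ψ (q.1, q'.2)) • (q'.1 : EE n) :=
    ((d.smooth_r.comp hγ).comp contMDiff_snd).smul (contMDiff_coe_sphere.comp contMDiff_fst)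
  have h3 : ContMDiff ((𝓡 (n - 1)).prod 𝓘(ℝ, ℝ)) 𝓘(ℝ, EE 2) ∞
      fun q' : USphere n × ℝ ↦ f₂ (Ψ (q.1, q'.2)) :=
    (d.smooth_f₂.comp hγ).comp contMDiff_snd
  exact ((contDiff_split A).contMDiff.comp (h2.prodMk_space h3)) q

theorem contMDiff : ContMDiff ((𝓡 (n - 1)).prod 𝓘(ℝ, ℝ)) (𝓡 n) ∞ Ψ := fun q ↦
  h.contMDiffAt_of_comp hΨ.continuous.continuousAt (hΨ.contMDiff_comp d h q)

/-- Add the partial differentials: on a slice, `f ∘ Ψ` is the restriction of an affine map of `ℝⁿ`;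
in the second variable the curve has velocity `e`. -/
theorem mfderiv_apply (p : USphere n) (s : ℝ) (u : TangentSpace (𝓡 (n - 1)) p) (a : ℝ) :
    diffl f (Ψ (p, s)) (familyDiff Ψ p s u a) =
      A (WithLp.toLp 2 (r (Ψ (p, s)) • coeDiff p u, 0))
      + a • diffl f (Ψ (p, s)) (e (Ψ (p, s))) := by
  have hd := ((hΨ.contMDiff d h).contMDiffAt (x := (p, s))).mdifferentiableAt (by simp)
  have h1 : mfderiv 𝓘(ℝ, ℝ) (𝓡 n) (fun t ↦ Ψ (p, t)) s a = a • e (Ψ (p, s)) := by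
    rw [(hΨ.curve p s).mfderiv]
    rfl
  have h2 : diffl f (Ψ (p, s)) (mfderiv (𝓡 (n - 1)) (𝓡 n) (fun q ↦ Ψ (q, s)) p u) =
      A (WithLp.toLp 2 (r (Ψ (p, s)) • coeDiff p u, 0)) := by
    let A' : EE n →L[ℝ] EE (n + 2) := A.toContinuousLinearEquiv.toContinuousLinearMap.comp
      ((WithLp.prodContinuousLinearEquiv 2 ℝ (EE n) (EE 2)).symm.toContinuousLinearMap.comp
        (r (Ψ (p, s)) • ContinuousLinearMap.inl ℝ (EE n) (EE 2)))
    have e1 : f ∘ (fun q ↦ Ψ (q, s)) = (fun z : EE n ↦ A (WithLp.toLp 2 (0, f₂ (Ψ (p, s)))) + A' z) ∘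
        fun q : USphere n ↦ (q : EE n) := by
      funext q
      simp only [Function.comp_apply]
      rw [hΨ.f_eq d p]
      change _ = A _ + A (WithLp.toLp 2 (r (Ψ (p, s)) • ((q : EE n), (0 : EE 2))))
      rw [← map_add]
      congr 1
      refine WithLp.ofLp_injective 2 (Prod.ext ?_ ?_)
      · exact (zero_add _).symm
      · change _ = f₂ (Ψ (p, s)) + r (Ψ (p, s)) • (0 : EE 2)
        rw [smul_zero, add_zero]
    have hq : MDifferentiableAt (𝓡 (n - 1)) (𝓡 n) (fun q ↦ Ψ (q, s)) p :=
      ((hΨ.contMDiff d h).comp (contMDiff_id.prodMk contMDiff_const)).contMDiffAt.mdifferentiableAt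
        (by simp)
    have hA : HasFDerivAt (fun z : EE n ↦ A (WithLp.toLp 2 (0, f₂ (Ψ (p, s)))) + A' z) A' (p : EE n) :=
      A'.hasFDerivAt.const_add _
    have hι : MDifferentiableAt (𝓡 (n - 1)) 𝓘(ℝ, EE n) (fun q : USphere n ↦ (q : EE n)) p :=
      (contMDiff_coe_sphere (m := ∞)).contMDiffAt.mdifferentiableAt (by simp)
    have e2 := mfderiv_comp p (h.mdifferentiableAt (Ψ (p, s))) hq
    rw [e1, (hA.hasMFDerivAt.comp p hι.hasMFDerivAt).mfderiv] at e2
    have e3 := DFunLike.congr_fun e2 u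
    refine e3.symm.trans ?_
    change A (WithLp.toLp 2 (r (Ψ (p, s)) • (coeDiff p u, (0 : EE 2)))) = _
    rw [Prod.smul_mk, smul_zero]
  have h3 : familyDiff Ψ p s u a =
      mfderiv (𝓡 (n - 1)) (𝓡 n) (fun q ↦ Ψ (q, s)) p u + a • e (Ψ (p, s)) := by
    rw [← h1]
    exact mfderiv_prod_eq_add_apply hd
  rw [h3, map_add, h2, map_smul]

theorem inner_e_mfderiv (p : USphere n) (s : ℝ) (u : TangentSpace (𝓡 (n - 1)) p) (a : ℝ) :
    inner ℝ (e (Ψ (p, s))) (familyDiff Ψ p s u a) = a := by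
  rw [← h.isometric, hΨ.mfderiv_apply d h, inner_add_right, real_inner_smul_right, h.isometric,
    d.inner_e, d.diffl_e, inner_split, hΨ.f₁_eq, inner_neg_left, real_inner_smul_left,
    real_inner_smul_left, real_inner_smul_right, real_inner_comm, inner_coeDiff,
    inner_zero_right]
  ring

theorem norm_mfderiv_sq (p : USphere n) (s : ℝ) (u : TangentSpace (𝓡 (n - 1)) p) (a : ℝ) :
    ‖familyDiff Ψ p s u a‖ ^ 2
      = r (Ψ (p, s)) ^ 2 * sphereNorm p u ^ 2 + a ^ 2 := by
  have h1 := hΨ.inner_e_mfderiv d h p s u a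
  rw [← h.isometric] at h1
  have h2 := hΨ.mfderiv_apply d h p s u a
  have h3 := hΨ.inner_e_mfderiv d h p s u 0
  rw [← h.isometric, hΨ.mfderiv_apply d h, zero_smul, add_zero] at h3
  have h4 : sphereNorm p u = ‖coeDiff p u‖ := rfl
  rw [← real_inner_self_eq_norm_sq, ← h.isometric]
  nth_rw 1 [h2]
  rw [inner_add_left, real_inner_smul_left, h1, h2, inner_add_right, real_inner_smul_right,
    real_inner_comm (diffl f (Ψ (p, s)) (e (Ψ (p, s)))) (A _), h3, inner_split,
    inner_zero_left, real_inner_smul_left,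
    real_inner_smul_right, real_inner_self_eq_norm_sq, h4]
  ring

/-- The metric formula makes the differential injective, since `r > 0`, and `(n - 1) + 1 = n`. -/
theorem isLocalDiffeomorph :
    IsLocalDiffeomorph ((𝓡 (n - 1)).prod 𝓘(ℝ, ℝ)) (𝓡 n) ∞ Ψ := by
  rintro ⟨p, s⟩
  apply isLocalDiffeomorphAt_of_bijective (hΨ.contMDiff d h)
  let L : (EE (n - 1) × ℝ) →ₗ[ℝ] EE n :=
    (mfderiv ((𝓡 (n - 1)).prod 𝓘(ℝ, ℝ)) (𝓡 n) Ψ (p, s) :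
      (EE (n - 1) × ℝ) →L[ℝ] EE n).toLinearMap
  have hinj : Function.Injective L := by
    rw [← LinearMap.ker_eq_bot, LinearMap.ker_eq_bot']
    rintro ⟨u, a⟩ hua
    have h1 := hΨ.norm_mfderiv_sq d h p s u a
    have h2 : familyDiff Ψ p s u a = 0 := hua
    rw [h2, norm_zero, zero_pow two_ne_zero] at h1
    have h3 := d.r_pos (Ψ (p, s))
    have h4 : a = 0 := by
      nlinarith [mul_nonneg (sq_nonneg (r (Ψ (p, s))))
        (sq_nonneg (sphereNorm p u))]
    rw [h4, zero_pow two_ne_zero, add_zero, zero_eq_mul] at h1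
    have h5 : sphereNorm p u = 0 := pow_eq_zero_iff two_ne_zero |>.1
      (h1.resolve_left (pow_ne_zero 2 h3.ne'))
    have h7 : u = 0 := coeDiff_injective p ((norm_eq_zero.1 h5).trans (map_zero _).symm)
    rw [h4, h7]
    rfl
  have hfr : Module.finrank ℝ (EE (n - 1) × ℝ) = Module.finrank ℝ (EE n) := by
    have hn : 3 ≤ n := Fact.out
    rw [Module.finrank_prod, finrank_euclideanSpace_fin, finrank_euclideanSpace_fin,
      Module.finrank_self]
    omega
  exact ⟨hinj, (LinearMap.injective_iff_surjective_of_finrank_eq_finrank hfr).1 hinj⟩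

end Differential
end IsRotationFamily
end RotationFamilyGeometry

/-! ### Surjectivity, periods and the global diffeomorphism -/

section GlobalParametrization

variable {n : ℕ} {M : Type*} [EMetricSpace M] [ChartedSpace (EE n) M]
  [Bundle.RiemannianBundle (fun x : M ↦ TangentSpace (𝓡 n) x)]
  {f N : M → EE (n + 2)} {lam mu : M → ℝ} {A : WithLp 2 (EE n × EE 2) ≃ₗᵢ[ℝ] EE (n + 2)}
  {f₁ : M → EE n} {f₂ ξ : M → EE 2} {r κ : M → ℝ} {e : ∀ x : M, TangentSpace (𝓡 n) x}
  [IsManifold (𝓡 n) ∞ M] [Fact (3 ≤ n)]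

/-- Ranges of rotation families are open. If the range of a family through `x` meets that of `Ψ`,
rigidity makes the two families translates of each other and `x` is reached by `Ψ`. So the
complement of the range is open as well. -/
theorem IsRotationFamily.surjective [ConnectedSpace M] [IsRiemannianManifold (𝓡 n) M]
    [CompleteSpace M] {Ψ : USphere n × ℝ → M} (hΨ : IsRotationFamily lam f₁ f₂ r e Ψ)
    (d : RotationalData f N lam mu A f₁ f₂ ξ r κ e) (h : IsOrientedHypersurface f N) :
    Function.Surjective Ψ := by
  have hopen : ∀ {Ψ : USphere n × ℝ → M}, IsRotationFamily lam f₁ f₂ r e Ψ →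
      IsOpen (Set.range Ψ) := fun hΨ ↦ (hΨ.isLocalDiffeomorph d h).isOpen_range
  rw [← Set.range_eq_univ]
  obtain ⟨x₀⟩ := ‹ConnectedSpace M›.toNonempty
  have hne : (Set.range Ψ).Nonempty := by
    obtain ⟨-, p, -⟩ := d.exists_rotationFamily h x₀
    exact ⟨Ψ (p, 0), Set.mem_range_self _⟩
  refine IsClopen.eq_univ ⟨⟨?_⟩, hopen hΨ⟩ hne
  rw [isOpen_iff_mem_nhds]
  intro x hx
  obtain ⟨Ψ', p', hx', hΨ'⟩ := d.exists_rotationFamily h x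
  refine Filter.mem_of_superset ((hopen hΨ').mem_nhds ⟨_, hx'⟩) ?_
  rintro _ ⟨⟨q', s'⟩, rfl⟩ ⟨⟨q, s⟩, hq⟩
  apply hx
  refine ⟨(p', s + -s'), ?_⟩
  rw [(hΨ.rigid hΨ' d h hq).2, add_neg_cancel, hx']

/-- The periods of a rotation family. -/
def periods (Ψ : USphere n × ℝ → M) : AddSubgroup ℝ where
  carrier := {t | ∀ q s, Ψ (q, s + t) = Ψ (q, s)}
  zero_mem' q s := by rw [add_zero]
  add_mem' {a b} ha hb q s := by rw [← add_assoc, hb, ha]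
  neg_mem' {a} ha q s := by rw [← ha q (s + -a), neg_add_cancel_right]

/-- Local injectivity near `(p, 0)` excludes small positive periods, and a subgroup of `ℝ` with
isolated zero is cyclic. The aperiodic case is `T = 0`. -/
theorem IsRotationFamily.exists_period {Ψ : USphere n × ℝ → M}
    (hΨ : IsRotationFamily lam f₁ f₂ r e Ψ)
    (d : RotationalData f N lam mu A f₁ f₂ ξ r κ e) (h : IsOrientedHypersurface f N)
    (p : USphere n) : ∃ T : ℝ, 0 ≤ T ∧ periods Ψ = AddSubgroup.zmultiples T := by
  obtain ⟨U, hU, hpU, hinj⟩ := (hΨ.isLocalDiffeomorph d h).isLocalHomeomorph.isLocallyInjective (p, 0)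
  obtain ⟨ε, hε, hball⟩ := Metric.isOpen_iff.1 hU (p, 0) hpU
  have hdis : Disjoint (periods Ψ : Set ℝ) (Set.Ioo 0 ε) := by
    rw [Set.disjoint_left]
    intro t ht ht'
    have h1 : Ψ (p, t) = Ψ (p, 0) := by simpa using ht p 0
    have h2 : ((p, t) : USphere n × ℝ) ∈ U := by
      apply hball
      rw [mem_ball, Prod.dist_eq, dist_self, Real.dist_0_eq_abs, abs_of_pos ht'.1]
      exact max_lt hε ht'.2
    have h3 := hinj h2 hpU h1
    exact ht'.1.ne' (congrArg Prod.snd h3)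
  obtain ⟨b, hb⟩ := AddSubgroup.cyclic_of_isolated_zero hε hdis
  refine ⟨|b|, abs_nonneg b, ?_⟩
  rw [hb, ← AddSubgroup.zmultiples_eq_closure]
  rcases abs_choice b with hc | hc
  · rw [hc]
  · rw [hc, AddSubgroup.zmultiples_neg]

/-- Rigidity of `Ψ` against itself: two points with the same image have the same sphere component,
and their times differ by a period. Hence `Ψ` descends to an injective map on the quotient by the
periods, which remains open and continuous. -/
theorem exists_parametrization [ConnectedSpace M] [IsRiemannianManifold (𝓡 n) M]
    [CompleteSpace M] (d : RotationalData f N lam mu A f₁ f₂ ξ r κ e)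
    (h : IsOrientedHypersurface f N) :
    ∃ (T : ℝ) (Φ : USphere n × AddCircle T ≃ₜ M), 0 ≤ T ∧
      IsRotationFamily lam f₁ f₂ r e (lift Φ) := by
  obtain ⟨x₀⟩ := ‹ConnectedSpace M›.toNonempty
  obtain ⟨Ψ, p, -, hΨ⟩ := d.exists_rotationFamily h x₀
  obtain ⟨T, hT, hper⟩ := hΨ.exists_period d h p
  have hT' : T ∈ periods Ψ := hper ▸ AddSubgroup.mem_zmultiples T
  have hperiodic : ∀ q, Function.Periodic (fun s ↦ Ψ (q, s)) T := fun q s ↦ hT' q s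
  let F : USphere n × AddCircle T → M := fun q ↦ (hperiodic q.1).lift q.2
  let proj : USphere n × ℝ → USphere n × AddCircle T := Prod.map id (fun s ↦ (s : AddCircle T))
  have hproj : IsOpenQuotientMap proj :=
    IsOpenQuotientMap.id.prodMap QuotientAddGroup.isOpenQuotientMap_mk
  have hFproj : F ∘ proj = Ψ := rfl
  have hFc : Continuous F := by
    rw [hproj.isQuotientMap.continuous_iff, hFproj]
    exact hΨ.continuous
  have hFo : IsOpenMap F := by
    intro U hU
    have h1 : F '' U = Ψ '' (proj ⁻¹' U) := by
      rw [← hFproj, Set.image_comp, Set.image_preimage_eq _ hproj.surjective]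
    rw [h1]
    exact (hΨ.isLocalDiffeomorph d h).isLocalHomeomorph.isOpenMap _ (hU.preimage hproj.continuous)
  have hFs : Function.Surjective F := by
    intro x
    obtain ⟨q, hq⟩ := hΨ.surjective d h x
    exact ⟨proj q, hq⟩
  have hFi : Function.Injective F := by
    intro a b hab
    obtain ⟨⟨q, s⟩, rfl⟩ := hproj.surjective a
    obtain ⟨⟨q', s'⟩, rfl⟩ := hproj.surjective b
    obtain ⟨rfl, h2⟩ := hΨ.rigid hΨ d h (show Ψ (q, s) = Ψ (q', s') from hab)
    have h3 : -s' + s ∈ AddSubgroup.zmultiples T := by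
      rw [← hper]
      intro q₀ t
      have := h2 q₀ (t - s')
      rw [add_sub_cancel] at this
      rw [← this]
      congr 2
      ring
    refine Prod.ext rfl ?_
    exact (QuotientAddGroup.eq.2 h3).symm
  exact ⟨T, (Equiv.ofBijective F ⟨hFi, hFs⟩).toHomeomorphOfContinuousOpen hFc hFo, hT, hΨ⟩

end GlobalParametrization

end SphereHypersurface

end

/-! ### Assembly of the theorem -/

open SphereHypersurface in
theorem theorem3p1 (n m : ℕ) [Fact (3 ≤ n)] (hm : 1 ≤ m) (hmn : m ≤ n)
    {M : Type*} [EMetricSpace M] [ConnectedSpace M] [CompleteSpace M]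
    [ChartedSpace (EE n) M] [IsManifold (𝓡 n) ∞ M]
    [Bundle.RiemannianBundle (fun x : M ↦ TangentSpace (𝓡 n) x)]
    [IsContMDiffRiemannianBundle (𝓡 n) ∞ (EE n) (fun x : M ↦ TangentSpace (𝓡 n) x)]
    [IsRiemannianManifold (𝓡 n) M]
    (f N : M → EE (n + 2)) (hf : IsOrientedHypersurface f N)
    (H : ℝ) (hH : ∀ x, meanCurvature f N m x = H)
    (lam mu : M → ℝ) (hlm : HasTwoPrincipalCurvatures f N lam mu)
    (hpos : ∀ x, 0 < lam x) :
    ∃ (T : ℝ) (Φ : USphere n × AddCircle T ≃ₜ M) (l : ℝ → ℝ),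
      0 ≤ T ∧
      -- `lam` is a smooth function `l` of `s` alone
      ContDiff ℝ ∞ l ∧
      (∀ p s, lam (lift Φ (p, s)) = l s) ∧
      (∀ s, H < l s ^ m) ∧
      -- the slices are the integral submanifolds of the principal curvature `lam`, and `s` is the
      -- arc length of their orthogonal trajectories
      (∀ p s u, shapeOperator f N (lift Φ (p, s)) (diffLift Φ p s u 0)
        = l s • diffLift Φ p s u 0) ∧
      (∀ p s a, shapeOperator f N (lift Φ (p, s)) (diffLift Φ p s 0 a)
        = mu (lift Φ (p, s)) • diffLift Φ p s 0 a) ∧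
      IsWarpedIsometry (sliceCurvature n m H l) Φ ∧
      IsRevolution f (fun s ↦ 1 / √(sliceCurvature n m H l s)) Φ ∧
      ContDiff ℝ ∞ (wFun n m H l) ∧
      ∀ s, deriv (deriv (wFun n m H l)) s - wFun n m H l s *
        (((n : ℝ) - m) * (wFun n m H l s ^ (-(n : ℤ)) + H) ^ ((2 - (m : ℝ)) / m)
            / (m * wFun n m H l s ^ n)
          - H * (wFun n m H l s ^ (-(n : ℤ)) + H) ^ ((2 - (m : ℝ)) / m) - 1) = 0 := by
  obtain ⟨A, f₁, f₂, ξ, r, κ, e, d⟩ := exists_rotationalData hf hlm hm hmn hH hpos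
  obtain ⟨T, Φ, hT, hΨ⟩ := exists_parametrization d hf
  obtain ⟨x₀⟩ := ‹ConnectedSpace M›.toNonempty
  let p₀ : USphere n := (Φ.symm x₀).1
  have ode := d.profileODE hf (hΨ.curve p₀) hlm hm hmn hH hpos
  -- The slice curvature is `1 + lam² + κ²`, which `r_sq` identifies with `r⁻²`.
  have hsc : ∀ p s, sliceCurvature n m H (fun s ↦ lam (lift Φ (p₀, s))) s
      = (r (lift Φ (p, s)) ^ 2)⁻¹ := fun p s ↦ by
    rw [ode.sliceCurvature_eq, hΨ.r_eq p p₀]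
    refine eq_inv_of_mul_eq_one_right ?_
    linear_combination d.r_sq (lift Φ (p₀, s))
  have hr : (fun s ↦ 1 / √(sliceCurvature n m H (fun s ↦ lam (lift Φ (p₀, s))) s))
      = fun s ↦ r (lift Φ (p₀, s)) := funext fun s ↦ by
    rw [hsc p₀, Real.sqrt_inv, Real.sqrt_sq (d.r_pos _).le, one_div, inv_inv]
  have hshape : ∀ p s u a, shapeOperator f N (lift Φ (p, s)) (diffLift Φ p s u a)
      = lam (lift Φ (p, s)) • diffLift Φ p s u a
        + ((mu (lift Φ (p, s)) - lam (lift Φ (p, s))) * a) • e (lift Φ (p, s)) :=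
    fun p s u a ↦ by
      rw [d.shape]
      congr 3
      exact hΨ.inner_e_mfderiv d hf p s u a
  have hcurve := d.contMDiff_integralCurve hf (hΨ.curve p₀)
  have hrd := d.hasDerivAt_r hf (hΨ.curve p₀)
  have hyd := d.hasDerivAt_f₂ hf (hΨ.curve p₀)
  refine ⟨T, Φ, fun s ↦ lam (lift Φ (p₀, s)), hT, ode.smooth_l, fun p s ↦ hΨ.lam_eq p p₀ s,
    ode.lt_pow, fun p s u ↦ ?_, fun p s a ↦ ?_, ⟨fun s ↦ ?_, hΨ.isLocalDiffeomorph d hf,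
      fun p s u a ↦ ?_⟩, ⟨fun s ↦ f₂ (lift Φ (p₀, s)), A, ?_, ?_, ?_, ?_, ?_, ?_⟩,
    ode.contDiff_wFun, ode.wFun_equation⟩
  · rw [hshape, mul_zero, zero_smul, add_zero, hΨ.lam_eq p p₀]
  · have h1 : diffLift Φ p s 0 a = a • e (lift Φ (p, s)) := by
      apply hf.diffl_injective
      refine (hΨ.mfderiv_apply d hf p s 0 a).trans ?_
      rw [map_zero, smul_zero, map_smul]
      refine (congrArg (· + _) (map_zero A)).trans (zero_add _)
    rw [hshape, h1]
    module
  · rw [hsc p₀]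
    exact inv_pos.2 (pow_pos (d.r_pos _) 2)
  · rw [hsc p, div_inv_eq_mul, mul_comm]
    exact hΨ.norm_mfderiv_sq d hf p s u a
  · rw [hr]
    exact contMDiff_iff_contDiff.1 (d.smooth_r.comp hcurve)
  · exact contMDiff_iff_contDiff.1 (d.smooth_f₂.comp hcurve)
  · intro s
    rw [hr]
    exact d.r_pos _
  · intro s
    have h1 := hf.inner_self (lift Φ (p₀, s))
    rw [d.f_eq, inner_split, real_inner_self_eq_norm_sq, real_inner_self_eq_norm_sq,
      d.norm_f₁] at h1
    rw [hr, h1]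
  · intro s
    -- Unit speed of the profile curve is the unit length of `df e`, split along the two factors:
    -- the first contributes `κ² r² = r'²`, the second the squared speed of `y`.
    have h1 := d.inner_e (lift Φ (p₀, s))
    rw [← hf.isometric, d.diffl_e, inner_split, inner_neg_neg, real_inner_smul_left,
      real_inner_smul_right, real_inner_self_eq_norm_sq, real_inner_self_eq_norm_sq,
      d.norm_f₁] at h1
    rw [hr, (hrd s).deriv, (hyd s).deriv, ← h1]
    ring
  · intro p s
    rw [hr]
    exact hΨ.f_eq d p₀ p s
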